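/- **Setting.** For $m\ge 0$ and $\Lambda\ge 1$ let $\omega(k)=(|k|^2+m^2)^{1/2}$ and $\tilde\eta(k)=(2\pi)^{-3/2}(2\omega(k))^{-1/2}\,\mathbf 1_{|k|\le\Lambda}(k)$ for $k\in\mathbb R^3$. Let $L^2_1(\mathbb R^3)$ be the space of $\alpha \in L^2(\mathbb R^3)$ with $(1+|\cdot|^2)^{1/2}\alpha\in L^2(\mathbb R^3)$. For an integer $N\ge 1$ and $\delta_N>0$, the (fermionic) Schrödinger–Klein–Gordon equations are $$ \begin{aligned} iN^{-1/3}\,\partial_t\varphi_j^t(x)&=\big(-N^{-2/3}\Delta+\Phi_\Lambda(x,t)\big)\varphi_j^t(x),\qquad j=1,\dots,N,\\ i\,\partial_t\alpha^t(k)&=N^{-1/3}\delta_N\,\omega(k)\,\alpha^t(k)+N^{-1}(2\pi)^{3/2}\,\tilde\eta(k)\,\mathcal F[\rho^t](k),\\ \Phi_\Lambda(x,t)&=\int_{\mathbb R^3}\tilde\eta(k)\big(e^{ikx}\alpha^t(k)+e^{-ikx}\overline{\alpha^t(k)}\big)\,dk, \end{aligned} $$ with $\rho^t=\sum_{j=1}^N|\varphi_j^t|^2$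 and $\mathcal F[f](k)=(2\pi)^{-3/2}\int e^{-ikx}f(x)\,dx$. Let $I\subseteq\mathbb R$ be an interval containing $0$ (for instance $I=\mathbb R$ or $I=[0,\infty)$). A solution on $I$ is a family $(\varphi_1^t,\dots,\varphi_N^t,\alpha^t)_{t\in I}$ with values in $H^2(\mathbb R^3)^N\times L^2_1(\mathbb R^3)$ that is strongly differentiable in $t\in I$ with respect to the norm of $L^2(\mathbb R^3)$ (one-sidedly at end points of $I$) and satisfies the equations for all $t\in I$. Put $p^t=\sum_{j=1}^N|\varphi_j^t\rangle\langle\varphi_j^t|$ and $q^t=1-p^t$. Further, $\|A\|_{\mathrm{Tr}}=\mathrm{Tr}\,|A|$ with $|A| = (A^*A)^{1/2}$, and $\|A\|_{\mathrm{HS}}=\sqrt{\mathrm{Tr}\,A^*A}$; $e^{ikx}$ denotes multiplication by $x\mapsto e^{ikx}$, and $p^t\nabla q^t$ is the bounded operator from $L^2(\mathbb R^3)$ to $L^2(\mathbb R^3)\otimes\mathbb C^3$ with components $\sum_{j=1}^N|\varphi_j^t\rangle\langle-\partial_l\varphi_j^t|\,q^t$, $l=1,2,3$. **Lemma.** There is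 a constant $C>0$, independent of $N,\delta_N,m,\Lambda,I,t,\tilde C$ and of the solution, such that the following holds. Let $(\varphi_1^t,\dots,\varphi_N^t,\alpha^t)$ be a solution on $I$ with $\varphi_1^0,\dots,\varphi_N^0$ orthonormal in $L^2(\mathbb R^3)$, and suppose that for some $\tilde C>0$ $$ \|p^0e^{ikx}q^0\|_{\mathrm{Tr}}\le\tilde C(1+|k|)N^{2/3}\ \text{ for all }k\in\mathbb R^3\qquad\text{and}\qquad\|p^0\nabla q^0\|_{\mathrm{Tr}}\le\tilde C N . $$ Then for all $t\in I$ $$ \|p^te^{ikx}q^t\|_{\mathrm{HS}}^2\le\|p^te^{ikx}q^t\|_{\mathrm{Tr}}\le 2\tilde C(1+|k|)N^{2/3}e^{C\Lambda^4(1+\|\alpha^0\|_2)(1+t^2)}\quad\text{for all }k\in\mathbb R^3 $$ and $$ \|p^t\nabla q^t\|_{\mathrm{Tr}}\le 2\tilde C N e^{C\Lambda^4(1+\|\alpha^0\|_2)(1+t^2)} . $$ -/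

import Mathlib

open MeasureTheory
open scoped ENNReal SchwartzMap LineDeriv Laplacian InnerProductSpace ComplexConjugate

noncomputable section

namespace SKG

/-! ### Trace norm and Hilbert-Schmidt norm of bounded operators -/

section Trace

theorem tsum_inner_sq {ι H : Type*} [NormedAddCommGroup H]
    [InnerProductSpace ℂ H] (b : HilbertBasis ι ℂ H) (x : H) :
    ∑' i, ENNReal.ofReal (‖⟪b i, x⟫_ℂ‖ ^ 2) = ENNReal.ofReal (‖x‖ ^ 2) := by
  have h := b.hasSum_inner_mul_inner x x
  have h2 : HasSum (fun i => ‖⟪b i, x⟫_ℂ‖ ^ 2) (‖x‖ ^ 2) := by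
    have h3 := Complex.hasSum_re h
    have h4 : (⟪x, x⟫_ℂ).re = ‖x‖ ^ 2 := by
      rw [inner_self_eq_norm_sq_to_K]
      norm_cast
    rw [h4] at h3
    refine h3.congr_fun ?_
    intro i
    rw [← inner_conj_symm x (b i), RCLike.conj_mul]
    norm_cast
  rw [← h2.tsum_eq, ENNReal.ofReal_tsum_of_nonneg (fun i => by positivity) h2.summable]

variable {H K : Type*} [NormedAddCommGroup H] [InnerProductSpace ℂ H] [CompleteSpace H]
  [NormedAddCommGroup K] [InnerProductSpace ℂ K] [CompleteSpace K]

/-- The trace `∑ᵢ ⟪eᵢ, P eᵢ⟫ ∈ [0, ∞]` of a nonnegative bounded operator `P`, computed in a Hilbert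
basis. The value does not depend on the basis, see `opTrace_eq`. -/
def opTrace (P : H →L[ℂ] H) : ℝ≥0∞ :=
  ∑' i : (exists_hilbertBasis ℂ H).choose,
    ENNReal.ofReal
      (RCLike.re ⟪(exists_hilbertBasis ℂ H).choose_spec.choose i,
        P ((exists_hilbertBasis ℂ H).choose_spec.choose i)⟫_ℂ)

/-- The absolute value `|A| = (A* A)^(1/2)` of a bounded operator between Hilbert spaces. -/
def opAbs (A : H →L[ℂ] K) : H →L[ℂ] H := CFC.sqrt (ContinuousLinearMap.adjoint A ∘L A)

/-- The trace norm `‖A‖_Tr = Tr |A|`, with value `∞` if `A` is not trace class. -/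
def traceNorm (A : H →L[ℂ] K) : ℝ≥0∞ := opTrace (opAbs A)

/-- The Hilbert-Schmidt norm `‖A‖_HS = (Tr A* A)^(1/2)`, with value `∞` if `A` is not a
Hilbert-Schmidt operator. -/
def hsNorm (A : H →L[ℂ] K) : ℝ≥0∞ := opTrace (ContinuousLinearMap.adjoint A ∘L A) ^ (1 / 2 : ℝ)

/-- The trace of a nonnegative operator can be computed in any Hilbert basis. -/
theorem opTrace_eq {ι : Type*} (b : HilbertBasis ι ℂ H) (P : H →L[ℂ] H) (hP : 0 ≤ P) :
    opTrace P = ∑' i, ENNReal.ofReal (RCLike.re ⟪b i, P (b i)⟫_ℂ) := by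
  have hS : IsSelfAdjoint (CFC.sqrt P) := (CFC.sqrt_nonneg P).isSelfAdjoint
  have hsymm : ∀ x y : H, ⟪CFC.sqrt P x, y⟫_ℂ = ⟪x, CFC.sqrt P y⟫_ℂ := fun x y => by
    conv_lhs => rw [← hS.adjoint_eq]
    exact ContinuousLinearMap.adjoint_inner_left _ _ _
  have key : ∀ x : H, RCLike.re ⟪x, P x⟫_ℂ = ‖CFC.sqrt P x‖ ^ 2 := fun x => by
    conv_lhs => rw [← CFC.sqrt_mul_sqrt_self P hP]
    change RCLike.re ⟪x, CFC.sqrt P (CFC.sqrt P x)⟫_ℂ = _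
    rw [← hsymm, inner_self_eq_norm_sq]
  have aux : ∀ {κ : Type _} (c : HilbertBasis κ ℂ H),
      ∑' i, ENNReal.ofReal (RCLike.re ⟪b i, P (b i)⟫_ℂ) =
        ∑' j, ENNReal.ofReal (RCLike.re ⟪c j, P (c j)⟫_ℂ) := fun c => by
    have e1 : ∀ i, ENNReal.ofReal (RCLike.re ⟪b i, P (b i)⟫_ℂ) =
        ∑' j, ENNReal.ofReal (‖⟪c j, CFC.sqrt P (b i)⟫_ℂ‖ ^ 2) := fun i => by
      rw [key, tsum_inner_sq c]
    have e2 : ∀ j, ENNReal.ofReal (RCLike.re ⟪c j, P (c j)⟫_ℂ) =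
        ∑' i, ENNReal.ofReal (‖⟪b i, CFC.sqrt P (c j)⟫_ℂ‖ ^ 2) := fun j => by
      rw [key, tsum_inner_sq b]
    rw [tsum_congr e1, tsum_congr e2, ENNReal.tsum_comm]
    refine tsum_congr fun j => tsum_congr fun i => ?_
    rw [← hsymm, norm_inner_symm]
  exact (aux (exists_hilbertBasis ℂ H).choose_spec.choose).symm

end Trace

/-! ### One-particle space and Sobolev derivatives -/

/-- Physical (or momentum) space `ℝ³` with the Euclidean norm. -/
abbrev E3 : Type := EuclideanSpace ℝ (Fin 3)

/-- The Hilbert space `L²(ℝ³)`. -/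
abbrev L2 : Type := Lp ℂ 2 (volume : Measure E3)

/-- The Hilbert space `L²(ℝ³) ⊗ ℂ³`. -/
abbrev L2Vec : Type := PiLp 2 (fun _ : Fin 3 => L2)

/-- `φ ∈ H²(ℝ³)`. -/
def MemH2 (φ : L2) : Prop := TemperedDistribution.MemSobolev 2 2 (φ : 𝓢'(E3, ℂ))

/-- `α ∈ L²₁(ℝ³)`, the weighted space with norm `‖(1 + |·|²)^(1/2) α‖₂`. -/
def MemL21 (α : L2) : Prop :=
  MemLp (fun k : E3 => (((1 + ‖k‖ ^ 2) ^ (1 / 2 : ℝ) : ℝ) : ℂ) * α k) 2 volume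

open Classical in
/-- The `L²` function that represents the tempered distribution `u` (and `0` if there is none). -/
def l2Rep (u : 𝓢'(E3, ℂ)) : L2 :=
  if h : ∃ g : L2, (g : 𝓢'(E3, ℂ)) = u then h.choose else 0

/-- The weak partial derivative `∂_l φ` of `φ ∈ H¹(ℝ³)` as an element of `L²(ℝ³)`. -/
def weakPartial (l : Fin 3) (φ : L2) : L2 :=
  l2Rep (∂_{(EuclideanSpace.single l (1 : ℝ) : E3)} (φ : 𝓢'(E3, ℂ)))

/-- The weak Laplacian `Δφ` of `φ ∈ H²(ℝ³)` as an element of `L²(ℝ³)`. -/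
def weakLaplacian (φ : L2) : L2 := l2Rep (Δ (φ : 𝓢'(E3, ℂ)))

theorem l2Rep_spec {u : 𝓢'(E3, ℂ)} (h : ∃ g : L2, (g : 𝓢'(E3, ℂ)) = u) :
    (l2Rep u : 𝓢'(E3, ℂ)) = u := by
  rw [l2Rep, dif_pos h]
  exact h.choose_spec

theorem coe_weakPartial {φ : L2} (h : MemH2 φ) (l : Fin 3) :
    (weakPartial l φ : 𝓢'(E3, ℂ)) =
      ∂_{(EuclideanSpace.single l (1 : ℝ) : E3)} (φ : 𝓢'(E3, ℂ)) := by
  have h1 := h.lineDerivOp (m := (EuclideanSpace.single l (1 : ℝ) : E3))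
  obtain ⟨g, hg⟩ := TemperedDistribution.memSobolev_zero_iff.mp
    (TemperedDistribution.MemSobolev.mono (s' := 0) (by norm_num) h1)
  exact l2Rep_spec ⟨g, hg.symm⟩

theorem coe_weakLaplacian {φ : L2} (h : MemH2 φ) :
    (weakLaplacian φ : 𝓢'(E3, ℂ)) = Δ (φ : 𝓢'(E3, ℂ)) := by
  obtain ⟨g, hg⟩ := TemperedDistribution.memSobolev_zero_iff.mp
    (TemperedDistribution.MemSobolev.mono (s' := 0) (by norm_num) h.laplacian)
  exact l2Rep_spec ⟨g, hg.symm⟩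

/-! ### The Schrödinger-Klein-Gordon system -/

/-- The dispersion relation `ω(k) = (|k|² + m²)^(1/2)`. -/
def omega (m : ℝ) (k : E3) : ℝ := Real.sqrt (‖k‖ ^ 2 + m ^ 2)

/-- The form factor `η(k) = (2π)^(-3/2) (2 ω(k))^(-1/2) 1_{|k| ≤ Λ}`. -/
def eta (m Λ : ℝ) (k : E3) : ℝ :=
  if ‖k‖ ≤ Λ then (2 * Real.pi) ^ (-(3 / 2) : ℝ) / Real.sqrt (2 * omega m k) else 0

/-- The function `x ↦ e^{ikx}`. -/
def planeWave (k x : E3) : ℂ := Complex.exp (Complex.I * ((⟪k, x⟫_ℝ : ℝ) : ℂ))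

/-- The classical field `Φ(x) = ∫ η(k) (e^{ikx} α(k) + e^{-ikx} conj(α(k))) dk`. -/
def classicalField (m Λ : ℝ) (α : L2) (x : E3) : ℂ :=
  ∫ k : E3, (eta m Λ k : ℂ) * (planeWave k x * α k + planeWave (-k) x * conj (α k))

/-- The density `ρ = ∑ⱼ |φⱼ|²`. -/
def density {N : ℕ} (φ : Fin N → L2) (x : E3) : ℂ := ∑ j, ((‖φ j x‖ ^ 2 : ℝ) : ℂ)

/-- The Fourier transform `F[f](k) = (2π)^(-3/2) ∫ e^{-ikx} f(x) dx`. -/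
def fourier3 (f : E3 → ℂ) (k : E3) : ℂ :=
  (((2 * Real.pi) ^ (-(3 / 2) : ℝ) : ℝ) : ℂ) * ∫ x : E3, planeWave (-k) x * f x

/-- `(φ₁ᵗ, …, φ_Nᵗ, αᵗ)`, `t ∈ I`, is a solution of the Schrödinger-Klein-Gordon equations
with particle number `N`, scaling parameter `δ`, boson mass `m` and cutoff `Λ`: it takes values in
`H²(ℝ³)^N × L²₁(ℝ³)`, is strongly differentiable in `L²` (one-sidedly at end points of `I`),
and satisfies the equations
`i N^(-1/3) ∂ₜ φⱼ = (-N^(-2/3) Δ + Φ) φⱼ` and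
`i ∂ₜ α = N^(-1/3) δ ω α + N^(-1) (2π)^(3/2) η F[ρ]`. -/
structure IsSolution (N : ℕ) (δ m Λ : ℝ) (I : Set ℝ) (φ : Fin N → ℝ → L2) (α : ℝ → L2) :
    Prop where
  memH2 : ∀ j, ∀ t ∈ I, MemH2 (φ j t)
  memL21 : ∀ t ∈ I, MemL21 (α t)
  schrodinger : ∀ j, ∀ t ∈ I, ∃ dφ : L2, HasDerivWithinAt (φ j) dφ I t ∧
    ∀ᵐ x : E3, Complex.I * (((N : ℝ) ^ (-(1 / 3) : ℝ) : ℝ) : ℂ) * dφ x =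
      -(((N : ℝ) ^ (-(2 / 3) : ℝ) : ℝ) : ℂ) * weakLaplacian (φ j t) x +
        classicalField m Λ (α t) x * φ j t x
  kleinGordon : ∀ t ∈ I, ∃ dα : L2, HasDerivWithinAt α dα I t ∧
    ∀ᵐ k : E3, Complex.I * dα k =
      (((N : ℝ) ^ (-(1 / 3) : ℝ) * δ * omega m k : ℝ) : ℂ) * α t k +
        (((N : ℝ)⁻¹ * (2 * Real.pi) ^ (3 / 2 : ℝ) * eta m Λ k : ℝ) : ℂ) *
          fourier3 (density (fun j => φ j t)) k

/-! ### The operators of the semiclassical structure -/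

theorem memLp_planeWave (k : E3) : MemLp (planeWave k) ∞ (volume : Measure E3) := by
  refine memLp_top_of_bound (C := 1) ?_ (Filter.Eventually.of_forall fun x => ?_)
  · apply Continuous.aestronglyMeasurable
    unfold planeWave
    fun_prop
  · rw [planeWave, mul_comm, Complex.norm_exp_ofReal_mul_I]

/-- Multiplication by `e^{ikx}` on `L²(ℝ³)`. -/
def expMul (k : E3) : L2 →L[ℂ] L2 :=
  (ContinuousLinearMap.lsmul ℂ ℂ).holderL volume ∞ 2 2 ((memLp_planeWave k).toLp (planeWave k))

theorem expMul_ae (k : E3) (f : L2) : ∀ᵐ x : E3, expMul k f x = planeWave k x * f x := by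
  have h1 := (ContinuousLinearMap.lsmul ℂ ℂ).coeFn_holder (r := 2)
    ((memLp_planeWave k).toLp (planeWave k)) f
  filter_upwards [h1, (memLp_planeWave k).coeFn_toLp] with x hx hx'
  rw [hx'] at hx
  exact hx

/-- `p = ∑ⱼ |φⱼ⟩⟨φⱼ|`. -/
def proj {N : ℕ} (φ : Fin N → L2) : L2 →L[ℂ] L2 :=
  ∑ j, InnerProductSpace.rankOne ℂ (φ j) (φ j)

/-- `q = 1 - p`. -/
def coproj {N : ℕ} (φ : Fin N → L2) : L2 →L[ℂ] L2 := 1 - proj φ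

/-- `p e^{ikx} q`. -/
def projExp {N : ℕ} (φ : Fin N → L2) (k : E3) : L2 →L[ℂ] L2 :=
  proj φ ∘L expMul k ∘L coproj φ

/-- `p ∂_l`, that is, the bounded operator `∑ⱼ |φⱼ⟩⟨-∂_l φⱼ|`. -/
def projPartial {N : ℕ} (φ : Fin N → L2) (l : Fin 3) : L2 →L[ℂ] L2 :=
  ∑ j, InnerProductSpace.rankOne ℂ (φ j) (-weakPartial l (φ j))

/-- `p ∇ q` as an operator from `L²(ℝ³)` to `L²(ℝ³) ⊗ ℂ³`,
`f ↦ (p ∂₁ q f, p ∂₂ q f, p ∂₃ q f)`. -/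
def projGrad {N : ℕ} (φ : Fin N → L2) : L2 →L[ℂ] L2Vec :=
  ((PiLp.continuousLinearEquiv 2 ℂ (fun _ : Fin 3 => L2)).symm : (Fin 3 → L2) →L[ℂ] L2Vec) ∘L
    ContinuousLinearMap.pi (fun l => projPartial φ l ∘L coproj φ)

end SKG

end

noncomputable section

namespace SKG

/-! ### The trace norm as a supremum over pairs of contractions -/

section TraceNorm

set_option linter.unusedSectionVars false

open ContinuousLinearMap

variable {H K : Type*} [NormedAddCommGroup H] [InnerProductSpace ℂ H] [CompleteSpace H]
  [NormedAddCommGroup K] [InnerProductSpace ℂ K] [CompleteSpace K]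

/-! Write ε = N^(-1/3), so that N^(2/3) = Nε, and let ‖pBq‖ denote the trace norm of the
off-diagonal block of a bounded operator B. The proof is a Gronwall argument for two families at
once: plane waves B = e^{ikx} and translations B = T_a = e^{a·∇}. The translations replace the
gradient. They are bounded, they commute with the free evolution, and a Lipschitz bound ‖p T_a q‖ ≤
c|a| gives ‖p (a·∇) q‖ ≤ c by differentiation at a = 0 (`traceLE_offGrad_of_offNorm_transl`). The
converse (`offNorm_transl_le_of_offGrad`) holds because ‖p T_a q‖ is subadditive in a.

Along an evolution with bounded self-adjoint generator M, ‖pBq‖ grows at rate at most ‖p[M,B]q‖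
(`offNorm_le_of_evolution`). The Laplacian is removed by passing to the interaction picture, where M
is ε⁻¹ times the conjugated field; there B appears as its free evolution. Translations do not change
under it, while e^{ikx} becomes a phase times T_{2cε...} e^{ikx}, namely e^{-icΔ} e^{ikx} e^{icΔ} =
e^{-ic|k|²} T_{2ck} e^{ikx} (`expMul_freeProp`). The field is a superposition of plane waves with
|k'| ≤ Λ, of total weight at most 2Λ‖α‖, so only commutators with e^{ik'x} matter
(`offNorm_comm_fieldOp_le`). It commutes with e^{ikx}, and [e^{ik'x}, T_a] = (e^{-ia·k'} - 1) T_a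
e^{ik'x} is small of order |a||k'|.

Let z bound both ‖p e^{ikx} q‖ / (Nε(1+|k|)) and ‖p T_a q‖ / (N|a|). In a time step h the plane
waves gain ‖p T_{2εhk} q‖ ≤ 2h z Nε|k|, up to O(h²). The translations gain at most 2ε⁻¹Λ²A h|a| (z
Nε(1+Λ) + ‖p T_a q‖), up to O(h²), where A bounds ‖α‖. The last term is quadratic in a and
disappears by subadditivity, so no negative power of ε survives. Hence z grows by a factor 1 +
(4Λ³A+2)h up to O(h²) (`semiclassicalBound_step`), and iterating over n equal steps and letting n →
∞ gives the exponential (`semiclassicalBound_solution`). Finally A ≤ 1 + ‖α⁰‖ + Λ|t|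
(`norm_field_le`), which makes the exponent quadratic in t. -/

theorem opAbs_nonneg (A : H →L[ℂ] K) : 0 ≤ opAbs A := CFC.sqrt_nonneg _

theorem opAbs_adjoint (A : H →L[ℂ] K) : adjoint (opAbs A) = opAbs A :=
  (opAbs_nonneg A).isSelfAdjoint.adjoint_eq

theorem opAbs_comp_self (A : H →L[ℂ] K) : opAbs A ∘L opAbs A = adjoint A ∘L A := by
  have hpos : (0 : H →L[ℂ] H) ≤ adjoint A ∘L A := by
    rw [nonneg_iff_isPositive]
    exact isPositive_adjoint_comp_self A
  exact CFC.sqrt_mul_sqrt_self _ hpos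

theorem norm_opAbs_apply (A : H →L[ℂ] K) (x : H) : ‖opAbs A x‖ = ‖A x‖ := by
  have h1 : ⟪opAbs A x, opAbs A x⟫_ℂ = ⟪A x, A x⟫_ℂ := by
    rw [← adjoint_inner_right, opAbs_adjoint, ← adjoint_inner_right]
    exact congrArg (fun B : H →L[ℂ] H => ⟪x, B x⟫_ℂ) (opAbs_comp_self A)
  rw [inner_self_eq_norm_sq_to_K, inner_self_eq_norm_sq_to_K] at h1
  have h2 : ‖opAbs A x‖ ^ 2 = ‖A x‖ ^ 2 := by exact_mod_cast h1
  exact (sq_eq_sq₀ (norm_nonneg _) (norm_nonneg _)).mp h2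

/-- Polar decomposition. -/
theorem exists_polar (A : H →L[ℂ] K) : ∃ V : H →L[ℂ] K, ‖V‖ ≤ 1 ∧ V ∘L opAbs A = A ∧
    adjoint V ∘L A = opAbs A := by
  set S := opAbs A
  set W : Submodule ℂ H := S.range.topologicalClosure
  have hmem : ∀ x, S x ∈ W := fun x => Submodule.le_topologicalClosure _ ⟨x, rfl⟩
  let e : H →ₗ[ℂ] W := S.toLinearMap.codRestrict W hmem
  have : CompleteSpace W := (Submodule.isClosed_topologicalClosure _).completeSpace_coe
  have hdense : DenseRange e := by
    intro y
    have hy : (y : H) ∈ closure (Set.range S) := by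
      have := y.2
      rw [← SetLike.mem_coe, Submodule.topologicalClosure_coe] at this
      exact this
    rw [closure_subtype]
    convert hy
    ext z
    constructor
    · rintro ⟨_, ⟨x, rfl⟩, rfl⟩
      exact ⟨x, rfl⟩
    · rintro ⟨x, rfl⟩
      exact ⟨e x, ⟨x, rfl⟩, rfl⟩
  have hnorm : ∀ x, ‖A.toLinearMap x‖ ≤ 1 * ‖e x‖ := fun x => by
    rw [one_mul]
    exact (norm_opAbs_apply A x).ge
  -- The map |A|x ↦ Ax is isometric on the range of |A|; it is extended to the closure of that range
  -- and by zero on the orthogonal complement.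
  let V0 : W →L[ℂ] K := A.toLinearMap.extendOfNorm e
  have hV0 : ∀ w, ‖V0 w‖ ≤ 1 * ‖w‖ := LinearMap.norm_extendOfNorm_apply_le hdense 1 hnorm
  let V : H →L[ℂ] K := V0 ∘L W.orthogonalProjectionOnto
  have hV : ‖V‖ ≤ 1 := by
    refine (opNorm_comp_le _ _).trans ?_
    have h1 : ‖V0‖ ≤ 1 := opNorm_le_bound _ zero_le_one hV0
    exact mul_le_one₀ h1 (norm_nonneg _) (Submodule.orthogonalProjectionOnto_norm_le W)
  have hVS : ∀ x, V (S x) = A x := fun x => by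
    have h1 : W.orthogonalProjectionOnto (S x) = e x :=
      Submodule.orthogonalProjectionOnto_mem_subspace_eq_self (⟨S x, hmem x⟩ : W)
    change V0 (W.orthogonalProjectionOnto (S x)) = _
    rw [h1]
    exact LinearMap.extendOfNorm_eq hdense ⟨1, hnorm⟩ x
  refine ⟨V, hV, ContinuousLinearMap.ext hVS, ContinuousLinearMap.ext fun x => ?_⟩
  have h1 : ‖adjoint V (A x)‖ ≤ ‖S x‖ := by
    refine (le_of_opNorm_le _ (c := 1) ?_ _).trans ?_
    · rwa [LinearIsometryEquiv.norm_map]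
    · rw [one_mul, norm_opAbs_apply]
  have h2 : RCLike.re ⟪adjoint V (A x), S x⟫_ℂ = ‖S x‖ ^ 2 := by
    rw [adjoint_inner_left, hVS, inner_self_eq_norm_sq, norm_opAbs_apply]
  -- Equality case of Cauchy–Schwarz: V*Ax has norm at most ‖|A|x‖, while its inner product with
  -- |A|x already has real part ‖|A|x‖².
  have h3 : ‖adjoint V (A x) - S x‖ ^ 2 ≤ 0 := by
    rw [@norm_sub_sq ℂ, h2]
    nlinarith [norm_nonneg (adjoint V (A x))]
  have h4 : ‖adjoint V (A x) - S x‖ = 0 := by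
    have := sq_nonneg ‖adjoint V (A x) - S x‖
    exact pow_eq_zero_iff two_ne_zero |>.mp (le_antisymm h3 this)
  exact sub_eq_zero.mp (norm_eq_zero.mp h4)

/-- The trace pairing `∑ᵢ ⟪X eᵢ, A (Y eᵢ)⟫ = Tr (X* A Y)`. -/
def tracePair {n : ℕ} (X : EuclideanSpace ℂ (Fin n) →L[ℂ] K) (Y : EuclideanSpace ℂ (Fin n) →L[ℂ] H)
    (A : H →L[ℂ] K) : ℂ :=
  ∑ i, ⟪X (EuclideanSpace.single i 1), A (Y (EuclideanSpace.single i 1))⟫_ℂ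

/-- Composition with a contraction does not increase the Hilbert–Schmidt norm. Expand in b,
interchange the sums, and move R and Y to the other side: for fixed j the inner sum is ‖Y* R b_j‖².
-/
theorem tsum_norm_comp_sq_le {n : ℕ} {ι : Type*} (b : HilbertBasis ι ℂ H)
    (R : H →L[ℂ] H) (hR : adjoint R = R)
    (Y : EuclideanSpace ℂ (Fin n) →L[ℂ] H) (hY : ‖Y‖ ≤ 1) :
    ENNReal.ofReal (∑ i, ‖R (Y (EuclideanSpace.single i 1))‖ ^ 2) ≤
      ∑' j, ENNReal.ofReal (‖R (b j)‖ ^ 2) := by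
  rw [ENNReal.ofReal_sum_of_nonneg fun i _ => by positivity]
  calc _ = ∑ i : Fin n, ∑' j, ENNReal.ofReal (‖⟪b j, R (Y (EuclideanSpace.single i 1))⟫_ℂ‖ ^ 2) := by
        simp_rw [tsum_inner_sq b]
    _ = ∑' j, ∑ i : Fin n, ENNReal.ofReal (‖⟪b j, R (Y (EuclideanSpace.single i 1))⟫_ℂ‖ ^ 2) :=
        (Summable.tsum_finsetSum fun i _ => ENNReal.summable).symm
    _ ≤ _ := ?_
  · refine ENNReal.tsum_le_tsum fun j => ?_
    rw [← ENNReal.ofReal_sum_of_nonneg fun i _ => by positivity]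
    apply ENNReal.ofReal_le_ofReal
    have h1 : ∀ i : Fin n, ‖⟪b j, R (Y (EuclideanSpace.single i 1))⟫_ℂ‖ =
        ‖adjoint Y (R (b j)) i‖ := fun i => by
      rw [← adjoint_inner_left, hR, ← adjoint_inner_left, norm_inner_symm,
        EuclideanSpace.inner_single_left]
      simp
    simp_rw [h1]
    rw [← EuclideanSpace.norm_sq_eq]
    gcongr
    refine (le_of_opNorm_le _ (c := 1) ?_ _).trans_eq (one_mul _)
    rwa [LinearIsometryEquiv.norm_map]

/-- With A = V|A| and R = |A|^(1/2), the pairing is a sum of ⟪R V*X eᵢ, R Y eᵢ⟫. Cauchy–Schwarz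
bounds it by two Hilbert–Schmidt norms, each at most that of R, whose square is Tr|A|. -/
theorem enorm_tracePair_le_traceNorm {n : ℕ} (A : H →L[ℂ] K)
    (X : EuclideanSpace ℂ (Fin n) →L[ℂ] K)
    (Y : EuclideanSpace ℂ (Fin n) →L[ℂ] H) (hX : ‖X‖ ≤ 1) (hY : ‖Y‖ ≤ 1) :
    ‖tracePair X Y A‖ₑ ≤ traceNorm A := by
  obtain ⟨V, hV, hVS, -⟩ := exists_polar A
  set R := CFC.sqrt (opAbs A)
  have hR : adjoint R = R := (CFC.sqrt_nonneg (opAbs A)).isSelfAdjoint.adjoint_eq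
  have hRR : ∀ x, R (R x) = opAbs A x := fun x =>
    congrArg (fun B : H →L[ℂ] H => B x) (CFC.sqrt_mul_sqrt_self _ (opAbs_nonneg A))
  set b := (exists_hilbertBasis ℂ H).choose_spec.choose
  have htr : traceNorm A = ∑' j, ENNReal.ofReal (‖R (b j)‖ ^ 2) := by
    rw [traceNorm, opTrace_eq b _ (opAbs_nonneg A)]
    refine tsum_congr fun j => ?_
    rw [← hRR, ← adjoint_inner_left, hR, inner_self_eq_norm_sq]
  set X' := adjoint V ∘L X
  have hX' : ‖X'‖ ≤ 1 := (opNorm_comp_le _ _).trans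
    (mul_le_one₀ (by rwa [LinearIsometryEquiv.norm_map]) (norm_nonneg _) hX)
  by_cases htop : traceNorm A = ∞
  · rw [htop]; exact le_top
  have b1 := tsum_norm_comp_sq_le b R hR X' hX'
  have b2 := tsum_norm_comp_sq_le b R hR Y hY
  rw [← htr, ENNReal.ofReal_le_iff_le_toReal htop] at b1 b2
  rw [← ofReal_norm, ENNReal.ofReal_le_iff_le_toReal htop]
  have e1 : ∀ i : Fin n, ⟪X (EuclideanSpace.single i 1), A (Y (EuclideanSpace.single i 1))⟫_ℂ =
      ⟪R (X' (EuclideanSpace.single i 1)), R (Y (EuclideanSpace.single i 1))⟫_ℂ := fun i => by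
    conv_rhs => rw [← adjoint_inner_right, hR, hRR]
    change _ = ⟪adjoint V (X _), _⟫_ℂ
    rw [adjoint_inner_left]
    exact congrArg (fun B : H →L[ℂ] K => ⟪X (EuclideanSpace.single i 1),
      B (Y (EuclideanSpace.single i 1))⟫_ℂ) hVS.symm
  calc ‖tracePair X Y A‖ ≤ ∑ i, ‖R (X' (EuclideanSpace.single i 1))‖ *
        ‖R (Y (EuclideanSpace.single i 1))‖ := by
        refine (norm_sum_le _ _).trans (Finset.sum_le_sum fun i _ => ?_)
        rw [e1]
        exact norm_inner_le_norm _ _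
    _ ≤ √(∑ i, ‖R (X' (EuclideanSpace.single i 1))‖ ^ 2) *
        √(∑ i, ‖R (Y (EuclideanSpace.single i 1))‖ ^ 2) := Real.sum_mul_le_sqrt_mul_sqrt _ _ _
    _ ≤ √(traceNorm A).toReal * √(traceNorm A).toReal := by gcongr
    _ = _ := Real.mul_self_sqrt ENNReal.toReal_nonneg

/-- The contraction that sends the standard basis to an orthonormal family. -/
def basisMap {n : ℕ} (v : Fin n → H) : EuclideanSpace ℂ (Fin n) →L[ℂ] H :=
  LinearMap.toContinuousLinearMap
    ((Fintype.linearCombination ℂ v) ∘ₗ (WithLp.linearEquiv 2 ℂ (Fin n → ℂ)).toLinearMap)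

theorem basisMap_apply {n : ℕ} (v : Fin n → H) (x : EuclideanSpace ℂ (Fin n)) :
    basisMap v x = ∑ i, x i • v i := rfl

theorem basisMap_single {n : ℕ} (v : Fin n → H) (i : Fin n) :
    basisMap v (EuclideanSpace.single i 1) = v i := by
  rw [basisMap_apply, Finset.sum_eq_single i]
  · simp
  · intro j _ hj
    simp [hj]
  · simp

theorem norm_basisMap_le {n : ℕ} (v : Fin n → H) (hv : Orthonormal ℂ v) : ‖basisMap v‖ ≤ 1 := by
  refine opNorm_le_bound _ zero_le_one fun x => ?_
  rw [one_mul, ← sq_le_sq₀ (norm_nonneg _) (norm_nonneg _), EuclideanSpace.norm_sq_eq,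
    basisMap_apply, ← @inner_self_eq_norm_sq ℂ, hv.inner_sum]
  simp [← Complex.normSq_eq_norm_sq, Complex.normSq_apply]

/-- The converse takes X = V Y and Y the inclusion of finitely many basis vectors, which recovers
the partial sums of Tr|A|. As the pairing is linear in A, the triangle inequality, the ideal
property and bounds for superpositions of operators reduce to bounds on complex numbers. -/
theorem traceNorm_le_iff (A : H →L[ℂ] K) (c : ℝ≥0∞) :
    traceNorm A ≤ c ↔ ∀ (n : ℕ) (X : EuclideanSpace ℂ (Fin n) →L[ℂ] K)
      (Y : EuclideanSpace ℂ (Fin n) →L[ℂ] H), ‖X‖ ≤ 1 → ‖Y‖ ≤ 1 → ‖tracePair X Y A‖ₑ ≤ c := by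
  refine ⟨fun h n X Y hX hY => (enorm_tracePair_le_traceNorm A X Y hX hY).trans h, fun h => ?_⟩
  obtain ⟨V, hV, -, hVA⟩ := exists_polar A
  rw [traceNorm, opTrace, ENNReal.tsum_eq_iSup_sum]
  refine iSup_le fun s => ?_
  set b := (exists_hilbertBasis ℂ H).choose_spec.choose
  let f := s.equivFin.symm
  let v : Fin s.card → H := fun i => b (f i : _)
  have hv : Orthonormal ℂ v := b.orthonormal.comp _ (Subtype.val_injective.comp f.injective)
  have hY := norm_basisMap_le v hv
  have hX : ‖V ∘L basisMap v‖ ≤ 1 := (opNorm_comp_le _ _).trans (mul_le_one₀ hV (norm_nonneg _) hY)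
  refine le_trans ?_ (h _ _ _ hX hY)
  have hnn : ∀ x, 0 ≤ RCLike.re ⟪x, opAbs A x⟫_ℂ := fun x =>
    ((nonneg_iff_isPositive _).mp (opAbs_nonneg A)).re_inner_nonneg_right x
  rw [← ENNReal.ofReal_sum_of_nonneg fun i _ => hnn _, ← ofReal_norm]
  refine ENNReal.ofReal_le_ofReal ?_
  have e1 : RCLike.re (tracePair (V ∘L basisMap v) (basisMap v) A) =
      ∑ i ∈ s, RCLike.re ⟪b i, opAbs A (b i)⟫_ℂ := by
    rw [tracePair, map_sum, ← Finset.sum_coe_sort s, ← f.sum_comp]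
    refine Finset.sum_congr rfl fun i _ => ?_
    rw [basisMap_single]
    change RCLike.re ⟪V (basisMap v _), _⟫_ℂ = _
    rw [basisMap_single, ← adjoint_inner_right, ← ContinuousLinearMap.comp_apply, hVA]
  rw [← e1]
  exact RCLike.re_le_norm _

theorem tracePair_add {n : ℕ} (X : EuclideanSpace ℂ (Fin n) →L[ℂ] K)
    (Y : EuclideanSpace ℂ (Fin n) →L[ℂ] H) (A B : H →L[ℂ] K) :
    tracePair X Y (A + B) = tracePair X Y A + tracePair X Y B := by
  simp [tracePair, Finset.sum_add_distrib]

theorem tracePair_smul {n : ℕ} (X : EuclideanSpace ℂ (Fin n) →L[ℂ] K)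
    (Y : EuclideanSpace ℂ (Fin n) →L[ℂ] H) (c : ℂ) (A : H →L[ℂ] K) :
    tracePair X Y (c • A) = c * tracePair X Y A := by
  simp [tracePair, Finset.mul_sum]

theorem traceNorm_add_le (A B : H →L[ℂ] K) : traceNorm (A + B) ≤ traceNorm A + traceNorm B := by
  rw [traceNorm_le_iff]
  intro n X Y hX hY
  rw [tracePair_add]
  exact (enorm_add_le _ _).trans (add_le_add (enorm_tracePair_le_traceNorm A X Y hX hY)
    (enorm_tracePair_le_traceNorm B X Y hX hY))

theorem traceNorm_zero : traceNorm (0 : H →L[ℂ] K) = 0 := by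
  rw [← nonpos_iff_eq_zero, traceNorm_le_iff]
  intro n X Y _ _
  simp [tracePair]

theorem traceNorm_sum_le {ι : Type*} (s : Finset ι) (A : ι → H →L[ℂ] K) :
    traceNorm (∑ i ∈ s, A i) ≤ ∑ i ∈ s, traceNorm (A i) :=
  Finset.le_sum_of_subadditive _ traceNorm_zero.le traceNorm_add_le _ _

theorem traceNorm_smul_le (c : ℂ) (A : H →L[ℂ] K) : traceNorm (c • A) ≤ ‖c‖ₑ * traceNorm A := by
  rw [traceNorm_le_iff]
  intro n X Y hX hY
  rw [tracePair_smul, enorm_mul]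
  gcongr
  exact enorm_tracePair_le_traceNorm A X Y hX hY

theorem traceNorm_neg_le (A : H →L[ℂ] K) : traceNorm (-A) ≤ traceNorm A := by
  simpa using traceNorm_smul_le (-1) A

theorem traceNorm_sub_le (A B : H →L[ℂ] K) : traceNorm (A - B) ≤ traceNorm A + traceNorm B := by
  rw [sub_eq_add_neg]
  exact (traceNorm_add_le _ _).trans (add_le_add le_rfl (traceNorm_neg_le B))

/-! ### The ideal property of the trace norm -/

section Ideal

variable {H' K' : Type*} [NormedAddCommGroup H'] [InnerProductSpace ℂ H'] [CompleteSpace H']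
  [NormedAddCommGroup K'] [InnerProductSpace ℂ K'] [CompleteSpace K']

theorem traceNorm_comp_comp_le_of_contraction (D : K →L[ℂ] K') (A : H →L[ℂ] K) (B : H' →L[ℂ] H)
    (hD : ‖D‖ ≤ 1) (hB : ‖B‖ ≤ 1) : traceNorm (D ∘L A ∘L B) ≤ traceNorm A := by
  rw [traceNorm_le_iff]
  intro n X Y hX hY
  have h1 : ‖adjoint D ∘L X‖ ≤ 1 := (opNorm_comp_le _ _).trans
    (mul_le_one₀ (by rwa [LinearIsometryEquiv.norm_map]) (norm_nonneg _) hX)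
  have h2 : ‖B ∘L Y‖ ≤ 1 := (opNorm_comp_le _ _).trans (mul_le_one₀ hB (norm_nonneg _) hY)
  have h3 : tracePair X Y (D ∘L A ∘L B) = tracePair (adjoint D ∘L X) (B ∘L Y) A :=
    Finset.sum_congr rfl fun i _ => (adjoint_inner_left D _ _).symm
  rw [h3]
  exact enorm_tracePair_le_traceNorm A _ _ h1 h2

theorem traceNorm_comp_left_le (D : K →L[ℂ] K') (A : H →L[ℂ] K) :
    traceNorm (D ∘L A) ≤ ‖D‖ₑ * traceNorm A := by
  rcases eq_or_ne D 0 with rfl | hD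
  · simp [traceNorm_zero]
  have hn : (‖D‖ : ℂ) ≠ 0 := by simpa using hD
  have h1 : D ∘L A = (‖D‖ : ℂ) • (((‖D‖ : ℂ)⁻¹ • D) ∘L A ∘L ContinuousLinearMap.id ℂ H) := by
    ext x
    simp [smul_smul, hn]
  rw [h1]
  refine (traceNorm_smul_le _ _).trans ?_
  have h2 : ‖(‖D‖ : ℂ)‖ₑ = ‖D‖ₑ := by
    rw [← ofReal_norm, ← ofReal_norm]; simp
  rw [h2]
  gcongr
  refine traceNorm_comp_comp_le_of_contraction _ _ _ ?_ norm_id_le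
  rw [norm_smul, norm_inv]
  simp [hD]

theorem traceNorm_comp_right_le (A : H →L[ℂ] K) (D : H' →L[ℂ] H) :
    traceNorm (A ∘L D) ≤ traceNorm A * ‖D‖ₑ := by
  rcases eq_or_ne D 0 with rfl | hD
  · simp [traceNorm_zero]
  have hn : (‖D‖ : ℂ) ≠ 0 := by simpa using hD
  have h1 : A ∘L D = (‖D‖ : ℂ) • (ContinuousLinearMap.id ℂ K ∘L A ∘L ((‖D‖ : ℂ)⁻¹ • D)) := by
    ext x
    simp [smul_smul, hn]
  rw [h1]
  refine (traceNorm_smul_le _ _).trans ?_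
  have h2 : ‖(‖D‖ : ℂ)‖ₑ = ‖D‖ₑ := by
    rw [← ofReal_norm, ← ofReal_norm]; simp
  rw [h2, mul_comm]
  gcongr
  refine traceNorm_comp_comp_le_of_contraction _ _ _ norm_id_le ?_
  rw [norm_smul, norm_inv]
  simp [hD]

end Ideal

/-- The pairing with a rank-one operator collapses to the single inner product ⟪y, Y X* x⟫. -/
theorem traceNorm_rankOne_le (x : K) (y : H) :
    traceNorm (InnerProductSpace.rankOne ℂ x y) ≤ ‖x‖ₑ * ‖y‖ₑ := by
  rw [traceNorm_le_iff]
  intro n X Y hX hY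
  have h1 : tracePair X Y (InnerProductSpace.rankOne ℂ x y) = ⟪y, Y (adjoint X x)⟫_ℂ := by
    have h2 : adjoint X x = ∑ i, ⟪X (EuclideanSpace.single i 1), x⟫_ℂ •
        EuclideanSpace.single i (1 : ℂ) := by
      ext j
      have h3 : ∀ i : Fin n, ⟪X (EuclideanSpace.single i 1), x⟫_ℂ = adjoint X x i := fun i => by
        rw [← adjoint_inner_right, EuclideanSpace.inner_single_left]
        simp
      simp_rw [h3]
      simp [Pi.single_apply]
    rw [h2, map_sum, inner_sum]
    refine Finset.sum_congr rfl fun i _ => ?_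
    simp [inner_smul_right, mul_comm]
  rw [h1, ← ofReal_norm, ← ofReal_norm, ← ofReal_norm, ← ENNReal.ofReal_mul (norm_nonneg _)]
  refine ENNReal.ofReal_le_ofReal ?_
  have h3 : ‖Y (adjoint X x)‖ ≤ ‖x‖ := by
    refine (le_of_opNorm_le _ hY _).trans ?_
    rw [one_mul]
    refine (le_of_opNorm_le _ (c := 1) ?_ _).trans_eq (one_mul _)
    rwa [LinearIsometryEquiv.norm_map]
  calc ‖⟪y, Y (adjoint X x)⟫_ℂ‖ ≤ ‖y‖ * ‖Y (adjoint X x)‖ := norm_inner_le_norm _ _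
    _ ≤ ‖y‖ * ‖x‖ := by gcongr
    _ = _ := mul_comm _ _

/-- The squared Hilbert-Schmidt norm of a contraction is at most its trace norm. -/
theorem hsNorm_sq_le_traceNorm (A : H →L[ℂ] K) (hA : ‖A‖ ≤ 1) : hsNorm A ^ 2 ≤ traceNorm A := by
  rw [hsNorm, ← ENNReal.rpow_natCast, ← ENNReal.rpow_mul]
  norm_num
  rw [← opAbs_comp_self, traceNorm, opTrace, opTrace]
  refine ENNReal.tsum_le_tsum fun i => ENNReal.ofReal_le_ofReal ?_
  set x := (exists_hilbertBasis ℂ H).choose_spec.choose i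
  set R := CFC.sqrt (opAbs A)
  have hR : adjoint R = R := (CFC.sqrt_nonneg (opAbs A)).isSelfAdjoint.adjoint_eq
  have hRR : ∀ x, R (R x) = opAbs A x := fun x =>
    congrArg (fun B : H →L[ℂ] H => B x) (CFC.sqrt_mul_sqrt_self _ (opAbs_nonneg A))
  have hle : ∀ y, ‖opAbs A y‖ ≤ ‖y‖ := fun y => by
    rw [norm_opAbs_apply]
    exact (le_of_opNorm_le _ hA _).trans_eq (one_mul _)
  -- The square root of the contraction |A| is a contraction, so ‖|A|x‖ = ‖R(Rx)‖ ≤ ‖Rx‖ compares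
  -- the two traces term by term.
  have hRle : ∀ y, ‖R y‖ ≤ ‖y‖ := fun y => by
    have h1 : ‖R y‖ ^ 2 ≤ ‖y‖ ^ 2 := by
      calc ‖R y‖ ^ 2 = RCLike.re ⟪y, opAbs A y⟫_ℂ := by
            rw [← hRR, ← adjoint_inner_left, hR, inner_self_eq_norm_sq]
        _ ≤ ‖y‖ * ‖opAbs A y‖ := re_inner_le_norm _ _
        _ ≤ ‖y‖ * ‖y‖ := by gcongr; exact hle y
        _ = _ := by ring
    exact (sq_le_sq₀ (norm_nonneg _) (norm_nonneg _)).mp h1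
  have e1 : RCLike.re ⟪x, (opAbs A ∘L opAbs A) x⟫_ℂ = ‖R (R x)‖ ^ 2 := by
    rw [ContinuousLinearMap.comp_apply, ← adjoint_inner_left, opAbs_adjoint,
      inner_self_eq_norm_sq, hRR]
  have e2 : RCLike.re ⟪x, opAbs A x⟫_ℂ = ‖R x‖ ^ 2 := by
    rw [← hRR, ← adjoint_inner_left, hR, inner_self_eq_norm_sq]
  rw [e1, e2]
  gcongr
  exact hRle _

end TraceNorm

/-! ### Trace norm bounds by real numbers -/

section TraceLE

open ContinuousLinearMap

set_option linter.unusedSectionVars false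

variable {H K : Type*} [NormedAddCommGroup H] [InnerProductSpace ℂ H] [CompleteSpace H]
  [NormedAddCommGroup K] [InnerProductSpace ℂ K] [CompleteSpace K]

/-- `A` is trace class with trace norm at most `c`. -/
def TraceLE (A : H →L[ℂ] K) (c : ℝ) : Prop := 0 ≤ c ∧ traceNorm A ≤ ENNReal.ofReal c

theorem TraceLE.mono {A : H →L[ℂ] K} {a b : ℝ} (h : TraceLE A a) (hab : a ≤ b) : TraceLE A b :=
  ⟨h.1.trans hab, h.2.trans (ENNReal.ofReal_le_ofReal hab)⟩

theorem TraceLE.add {A B : H →L[ℂ] K} {a b : ℝ} (hA : TraceLE A a) (hB : TraceLE B b) :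
    TraceLE (A + B) (a + b) := by
  refine ⟨add_nonneg hA.1 hB.1, (traceNorm_add_le A B).trans ?_⟩
  rw [ENNReal.ofReal_add hA.1 hB.1]
  exact add_le_add hA.2 hB.2

theorem TraceLE.sub {A B : H →L[ℂ] K} {a b : ℝ} (hA : TraceLE A a) (hB : TraceLE B b) :
    TraceLE (A - B) (a + b) := by
  refine ⟨add_nonneg hA.1 hB.1, (traceNorm_sub_le A B).trans ?_⟩
  rw [ENNReal.ofReal_add hA.1 hB.1]
  exact add_le_add hA.2 hB.2

theorem TraceLE.sum {ι : Type*} (s : Finset ι) {A : ι → H →L[ℂ] K} {a : ι → ℝ}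
    (hA : ∀ i ∈ s, TraceLE (A i) (a i)) : TraceLE (∑ i ∈ s, A i) (∑ i ∈ s, a i) := by
  refine ⟨Finset.sum_nonneg fun i hi => (hA i hi).1, (traceNorm_sum_le _ _).trans ?_⟩
  rw [ENNReal.ofReal_sum_of_nonneg fun i hi => (hA i hi).1]
  exact Finset.sum_le_sum fun i hi => (hA i hi).2

theorem TraceLE.smul {A : H →L[ℂ] K} {a : ℝ} (hA : TraceLE A a) (c : ℂ) :
    TraceLE (c • A) (‖c‖ * a) := by
  refine ⟨mul_nonneg (norm_nonneg _) hA.1, (traceNorm_smul_le _ _).trans ?_⟩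
  rw [ENNReal.ofReal_mul (norm_nonneg _), ofReal_norm]
  gcongr
  exact hA.2

theorem TraceLE.comp_left {K' : Type*} [NormedAddCommGroup K'] [InnerProductSpace ℂ K']
    [CompleteSpace K'] {A : H →L[ℂ] K} {a : ℝ} (hA : TraceLE A a) (D : K →L[ℂ] K') :
    TraceLE (D ∘L A) (‖D‖ * a) := by
  refine ⟨mul_nonneg (norm_nonneg _) hA.1, (traceNorm_comp_left_le _ _).trans ?_⟩
  rw [ENNReal.ofReal_mul (norm_nonneg _), ofReal_norm]
  gcongr
  exact hA.2

theorem TraceLE.comp_right {H' : Type*} [NormedAddCommGroup H'] [InnerProductSpace ℂ H']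
    [CompleteSpace H'] {A : H →L[ℂ] K} {a : ℝ} (hA : TraceLE A a) (D : H' →L[ℂ] H) :
    TraceLE (A ∘L D) (a * ‖D‖) := by
  refine ⟨mul_nonneg hA.1 (norm_nonneg _), (traceNorm_comp_right_le _ _).trans ?_⟩
  rw [ENNReal.ofReal_mul hA.1, ofReal_norm]
  gcongr
  exact hA.2

theorem traceLE_rankOne (x : K) (y : H) :
    TraceLE (InnerProductSpace.rankOne ℂ x y) (‖x‖ * ‖y‖) := by
  refine ⟨by positivity, (traceNorm_rankOne_le _ _).trans ?_⟩
  rw [ENNReal.ofReal_mul (norm_nonneg _), ofReal_norm, ofReal_norm]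

theorem TraceLE.toReal_le {A : H →L[ℂ] K} {a : ℝ} (hA : TraceLE A a) : (traceNorm A).toReal ≤ a :=
  ENNReal.toReal_le_of_le_ofReal hA.1 hA.2

/-- Any finite bound excludes the value ∞, which `toReal` would turn into 0; after that the real
trace norm is itself a valid bound. -/
theorem TraceLE.self {A : H →L[ℂ] K} {a : ℝ} (hA : TraceLE A a) :
    TraceLE A (traceNorm A).toReal :=
  ⟨ENNReal.toReal_nonneg,
    (ENNReal.ofReal_toReal (ne_top_of_le_ne_top ENNReal.ofReal_ne_top hA.2)).ge⟩

end TraceLE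

/-! ### The projection onto the span of an orthonormal family -/

section Span

open ContinuousLinearMap

set_option linter.unusedSectionVars false

variable {H : Type*} [NormedAddCommGroup H] [InnerProductSpace ℂ H] [CompleteSpace H] {N : ℕ}

/-- The operator `∑ⱼ |ψⱼ⟩⟨ψⱼ|`. -/
def spanProj (ψ : Fin N → H) : H →L[ℂ] H := ∑ j, InnerProductSpace.rankOne ℂ (ψ j) (ψ j)

theorem spanProj_apply (ψ : Fin N → H) (x : H) : spanProj ψ x = ∑ j, ⟪ψ j, x⟫_ℂ • ψ j := by
  simp [spanProj]

theorem spanProj_inner (ψ : Fin N → H) (x y : H) :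
    ⟪spanProj ψ x, y⟫_ℂ = ⟪x, spanProj ψ y⟫_ℂ := by
  simp only [spanProj_apply, sum_inner, inner_sum, inner_smul_left, inner_smul_right,
    inner_conj_symm]
  exact Finset.sum_congr rfl fun j _ => mul_comm _ _

theorem spanProj_spanProj {ψ : Fin N → H} (hψ : Orthonormal ℂ ψ) (x : H) :
    spanProj ψ (spanProj ψ x) = spanProj ψ x := by
  rw [spanProj_apply, spanProj_apply]
  refine Finset.sum_congr rfl fun j _ => ?_
  rw [hψ.inner_right_fintype]

theorem norm_spanProj_apply_sq {ψ : Fin N → H} (hψ : Orthonormal ℂ ψ) (x : H) :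
    ‖spanProj ψ x‖ ^ 2 + ‖x - spanProj ψ x‖ ^ 2 = ‖x‖ ^ 2 := by
  have h : ⟪spanProj ψ x, x - spanProj ψ x⟫_ℂ = 0 := by
    rw [spanProj_inner, map_sub, spanProj_spanProj hψ, sub_self, inner_zero_right]
  have h2 := norm_add_sq_eq_norm_sq_add_norm_sq_of_inner_eq_zero _ _ h
  rw [add_sub_cancel] at h2
  rw [sq, sq, sq, h2]

theorem norm_spanProj_le {ψ : Fin N → H} (hψ : Orthonormal ℂ ψ) : ‖spanProj ψ‖ ≤ 1 := by
  refine opNorm_le_bound _ zero_le_one fun x => ?_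
  rw [one_mul]
  refine (sq_le_sq₀ (norm_nonneg _) (norm_nonneg _)).mp ?_
  nlinarith [norm_spanProj_apply_sq hψ x, sq_nonneg ‖x - spanProj ψ x‖]

theorem norm_one_sub_spanProj_le {ψ : Fin N → H} (hψ : Orthonormal ℂ ψ) :
    ‖1 - spanProj ψ‖ ≤ 1 := by
  refine opNorm_le_bound _ zero_le_one fun x => ?_
  rw [one_mul]
  refine (sq_le_sq₀ (norm_nonneg _) (norm_nonneg _)).mp ?_
  have : (1 - spanProj ψ) x = x - spanProj ψ x := rfl
  rw [this]
  nlinarith [norm_spanProj_apply_sq hψ x, sq_nonneg ‖spanProj ψ x‖]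

theorem traceLE_spanProj {ψ : Fin N → H} (hψ : Orthonormal ℂ ψ) : TraceLE (spanProj ψ) N := by
  have := TraceLE.sum Finset.univ fun j _ => traceLE_rankOne (ψ j) (ψ j)
  simpa [hψ.1, spanProj] using this

/-- The off-diagonal block `p B q`, with `p` the projection onto the span of `ψ` and `q = 1 - p`. -/
def offDiag (ψ : Fin N → H) (B : H →L[ℂ] H) : H →L[ℂ] H := spanProj ψ ∘L B ∘L (1 - spanProj ψ)

/-- The trace norm of `p B q`. -/
def offNorm (ψ : Fin N → H) (B : H →L[ℂ] H) : ℝ := (traceNorm (offDiag ψ B)).toReal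

variable {ψ : Fin N → H}

theorem offNorm_nonneg (ψ : Fin N → H) (B : H →L[ℂ] H) : 0 ≤ offNorm ψ B := ENNReal.toReal_nonneg

theorem traceLE_spanProj_comp (hψ : Orthonormal ℂ ψ) (B : H →L[ℂ] H) :
    TraceLE (spanProj ψ ∘L B) (N * ‖B‖) :=
  (traceLE_spanProj hψ).comp_right B

theorem traceLE_offDiag_norm (hψ : Orthonormal ℂ ψ) (B : H →L[ℂ] H) :
    TraceLE (offDiag ψ B) (N * ‖B‖) := by
  refine ((traceLE_spanProj_comp hψ B).comp_right (1 - spanProj ψ)).mono ?_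
  exact mul_le_of_le_one_right (by positivity) (norm_one_sub_spanProj_le hψ)

theorem traceLE_offDiag (hψ : Orthonormal ℂ ψ) (B : H →L[ℂ] H) :
    TraceLE (offDiag ψ B) (offNorm ψ B) := (traceLE_offDiag_norm hψ B).self

theorem offNorm_le_norm (hψ : Orthonormal ℂ ψ) (B : H →L[ℂ] H) : offNorm ψ B ≤ N * ‖B‖ :=
  (traceLE_offDiag_norm hψ B).toReal_le

theorem offDiag_add (B D : H →L[ℂ] H) : offDiag ψ (B + D) = offDiag ψ B + offDiag ψ D := by
  ext x
  simp only [offDiag, comp_apply, add_apply, map_add]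

theorem offDiag_smul (c : ℂ) (B : H →L[ℂ] H) : offDiag ψ (c • B) = c • offDiag ψ B := by
  ext x
  simp only [offDiag, comp_apply, smul_apply, map_smul]

theorem offNorm_smul_le (hψ : Orthonormal ℂ ψ) (c : ℂ) (B : H →L[ℂ] H) :
    offNorm ψ (c • B) ≤ ‖c‖ * offNorm ψ B := by
  refine TraceLE.toReal_le ?_
  rw [offDiag_smul]
  exact (traceLE_offDiag hψ B).smul c

/-- Inserting 1 = p + q between the factors gives pBDq = (pBq)(Dq) + (pB)(pDq). -/
theorem offNorm_comp_le (hψ : Orthonormal ℂ ψ) {B D : H →L[ℂ] H} (hB : ‖B‖ ≤ 1) (hD : ‖D‖ ≤ 1) :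
    offNorm ψ (B ∘L D) ≤ offNorm ψ B + offNorm ψ D := by
  refine TraceLE.toReal_le ?_
  have h1 : offDiag ψ (B ∘L D) = offDiag ψ B ∘L (D ∘L (1 - spanProj ψ)) +
      (spanProj ψ ∘L B) ∘L offDiag ψ D := by
    ext x
    simp [offDiag]
    abel
  rw [h1]
  have h2 : ‖D ∘L (1 - spanProj ψ)‖ ≤ 1 :=
    (opNorm_comp_le _ _).trans (mul_le_one₀ hD (norm_nonneg _) (norm_one_sub_spanProj_le hψ))
  have h3 : ‖spanProj ψ ∘L B‖ ≤ 1 :=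
    (opNorm_comp_le _ _).trans (mul_le_one₀ (norm_spanProj_le hψ) (norm_nonneg _) hB)
  exact (((traceLE_offDiag hψ B).comp_right _).mono
    (mul_le_of_le_one_right (offNorm_nonneg _ _) h2)).add
    (((traceLE_offDiag hψ D).comp_left _).mono (mul_le_of_le_one_left (offNorm_nonneg _ _) h3))

/-- Conjugation by a unitary operator. -/
theorem offNorm_map_le (hψ : Orthonormal ℂ ψ) {U U' : H →L[ℂ] H} (hU : ‖U‖ ≤ 1) (hU' : ‖U'‖ ≤ 1)
    (hUU : U ∘L U' = 1) (hadj : ∀ x y, ⟪U x, y⟫_ℂ = ⟪x, U' y⟫_ℂ) (B : H →L[ℂ] H) :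
    offNorm (fun j => U (ψ j)) B ≤ offNorm ψ (U' ∘L B ∘L U) := by
  have hP : spanProj (fun j => U (ψ j)) = U ∘L spanProj ψ ∘L U' := by
    ext x
    simp [spanProj_apply, hadj]
  have h1 : ∀ x, U (U' x) = x := fun x => congrArg (fun A : H →L[ℂ] H => A x) hUU
  have h2 : offDiag (fun j => U (ψ j)) B = U ∘L offDiag ψ (U' ∘L B ∘L U) ∘L U' := by
    ext x
    simp [offDiag, hP, h1]
  refine TraceLE.toReal_le ?_
  rw [h2]
  refine (((traceLE_offDiag hψ _).comp_right U').comp_left U).mono ?_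
  calc _ ≤ 1 * (offNorm ψ (U' ∘L B ∘L U) * 1) := by
        gcongr
        exact mul_nonneg (offNorm_nonneg _ _) (norm_nonneg _)
        exact offNorm_nonneg _ _
    _ = _ := by ring

end Span

/-! ### Evolution of off-diagonal blocks under a bounded self-adjoint generator -/

section Evolution

set_option linter.unusedSectionVars false

open ContinuousLinearMap Filter Topology

variable {H : Type*} [NormedAddCommGroup H] [InnerProductSpace ℂ H] [CompleteSpace H] {N : ℕ}

/-- The first-order approximation `1 - i h M` of a unitary evolution. -/
def eulerStep (M : H →L[ℂ] H) (h : ℝ) : H →L[ℂ] H := 1 - (Complex.I * (h : ℂ)) • M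

theorem eulerStep_apply (M : H →L[ℂ] H) (h : ℝ) (x : H) :
    eulerStep M h x = x - (Complex.I * (h : ℂ)) • M x := rfl

theorem inner_eulerStep {M : H →L[ℂ] H} (hM : ∀ x y, ⟪M x, y⟫_ℂ = ⟪x, M y⟫_ℂ) (h : ℝ) (x y : H) :
    ⟪eulerStep M h x, y⟫_ℂ = ⟪x, eulerStep M (-h) y⟫_ℂ := by
  simp only [eulerStep_apply, inner_sub_left, inner_sub_right, inner_smul_left, inner_smul_right,
    hM, map_mul, Complex.conj_I, Complex.conj_ofReal]
  push_cast
  ring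

theorem eulerStep_eulerStep_neg (M : H →L[ℂ] H) (h : ℝ) (x : H) :
    eulerStep M h (eulerStep M (-h) x) = x + ((h : ℂ) ^ 2) • M (M x) := by
  simp only [eulerStep_apply, map_sub, map_smul, smul_sub, smul_smul]
  have : Complex.I * ((-h : ℝ) : ℂ) * (Complex.I * (h : ℂ)) = (h : ℂ) ^ 2 := by
    push_cast
    linear_combination (-(h : ℂ) ^ 2) * Complex.I_sq
  rw [this]
  have h2 : Complex.I * ((-h : ℝ) : ℂ) = -(Complex.I * h) := by push_cast; ring
  rw [h2, neg_smul]
  abel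

/-- For symmetric M the terms linear in h cancel in ⟪x - ihMx, x - ihMx⟫, so the Euler step is
unitary up to O(h²), which is harmless for a derivative. -/
theorem norm_eulerStep_sq_le {M : H →L[ℂ] H} (hM : ∀ x y, ⟪M x, y⟫_ℂ = ⟪x, M y⟫_ℂ) (h : ℝ) :
    ‖eulerStep M h‖ ^ 2 ≤ 1 + h ^ 2 * ‖M‖ ^ 2 := by
  have h0 : 0 ≤ 1 + h ^ 2 * ‖M‖ ^ 2 := by positivity
  have h1 : ‖eulerStep M h‖ ≤ √(1 + h ^ 2 * ‖M‖ ^ 2) := by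
    refine opNorm_le_bound _ (Real.sqrt_nonneg _) fun x => ?_
    refine (sq_le_sq₀ (norm_nonneg _) (by positivity)).mp ?_
    rw [mul_pow, Real.sq_sqrt h0]
    have h2 : ‖eulerStep M h x‖ ^ 2 = ‖x‖ ^ 2 + h ^ 2 * ‖M x‖ ^ 2 := by
      rw [← @inner_self_eq_norm_sq ℂ, inner_eulerStep hM]
      have h3 := eulerStep_eulerStep_neg M (-h) x
      rw [neg_neg] at h3
      rw [h3, inner_add_right, inner_smul_right, ← hM, map_add, inner_self_eq_norm_sq]
      have h4 : ((-h : ℝ) : ℂ) ^ 2 = ((h ^ 2 : ℝ) : ℂ) := by push_cast; ring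
      rw [h4]
      erw [RCLike.re_ofReal_mul]
      rw [inner_self_eq_norm_sq]
      rfl
    rw [h2]
    have h4 : ‖M x‖ ≤ ‖M‖ * ‖x‖ := le_opNorm _ _
    have h5 : ‖M x‖ ^ 2 ≤ (‖M‖ * ‖x‖) ^ 2 := by gcongr
    nlinarith [mul_le_mul_of_nonneg_left h5 (sq_nonneg h)]
  calc _ ≤ √(1 + h ^ 2 * ‖M‖ ^ 2) ^ 2 := by gcongr
    _ = _ := Real.sq_sqrt h0

theorem norm_eulerStep_le (M : H →L[ℂ] H) {h : ℝ} (h0 : 0 ≤ h) (h1 : h ≤ 1) :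
    ‖eulerStep M h‖ ≤ 1 + ‖M‖ := by
  refine (norm_sub_le _ _).trans (add_le_add norm_id_le ?_)
  rw [norm_smul]
  simp only [norm_mul, Complex.norm_I, one_mul, Complex.norm_real, Real.norm_eq_abs, abs_of_nonneg h0]
  exact mul_le_of_le_one_left (norm_nonneg _) h1

/-- Telescoping |ψ⟩⟨ψ| - |χ⟩⟨χ| = |ψ-χ⟩⟨ψ| + |χ⟩⟨ψ-χ| gives rank-one terms. Neither family is
assumed orthonormal, since Euler steps do not preserve orthonormality. -/
theorem traceLE_spanProj_sub {ψ χ : Fin N → H} {c : ℝ} {a : Fin N → ℝ}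
    (hψ : ∀ j, ‖ψ j‖ ≤ c) (hχ : ∀ j, ‖χ j‖ ≤ c) (ha : ∀ j, ‖ψ j - χ j‖ ≤ a j) :
    TraceLE (spanProj ψ - spanProj χ) (2 * c * ∑ j, a j) := by
  have h1 : spanProj ψ - spanProj χ = ∑ j, (InnerProductSpace.rankOne ℂ (ψ j - χ j) (ψ j) +
      InnerProductSpace.rankOne ℂ (χ j) (ψ j - χ j)) := by
    simp [spanProj]
  rw [h1, Finset.mul_sum]
  refine TraceLE.sum _ fun j _ => ((traceLE_rankOne _ _).add (traceLE_rankOne _ _)).mono ?_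
  have hc : 0 ≤ c := (norm_nonneg _).trans (hψ j)
  have ha0 : 0 ≤ a j := (norm_nonneg _).trans (ha j)
  calc _ ≤ a j * c + c * a j := by
        gcongr
        exacts [ha j, hψ j, hχ j, ha j]
    _ = _ := by ring

/-- The change of `‖p B q‖` in a short time step. -/
theorem offNorm_step_le {ψ ψ' : Fin N → H} (hψ : Orthonormal ℂ ψ) (hψ' : Orthonormal ℂ ψ')
    {M : H →L[ℂ] H} (hM : ∀ x y, ⟪M x, y⟫_ℂ = ⟪x, M y⟫_ℂ) {h : ℝ} (h0 : 0 ≤ h) (h1 : h ≤ 1)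
    {R : ℝ} (hR : R = 2 * (1 + ‖M‖) * ∑ j, ‖ψ' j - eulerStep M h (ψ j)‖) (B : H →L[ℂ] H) :
    offNorm ψ' B ≤ (1 + h ^ 2 * ‖M‖ ^ 2) *
      (offNorm ψ B + h * offNorm ψ (M ∘L B - B ∘L M) + h ^ 2 * (N * (‖M‖ ^ 2 * ‖B‖))) +
      ((1 + ‖M‖ ^ 2) * ‖B‖ * (N * (h ^ 2 * ‖M‖ ^ 2) + R) + R * ‖B‖) := by
  set V := eulerStep M h
  set V' := eulerStep M (-h)
  set μ := ‖M‖
  have hVadj : ∀ x y, ⟪V x, y⟫_ℂ = ⟪x, V' y⟫_ℂ := inner_eulerStep hM h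
  have hVn : ‖V‖ ^ 2 ≤ 1 + h ^ 2 * μ ^ 2 := norm_eulerStep_sq_le hM h
  have hV'n : ‖V'‖ ^ 2 ≤ 1 + h ^ 2 * μ ^ 2 := by
    have := norm_eulerStep_sq_le hM (-h)
    rwa [neg_sq] at this
  have hVV'n : ‖V‖ * ‖V'‖ ≤ 1 + h ^ 2 * μ ^ 2 := by nlinarith [sq_nonneg (‖V‖ - ‖V'‖)]
  have hVV'n2 : ‖V‖ * ‖V'‖ ≤ 1 + μ ^ 2 := by
    have : h ^ 2 ≤ 1 := by nlinarith
    nlinarith [sq_nonneg μ]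
  have hV1 : ‖V‖ ≤ 1 + μ := norm_eulerStep_le M h0 h1
  have hμ : 0 ≤ μ := norm_nonneg _
  set p := spanProj ψ
  set p' := spanProj ψ'
  set D := p' - V ∘L p ∘L V'
  have hPV : spanProj (fun j => V (ψ j)) = V ∘L p ∘L V' := by
    ext x
    simp [p, spanProj_apply, hVadj]
  have hD : TraceLE D R := by
    rw [hR]
    change TraceLE (p' - V ∘L p ∘L V') _
    rw [← hPV]
    refine traceLE_spanProj_sub (fun j => ?_) (fun j => ?_) fun j => le_rfl
    · rw [hψ'.1 j]; linarith
    · refine (le_opNorm _ _).trans ?_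
      rw [hψ.1 j, mul_one]
      exact hV1
  have hDn : p' = V ∘L p ∘L V' + D := by simp [D]
  have hVV' : ∀ x, V (V' x) = x + ((h : ℂ) ^ 2) • M (M x) := eulerStep_eulerStep_neg M h
  set Q : H →L[ℂ] H := ((h : ℂ) ^ 2) • (M ∘L M)
  -- With V V' = 1 + Q and p' = V p V' + D one has q' = V q V' - Q - D. The main term is the old
  -- block of V' B V, and every other term contains Q = O(h²) or D, which is controlled by R.
  have hkey : offDiag ψ' B = V ∘L offDiag ψ (V' ∘L B ∘L V) ∘L V' -
      (V ∘L p ∘L (V' ∘L B ∘L Q) + (V ∘L (p ∘L V') ∘L B) ∘L D) + D ∘L (B ∘L (1 - p')) := by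
    have e1 : (1 : H →L[ℂ] H) - p' = V ∘L (1 - p) ∘L V' - Q - D := by
      rw [hDn]
      ext x
      simp [hVV', Q]
      abel
    have e2 : offDiag ψ' B = (V ∘L p ∘L V') ∘L B ∘L (1 - p') + D ∘L (B ∘L (1 - p')) := by
      rw [← add_comp, ← hDn]
      rfl
    rw [e2]
    congr 1
    rw [e1]
    ext x
    simp only [offDiag, comp_apply, sub_apply, add_apply, map_sub]
    abel
  -- The conjugated operator has first-order part ih[M,B]; this is the source of the commutator in
  -- the growth rate.
  have hmid : V' ∘L B ∘L V = B + (Complex.I * (h : ℂ)) • (M ∘L B - B ∘L M) +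
      ((h : ℂ) ^ 2) • (M ∘L B ∘L M) := by
    ext x
    simp only [V, V', comp_apply, eulerStep_apply, add_apply, smul_apply, sub_apply, map_sub, map_smul,
      smul_sub, smul_smul]
    push_cast
    have : Complex.I * (h : ℂ) * (Complex.I * -(h : ℂ)) = (h : ℂ) ^ 2 := by
      linear_combination (-(h : ℂ) ^ 2) * Complex.I_sq
    rw [this]
    have h2 : Complex.I * (-h : ℂ) = -(Complex.I * h) := by ring
    rw [h2, neg_smul]
    abel
  have hnh : ‖Complex.I * (h : ℂ)‖ = h := by simp [abs_of_nonneg h0]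
  have hnh2 : ‖(h : ℂ) ^ 2‖ = h ^ 2 := by simp
  have t1 : TraceLE (offDiag ψ (V' ∘L B ∘L V)) (offNorm ψ B +
      h * offNorm ψ (M ∘L B - B ∘L M) + h ^ 2 * (N * (μ ^ 2 * ‖B‖))) := by
    rw [hmid, offDiag_add, offDiag_add, offDiag_smul, offDiag_smul]
    have a1 := (traceLE_offDiag hψ (M ∘L B - B ∘L M)).smul (Complex.I * (h : ℂ))
    have a2 := (traceLE_offDiag_norm hψ (M ∘L B ∘L M)).smul ((h : ℂ) ^ 2)
    rw [hnh] at a1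
    rw [hnh2] at a2
    refine ((traceLE_offDiag hψ B).add a1).add (a2.mono ?_)
    gcongr
    calc ‖M ∘L B ∘L M‖ ≤ ‖M‖ * (‖B‖ * ‖M‖) :=
          (opNorm_comp_le _ _).trans (by gcongr; exact opNorm_comp_le _ _)
      _ = _ := by simp only [μ]; ring
  have hQ : ‖Q‖ ≤ h ^ 2 * μ ^ 2 := by
    rw [norm_smul, hnh2]
    gcongr
    refine (opNorm_comp_le _ _).trans_eq ?_
    simp only [μ]; ring
  have hR0 : 0 ≤ R := hD.1
  have t2 : TraceLE (V ∘L p ∘L (V' ∘L B ∘L Q)) ((1 + μ ^ 2) * ‖B‖ * (N * (h ^ 2 * μ ^ 2))) := by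
    refine ((traceLE_spanProj_comp hψ (V' ∘L B ∘L Q)).comp_left V).mono ?_
    calc _ ≤ ‖V‖ * (N * (‖V'‖ * (‖B‖ * (h ^ 2 * μ ^ 2)))) := by
          gcongr
          refine (opNorm_comp_le _ _).trans ?_
          gcongr
          refine (opNorm_comp_le _ _).trans ?_
          gcongr
      _ = (‖V‖ * ‖V'‖) * ‖B‖ * (N * (h ^ 2 * μ ^ 2)) := by ring
      _ ≤ _ := by gcongr
  have t3 : TraceLE ((V ∘L (p ∘L V') ∘L B) ∘L D) ((1 + μ ^ 2) * ‖B‖ * R) := by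
    refine (hD.comp_left _).mono ?_
    gcongr
    calc ‖V ∘L (p ∘L V') ∘L B‖ ≤ ‖V‖ * ((1 * ‖V'‖) * ‖B‖) := by
          refine (opNorm_comp_le _ _).trans ?_
          gcongr
          refine (opNorm_comp_le _ _).trans ?_
          gcongr
          refine (opNorm_comp_le _ _).trans ?_
          gcongr
          exact norm_spanProj_le hψ
      _ = (‖V‖ * ‖V'‖) * ‖B‖ := by ring
      _ ≤ _ := by gcongr
  have t4 : TraceLE (D ∘L (B ∘L (1 - p'))) (R * ‖B‖) := by
    refine (hD.comp_right _).mono ?_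
    gcongr
    refine (opNorm_comp_le _ _).trans ?_
    exact mul_le_of_le_one_right (norm_nonneg _) (norm_one_sub_spanProj_le hψ')
  have t5 : TraceLE (V ∘L offDiag ψ (V' ∘L B ∘L V) ∘L V') ((1 + h ^ 2 * μ ^ 2) * (offNorm ψ B +
      h * offNorm ψ (M ∘L B - B ∘L M) + h ^ 2 * (N * (μ ^ 2 * ‖B‖)))) := by
    refine ((t1.comp_right V').comp_left V).mono ?_
    rw [mul_comm _ ‖V'‖, ← mul_assoc]
    exact mul_le_mul_of_nonneg_right hVV'n t1.1
  refine TraceLE.toReal_le ?_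
  rw [hkey]
  refine ((t5.sub (t2.add t3)).add t4).mono (le_of_eq ?_)
  ring

/-- Lipschitz dependence of the block norm on the orbitals; its use is continuity in time. -/
theorem offNorm_le_add_norm_sub {ψ χ : Fin N → H} (hψ : Orthonormal ℂ ψ) (hχ : Orthonormal ℂ χ)
    (B : H →L[ℂ] H) : offNorm ψ B ≤ offNorm χ B + 4 * ‖B‖ * ∑ j, ‖ψ j - χ j‖ := by
  have hD := traceLE_spanProj_sub (ψ := ψ) (χ := χ) (c := 1) (fun j => (hψ.1 j).le)
    (fun j => (hχ.1 j).le) (fun j => le_rfl)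
  set D := spanProj ψ - spanProj χ
  have h1 : offDiag ψ B = offDiag χ B + (D ∘L (B ∘L (1 - spanProj ψ)) -
      (spanProj χ ∘L B) ∘L D) := by
    ext x
    simp only [offDiag, D, comp_apply, sub_apply, add_apply, map_sub]
    abel
  refine TraceLE.toReal_le ?_
  rw [h1]
  have t1 : TraceLE (D ∘L (B ∘L (1 - spanProj ψ))) ((2 * 1 * ∑ j, ‖ψ j - χ j‖) * ‖B‖) := by
    refine (hD.comp_right _).mono ?_
    refine mul_le_mul_of_nonneg_left ((opNorm_comp_le _ _).trans ?_) hD.1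
    exact mul_le_of_le_one_right (norm_nonneg _) (norm_one_sub_spanProj_le hψ)
  have t2 : TraceLE ((spanProj χ ∘L B) ∘L D) (‖B‖ * (2 * 1 * ∑ j, ‖ψ j - χ j‖)) := by
    refine (hD.comp_left _).mono ?_
    refine mul_le_mul_of_nonneg_right ((opNorm_comp_le _ _).trans ?_) hD.1
    exact mul_le_of_le_one_left (norm_nonneg _) (norm_spanProj_le hχ)
  refine ((traceLE_offDiag hχ B).add (t1.sub t2)).mono (le_of_eq ?_)
  ring

variable [NormedSpace ℝ H] [IsScalarTower ℝ ℂ H] {ψ : Fin N → ℝ → H} {M : ℝ → H →L[ℂ] H} {T : ℝ}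

theorem orthonormal_of_evolution (hM : ∀ s ∈ Set.Icc 0 T, ∀ x y, ⟪M s x, y⟫_ℂ = ⟪x, M s y⟫_ℂ)
    (hψ : ∀ j, ∀ s ∈ Set.Icc 0 T,
      HasDerivWithinAt (ψ j) ((-Complex.I) • M s (ψ j s)) (Set.Icc 0 T) s)
    (h0 : Orthonormal ℂ (fun j => ψ j 0)) {s : ℝ} (hs : s ∈ Set.Icc 0 T) :
    Orthonormal ℂ (fun j => ψ j s) := by
  rw [orthonormal_iff_ite] at h0 ⊢
  intro i j
  rw [← h0 i j]
  have hd : ∀ x ∈ Set.Icc 0 T, HasDerivWithinAt (fun s => ⟪ψ i s, ψ j s⟫_ℂ) 0 (Set.Icc 0 T) x := by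
    intro x hx
    have h1 := (hψ i x hx).inner ℂ (hψ j x hx)
    have h2 : ⟪ψ i x, (-Complex.I) • M x (ψ j x)⟫_ℂ +
        ⟪(-Complex.I) • M x (ψ i x), ψ j x⟫_ℂ = 0 := by
      rw [inner_smul_left, inner_smul_right, hM x hx]
      simp
    rwa [h2] at h1
  refine constant_of_has_deriv_right_zero (f := fun s => ⟪ψ i s, ψ j s⟫_ℂ)
    (fun x hx => (hd x hx).continuousWithinAt) (fun x hx => ?_) s hs
  exact (hd x ⟨hx.1, hx.2.le⟩).mono_of_mem_nhdsWithin (Icc_mem_nhdsGE_of_mem hx)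

/-- Growth of `‖p B q‖` along an evolution with a bounded self-adjoint generator. -/
theorem offNorm_le_of_evolution
    (hM : ∀ s ∈ Set.Icc 0 T, ∀ x y, ⟪M s x, y⟫_ℂ = ⟪x, M s y⟫_ℂ)
    (hψ : ∀ j, ∀ s ∈ Set.Icc 0 T,
      HasDerivWithinAt (ψ j) ((-Complex.I) • M s (ψ j s)) (Set.Icc 0 T) s)
    (hon : ∀ s ∈ Set.Icc 0 T, Orthonormal ℂ (fun j => ψ j s))
    {s₁ s₂ : ℝ} (h01 : 0 ≤ s₁) (h12 : s₁ ≤ s₂) (h2T : s₂ ≤ T) (B : H →L[ℂ] H) {r : ℝ}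
    (hr : ∀ s ∈ Set.Icc s₁ s₂, offNorm (fun j => ψ j s) (M s ∘L B - B ∘L M s) ≤ r) :
    offNorm (fun j => ψ j s₂) B ≤ offNorm (fun j => ψ j s₁) B + r * (s₂ - s₁) := by
  have hsub : Set.Icc s₁ s₂ ⊆ Set.Icc 0 T := Set.Icc_subset_Icc h01 h2T
  set f : ℝ → ℝ := fun s => offNorm (fun j => ψ j s) B
  have hcont : ContinuousOn f (Set.Icc s₁ s₂) := by
    intro s hs
    have h1 : Tendsto (fun z => 4 * ‖B‖ * ∑ j, ‖ψ j z - ψ j s‖) (𝓝[Set.Icc s₁ s₂] s) (𝓝 0) := by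
      have : Tendsto (fun z => 4 * ‖B‖ * ∑ j, ‖ψ j z - ψ j s‖) (𝓝[Set.Icc s₁ s₂] s)
          (𝓝 (4 * ‖B‖ * ∑ j : Fin N, ‖ψ j s - ψ j s‖)) := by
        refine (tendsto_finsetSum _ fun j _ => ?_).const_mul _
        exact (((hψ j s (hsub hs)).continuousWithinAt.mono hsub).sub
          continuousWithinAt_const).norm
      simpa using this
    refine tendsto_iff_norm_sub_tendsto_zero.mpr ?_
    refine squeeze_zero' (Eventually.of_forall fun _ => norm_nonneg _) ?_ h1
    filter_upwards [self_mem_nhdsWithin] with z hz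
    rw [Real.norm_eq_abs, abs_sub_le_iff]
    constructor
    · have := offNorm_le_add_norm_sub (hon z (hsub hz)) (hon s (hsub hs)) B
      simp only [f]; linarith
    · have := offNorm_le_add_norm_sub (hon s (hsub hs)) (hon z (hsub hz)) B
      simp_rw [norm_sub_rev (ψ _ s)] at this
      simp only [f]; linarith
  -- Only the lower right Dini derivative has to be at most r. Thus neither differentiability of the
  -- trace norm nor continuity of M in time is needed: each short step freezes M at its left end
  -- point.
  refine image_le_of_liminf_slope_right_le_deriv_boundary (f := f)
    (B := fun z => f s₁ + r * (z - s₁)) (B' := fun _ => r) hcont (by simp) (by fun_prop)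
    (fun x _ => ?_) (fun x hx r' hr' => ?_) (Set.right_mem_Icc.mpr h12)
  · have := (((hasDerivAt_id x).sub_const s₁).const_mul r).const_add (f s₁)
    simpa using this.hasDerivWithinAt
  have hxT : x ∈ Set.Icc 0 T := hsub ⟨hx.1, hx.2.le⟩
  have hxT' : x < T := hx.2.trans_le h2T
  set μ := ‖M x‖
  set r₀ := offNorm (fun j => ψ j x) (M x ∘L B - B ∘L M x)
  have hr₀ : r₀ < r' := (hr x ⟨hx.1, hx.2.le⟩).trans_lt hr'
  set E : ℝ → ℝ := fun z => ∑ j, ‖ψ j z - eulerStep (M x) (z - x) (ψ j x)‖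
  have hE : Tendsto (fun z => E z / (z - x)) (𝓝[>] x) (𝓝 0) := by
    have h1 : Tendsto (fun z => ∑ j, ‖z - x‖⁻¹ *
        ‖ψ j z - ψ j x - (z - x) • ((-Complex.I) • M x (ψ j x))‖) (𝓝[>] x)
        (𝓝 (∑ _j : Fin N, 0)) := by
      refine tendsto_finsetSum _ fun j _ => ?_
      have h2 := hasDerivWithinAt_iff_tendsto.mp (hψ j x hxT)
      refine h2.mono_left ?_
      rw [nhdsWithin_le_iff]
      exact mem_of_superset (Ioc_mem_nhdsGT hxT') fun z hz => ⟨hxT.1.trans hz.1.le, hz.2⟩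
    rw [Finset.sum_const_zero] at h1
    refine h1.congr' ?_
    filter_upwards [self_mem_nhdsWithin] with z hz
    rw [div_eq_inv_mul, Finset.mul_sum]
    refine Finset.sum_congr rfl fun j _ => ?_
    have hz' : 0 < z - x := sub_pos.mpr hz
    rw [Real.norm_of_nonneg hz'.le, eulerStep_apply]
    congr 2
    rw [neg_smul, smul_neg, ← algebraMap_smul ℂ, Complex.coe_algebraMap, smul_smul, mul_comm]
    abel
  have hid : Tendsto (fun z : ℝ => z - x) (𝓝[>] x) (𝓝 0) := by
    have : Tendsto (fun z : ℝ => z - x) (𝓝 x) (𝓝 (x - x)) := tendsto_id.sub_const x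
    rw [sub_self] at this
    exact this.mono_left nhdsWithin_le_nhds
  -- G is the bound of `offNorm_step_le` minus f x, divided by z - x. All summands vanish as z → x
  -- except r₀; the last one does so because E is the error of the first-order expansion of ψ.
  set G : ℝ → ℝ := fun z => (z - x) * μ ^ 2 * f x +
    (1 + (z - x) ^ 2 * μ ^ 2) * (r₀ + (z - x) * (N * (μ ^ 2 * ‖B‖))) +
    (1 + μ ^ 2) * ‖B‖ * (N * ((z - x) * μ ^ 2)) +
    ((1 + μ ^ 2) * ‖B‖ * (2 * (1 + μ)) + 2 * (1 + μ) * ‖B‖) * (E z / (z - x))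
  have hG : Tendsto G (𝓝[>] x) (𝓝 r₀) := by
    have := ((((hid.mul_const (μ ^ 2)).mul_const (f x)).add
      (((hid.pow 2).mul_const (μ ^ 2)).const_add 1 |>.mul
        ((hid.mul_const (N * (μ ^ 2 * ‖B‖))).const_add r₀))).add
      (((hid.mul_const (μ ^ 2)).const_mul (N : ℝ)).const_mul ((1 + μ ^ 2) * ‖B‖))).add
      (hE.const_mul ((1 + μ ^ 2) * ‖B‖ * (2 * (1 + μ)) + 2 * (1 + μ) * ‖B‖))
    simpa using this
  refine Eventually.frequently ?_
  filter_upwards [hG.eventually_lt_const hr₀, self_mem_nhdsWithin,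
    Ioc_mem_nhdsGT hxT', Ioc_mem_nhdsGT (lt_add_one x)] with z hz1 hz2 hz3 hz4
  refine lt_of_le_of_lt ?_ hz1
  have hz' : 0 < z - x := sub_pos.mpr hz2
  have hstep := offNorm_step_le (hon x hxT) (hon z ⟨hxT.1.trans hz3.1.le, hz3.2⟩) (hM x hxT)
    hz'.le (by linarith [hz4.2]) rfl B
  rw [slope_def_field, div_le_iff₀ hz']
  have hEz : E z / (z - x) * (z - x) = E z := div_mul_cancel₀ _ hz'.ne'
  have e1 : G z * (z - x) = (1 + (z - x) ^ 2 * μ ^ 2) * (f x + (z - x) * r₀ +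
      (z - x) ^ 2 * (N * (μ ^ 2 * ‖B‖))) + ((1 + μ ^ 2) * ‖B‖ * (N * ((z - x) ^ 2 * μ ^ 2) +
        2 * (1 + μ) * E z) + 2 * (1 + μ) * E z * ‖B‖) - f x := by
    simp only [G]
    linear_combination ((1 + μ ^ 2) * ‖B‖ * (2 * (1 + μ)) + 2 * (1 + μ) * ‖B‖) * hEz
  rw [e1]
  exact sub_le_sub_right hstep _

end Evolution

/-! ### Multiplication operators and Fourier multipliers on `L²(ℝ³)` -/

section Multipliers

open Filter Topology

/-- Multiplication by a bounded function on `L²(ℝ³)`. -/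
def mulOp (g : E3 → ℂ) (hg : MemLp g ∞ (volume : Measure E3)) : L2 →L[ℂ] L2 :=
  (ContinuousLinearMap.lsmul ℂ ℂ).holderL volume ∞ 2 2 (hg.toLp g)

theorem mulOp_ae {g : E3 → ℂ} (hg : MemLp g ∞ (volume : Measure E3)) (f : L2) :
    ∀ᵐ x : E3, mulOp g hg f x = g x * f x := by
  have h1 := (ContinuousLinearMap.lsmul ℂ ℂ).coeFn_holder (r := 2) (hg.toLp g) f
  filter_upwards [h1, hg.coeFn_toLp] with x hx hx'
  rw [hx'] at hx
  exact hx

theorem norm_phase (r : ℝ) : ‖Complex.exp (Complex.I * (r : ℂ))‖ = 1 := by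
  rw [mul_comm, Complex.norm_exp_ofReal_mul_I]

theorem memLp_phase (θ : C(E3, ℝ)) :
    MemLp (fun x => Complex.exp (Complex.I * (θ x : ℂ))) ∞ (volume : Measure E3) := by
  refine memLp_top_of_bound (C := 1) ?_ (Eventually.of_forall fun x => (norm_phase _).le)
  apply Continuous.aestronglyMeasurable
  fun_prop

/-- Multiplication by `e^{iθ}`. -/
def phaseMul (θ : C(E3, ℝ)) : L2 →L[ℂ] L2 := mulOp _ (memLp_phase θ)

theorem phaseMul_ae (θ : C(E3, ℝ)) (f : L2) :
    ∀ᵐ x : E3, phaseMul θ f x = Complex.exp (Complex.I * (θ x : ℂ)) * f x := mulOp_ae _ f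

theorem norm_phaseMul_apply (θ : C(E3, ℝ)) (f : L2) : ‖phaseMul θ f‖ = ‖f‖ := by
  rw [Lp.norm_def, Lp.norm_def]
  congr 1
  refine eLpNorm_congr_norm_ae ?_
  filter_upwards [phaseMul_ae θ f] with x hx
  rw [hx, norm_mul, norm_phase, one_mul]

theorem phaseMul_phaseMul (θ θ' : C(E3, ℝ)) (f : L2) :
    phaseMul θ (phaseMul θ' f) = phaseMul (θ + θ') f := by
  refine Lp.ext ?_
  filter_upwards [phaseMul_ae θ (phaseMul θ' f), phaseMul_ae θ' f, phaseMul_ae (θ + θ') f]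
    with x h1 h2 h3
  rw [h1, h2, h3, ← mul_assoc, ← Complex.exp_add]
  simp [mul_add]

theorem phaseMul_const (c : ℝ) (f : L2) :
    phaseMul (ContinuousMap.const _ c) f = Complex.exp (Complex.I * (c : ℂ)) • f := by
  refine Lp.ext ?_
  filter_upwards [phaseMul_ae (ContinuousMap.const _ c) f,
    Lp.coeFn_smul (Complex.exp (Complex.I * (c : ℂ))) f] with x h1 h2
  rw [h1, h2]
  rfl

theorem phaseMul_zero (f : L2) : phaseMul 0 f = f := by
  have := phaseMul_const 0 f
  simpa using this

/-- Translation by `v` on `L²(ℝ³)`. -/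
def shift (v : E3) (f : L2) : L2 :=
  Lp.compMeasurePreserving (fun x => x - v) (measurePreserving_sub_right volume v) f

theorem shift_ae (v : E3) (f : L2) : ∀ᵐ x : E3, shift v f x = f (x - v) :=
  Lp.coeFn_compMeasurePreserving f (measurePreserving_sub_right volume v)

theorem continuous_shift (v : E3) : Continuous (shift v) :=
  (Lp.isometry_compMeasurePreserving (measurePreserving_sub_right volume v)).continuous

/-- A phase function, translated. -/
def shiftPhase (v : E3) (θ : C(E3, ℝ)) : C(E3, ℝ) := ⟨fun x => θ (x - v), by fun_prop⟩

theorem shift_phaseMul (v : E3) (θ : C(E3, ℝ)) (f : L2) :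
    shift v (phaseMul θ f) = phaseMul (shiftPhase v θ) (shift v f) := by
  refine Lp.ext ?_
  have h := (measurePreserving_sub_right volume v).quasiMeasurePreserving.ae (phaseMul_ae θ f)
  filter_upwards [shift_ae v (phaseMul θ f), phaseMul_ae (shiftPhase v θ) (shift v f),
    shift_ae v f, h] with x h1 h2 h3 h4
  rw [h1, h2, h3, h4]
  rfl

/-- The unitary Fourier transform on `L²(ℝ³)`. -/
def fourierL2 : L2 ≃ₗᵢ[ℂ] L2 := Lp.fourierTransformₗᵢ E3 ℂ

theorem fourierInv_compSubConst (v x : E3) (u : 𝓢(E3, ℂ)) :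
    FourierTransform.fourierInv (SchwartzMap.compSubConstCLM ℂ v u) x =
      planeWave ((2 * Real.pi) • v) x * FourierTransform.fourierInv u x := by
  rw [SchwartzMap.fourierInv_coe, SchwartzMap.fourierInv_coe, Real.fourierInv_eq, Real.fourierInv_eq,
    ← integral_const_mul, ← integral_add_right_eq_self _ v]
  refine integral_congr_ae (Eventually.of_forall fun ξ => ?_)
  simp only [Circle.smul_def, smul_eq_mul, ← mul_assoc, SchwartzMap.compSubConstCLM_apply,
    add_sub_cancel_right]
  congr 1
  rw [planeWave, Real.fourierChar_apply, Real.fourierChar_apply, ← Complex.exp_add]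
  congr 1
  rw [inner_add_left, inner_smul_left]
  push_cast
  simp
  ring

/-- Modulation is translation on the Fourier side. Both sides are continuous in g, so Schwartz
functions suffice; the factor 1/(2π) comes from the convention e^{-2πi x·ξ}. -/
theorem expMul_fourierL2_symm (k : E3) (g : L2) :
    expMul k (fourierL2.symm g) = fourierL2.symm (shift ((2 * Real.pi)⁻¹ • k) g) := by
  refine DenseRange.induction_on (p := fun g : L2 => expMul k (fourierL2.symm g) =
    fourierL2.symm (shift ((2 * Real.pi)⁻¹ • k) g))
    (SchwartzMap.denseRange_toLpCLM (p := 2) ENNReal.ofNat_ne_top) g ?_ ?_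
  · exact isClosed_eq ((expMul k).continuous.comp fourierL2.symm.continuous)
      (fourierL2.symm.continuous.comp (continuous_shift _))
  · intro u
    set v := (2 * Real.pi)⁻¹ • k
    have hv : (2 * Real.pi) • v = k := by
      rw [smul_smul, mul_inv_cancel₀ (by positivity), one_smul]
    have h1 : shift v (u.toLp 2) = (SchwartzMap.compSubConstCLM ℂ v u).toLp 2 := by
      refine Lp.ext ?_
      have h := (measurePreserving_sub_right volume v).quasiMeasurePreserving.ae
        (u.coeFn_toLp 2 volume)
      filter_upwards [shift_ae v (u.toLp 2), h,
        (SchwartzMap.compSubConstCLM ℂ v u).coeFn_toLp 2 volume] with x h1 h2 h3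
      rw [h1, h2, h3]
      rfl
    rw [SchwartzMap.toLpCLM_apply, h1]
    have h2 : ∀ w : 𝓢(E3, ℂ), fourierL2.symm (w.toLp 2) =
        (FourierTransform.fourierInv w).toLp 2 := SchwartzMap.toLp_fourierInv_eq
    rw [h2, h2]
    refine Lp.ext ?_
    filter_upwards [expMul_ae k ((FourierTransform.fourierInv u).toLp 2),
      (FourierTransform.fourierInv u).coeFn_toLp 2 volume,
      (FourierTransform.fourierInv (SchwartzMap.compSubConstCLM ℂ v u)).coeFn_toLp 2 volume]
      with x h3 h4 h5
    rw [h3, h4, h5, fourierInv_compSubConst, hv]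

/-- The Fourier multiplier with symbol `e^{iθ}`. -/
def multiplier (θ : C(E3, ℝ)) : L2 →L[ℂ] L2 :=
  (fourierL2.symm : L2 →L[ℂ] L2) ∘L phaseMul θ ∘L (fourierL2 : L2 →L[ℂ] L2)

theorem multiplier_apply (θ : C(E3, ℝ)) (f : L2) :
    multiplier θ f = fourierL2.symm (phaseMul θ (fourierL2 f)) := rfl

theorem norm_multiplier_apply (θ : C(E3, ℝ)) (f : L2) : ‖multiplier θ f‖ = ‖f‖ := by
  rw [multiplier_apply, LinearIsometryEquiv.norm_map, norm_phaseMul_apply,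
    LinearIsometryEquiv.norm_map]

theorem norm_multiplier_le (θ : C(E3, ℝ)) : ‖multiplier θ‖ ≤ 1 :=
  ContinuousLinearMap.opNorm_le_bound _ zero_le_one fun f => by
    rw [norm_multiplier_apply, one_mul]

theorem norm_expMul_apply (k : E3) (f : L2) : ‖expMul k f‖ = ‖f‖ := by
  rw [Lp.norm_def, Lp.norm_def]
  congr 1
  refine eLpNorm_congr_norm_ae ?_
  filter_upwards [expMul_ae k f] with x hx
  rw [hx, norm_mul, planeWave, norm_phase, one_mul]

theorem norm_expMul_le (k : E3) : ‖expMul k‖ ≤ 1 :=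
  ContinuousLinearMap.opNorm_le_bound _ zero_le_one fun f => by
    rw [norm_expMul_apply, one_mul]

theorem multiplier_multiplier (θ θ' : C(E3, ℝ)) (f : L2) :
    multiplier θ (multiplier θ' f) = multiplier (θ + θ') f := by
  simp only [multiplier_apply, LinearIsometryEquiv.apply_symm_apply, phaseMul_phaseMul]

theorem multiplier_const (c : ℝ) (f : L2) :
    multiplier (ContinuousMap.const _ c) f = Complex.exp (Complex.I * (c : ℂ)) • f := by
  rw [multiplier_apply, phaseMul_const, map_smul, LinearIsometryEquiv.symm_apply_apply]

theorem multiplier_zero (f : L2) : multiplier 0 f = f := by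
  rw [multiplier_apply, phaseMul_zero, LinearIsometryEquiv.symm_apply_apply]

theorem multiplier_apply_neg (θ : C(E3, ℝ)) (f : L2) :
    multiplier θ (multiplier (-θ) f) = f := by
  rw [multiplier_multiplier, add_neg_cancel, multiplier_zero]

theorem inner_multiplier (θ : C(E3, ℝ)) (f g : L2) :
    ⟪multiplier θ f, g⟫_ℂ = ⟪f, multiplier (-θ) g⟫_ℂ := by
  let U : L2 →ₗᵢ[ℂ] L2 := ⟨(multiplier θ : L2 →ₗ[ℂ] L2), norm_multiplier_apply θ⟩
  have := U.inner_map_map f (multiplier (-θ) g)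
  rw [← this]
  change _ = ⟪multiplier θ f, multiplier θ (multiplier (-θ) g)⟫_ℂ
  rw [multiplier_apply_neg]

theorem expMul_multiplier (k : E3) (θ : C(E3, ℝ)) (f : L2) :
    expMul k (multiplier θ f) = multiplier (shiftPhase ((2 * Real.pi)⁻¹ • k) θ) (expMul k f) := by
  obtain ⟨g, rfl⟩ := fourierL2.symm.surjective f
  simp only [multiplier_apply, LinearIsometryEquiv.apply_symm_apply, expMul_fourierL2_symm,
    shift_phaseMul]

theorem integrable_norm_sq (f : L2) : Integrable (fun x => ‖f x‖ ^ 2) (volume : Measure E3) :=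
  (memLp_two_iff_integrable_sq_norm (Lp.aestronglyMeasurable f)).mp (Lp.memLp f)

theorem l2_norm_sq (f : L2) : ‖f‖ ^ 2 = ∫ x : E3, ‖f x‖ ^ 2 := by
  have h1 : ((‖f‖ ^ 2 : ℝ) : ℂ) = ((∫ x : E3, ‖f x‖ ^ 2 : ℝ) : ℂ) := by
    push_cast
    rw [← integral_complex_ofReal]
    have h2 := inner_self_eq_norm_sq_to_K (𝕜 := ℂ) f
    rw [L2.inner_def] at h2
    refine h2.symm.trans (integral_congr_ae (Eventually.of_forall fun x => ?_))
    change ⟪f x, f x⟫_ℂ = _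
    rw [inner_self_eq_norm_sq_to_K]
    push_cast
    rfl
  exact_mod_cast h1

/-- Stone's formula: the derivative of `e^{isθ} f` at `s = 0` is `iθ f` if the latter is in `L²`. -/
theorem hasDerivAt_phaseMul (θ : C(E3, ℝ)) {f g : L2}
    (hg : ∀ᵐ ξ : E3, g ξ = Complex.I * (θ ξ : ℂ) * f ξ) :
    HasDerivAt (fun s : ℝ => phaseMul (s • θ) f) g 0 := by
  rw [hasDerivAt_iff_tendsto_slope]
  have key : ∀ s : ℝ, s ≠ 0 → ∀ᵐ ξ : E3, (slope (fun s : ℝ => phaseMul (s • θ) f) 0 s - g) ξ =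
      ((Complex.exp (Complex.I * ((s * θ ξ : ℝ) : ℂ)) - 1) / s - Complex.I * (θ ξ : ℂ)) * f ξ := by
    intro s hs
    have h1 : slope (fun s : ℝ => phaseMul (s • θ) f) 0 s = s⁻¹ • (phaseMul (s • θ) f - f) := by
      rw [slope_def_module, zero_smul, phaseMul_zero, sub_zero]
    rw [h1]
    filter_upwards [hg, phaseMul_ae (s • θ) f, Lp.coeFn_sub (s⁻¹ • (phaseMul (s • θ) f - f)) g,
      Lp.coeFn_smul s⁻¹ (phaseMul (s • θ) f - f), Lp.coeFn_sub (phaseMul (s • θ) f) f]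
      with ξ h2 h3 h4 h5 h6
    rw [h4, Pi.sub_apply, h5, Pi.smul_apply, h6, Pi.sub_apply, h3, h2, Complex.real_smul]
    simp only [ContinuousMap.smul_apply, smul_eq_mul]
    push_cast
    ring
  have hcpt : ∀ (s : ℝ) (r : ℝ), s ≠ 0 →
      ‖(Complex.exp (Complex.I * ((s * r : ℝ) : ℂ)) - 1) / s - Complex.I * (r : ℂ)‖ ≤ 2 * |r| := by
    intro s r hs
    have h1 : ‖(Complex.exp (Complex.I * ((s * r : ℝ) : ℂ)) - 1) / s‖ ≤ |r| := by
      rw [norm_div, Complex.norm_real, Real.norm_eq_abs, div_le_iff₀ (abs_pos.mpr hs)]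
      refine (Real.norm_exp_I_mul_ofReal_sub_one_le).trans_eq ?_
      rw [Real.norm_eq_abs, abs_mul, mul_comm]
    refine (norm_sub_le _ _).trans ?_
    rw [norm_mul, Complex.norm_I, one_mul, Complex.norm_real, Real.norm_eq_abs]
    linarith
  have hlim : ∀ r : ℝ, Tendsto (fun s : ℝ => (Complex.exp (Complex.I * ((s * r : ℝ) : ℂ)) - 1) / s -
      Complex.I * (r : ℂ)) (𝓝[≠] 0) (𝓝 0) := by
    intro r
    have h1 : HasDerivAt (fun s : ℝ => Complex.exp (Complex.I * ((s * r : ℝ) : ℂ)))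
        (Complex.I * r) 0 := by
      have h2 : HasDerivAt (fun s : ℝ => Complex.I * ((s * r : ℝ) : ℂ)) (Complex.I * r) 0 := by
        have h3 := (((hasDerivAt_id (0 : ℝ)).mul_const r).ofReal_comp).const_mul Complex.I
        simpa using h3
      simpa using h2.cexp
    rw [hasDerivAt_iff_tendsto_slope] at h1
    have h4 := h1.sub_const (Complex.I * r)
    rw [sub_self] at h4
    refine h4.congr fun s => ?_
    rw [slope_def_module]
    simp [Complex.real_smul, div_eq_inv_mul]
  set c : ℝ → ℝ → ℂ := fun s r =>
    (Complex.exp (Complex.I * ((s * r : ℝ) : ℂ)) - 1) / s - Complex.I * (r : ℂ)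
  rw [tendsto_iff_norm_sub_tendsto_zero]
  have hsq : Tendsto (fun s : ℝ => ‖slope (fun s : ℝ => phaseMul (s • θ) f) 0 s - g‖ ^ 2)
      (𝓝[≠] 0) (𝓝 0) := by
    have h1 : Tendsto (fun s : ℝ => ∫ ξ : E3, ‖c s (θ ξ) * f ξ‖ ^ 2) (𝓝[≠] 0)
        (𝓝 (∫ _ξ : E3, (0 : ℝ))) := by
      -- The difference quotient differs from its limit iθ by at most 2|θ|, and |θ f| = |g|, hence
      -- the square-integrable majorant.
      refine tendsto_integral_filter_of_dominated_convergence (fun ξ => 4 * ‖g ξ‖ ^ 2) ?_ ?_ ?_ ?_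
      · refine Eventually.of_forall fun s => ?_
        refine (AEStronglyMeasurable.mul ?_ (Lp.aestronglyMeasurable f)).norm.pow 2
        apply Continuous.aestronglyMeasurable
        fun_prop
      · filter_upwards [self_mem_nhdsWithin] with s hs
        filter_upwards [hg] with ξ h2
        rw [Real.norm_of_nonneg (by positivity), h2]
        simp only [norm_mul, Complex.norm_I, one_mul, Complex.norm_real, Real.norm_eq_abs]
        have h3 := hcpt s (θ ξ) hs
        calc (‖c s (θ ξ)‖ * ‖f ξ‖) ^ 2 ≤ (2 * |θ ξ| * ‖f ξ‖) ^ 2 := by gcongr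
          _ = _ := by ring
      · exact (integrable_norm_sq g).const_mul 4
      · refine Eventually.of_forall fun ξ => ?_
        have := (((hlim (θ ξ)).mul_const (f ξ)).norm).pow 2
        rw [zero_mul, norm_zero, zero_pow two_ne_zero] at this
        exact this
    rw [integral_zero] at h1
    refine h1.congr' ?_
    filter_upwards [self_mem_nhdsWithin] with s hs
    rw [l2_norm_sq]
    refine integral_congr_ae ?_
    filter_upwards [key s hs] with ξ h2
    rw [h2]
  have := hsq.sqrt
  simpa [Real.sqrt_sq] using this

theorem hasDerivAt_multiplier (θ : C(E3, ℝ)) {f g : L2}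
    (hg : ∀ᵐ ξ : E3, fourierL2 g ξ = Complex.I * (θ ξ : ℂ) * fourierL2 f ξ) :
    HasDerivAt (fun s : ℝ => multiplier (s • θ) f) g 0 := by
  have h1 := hasDerivAt_phaseMul θ hg
  have h2 := (((fourierL2.symm : L2 →L[ℂ] L2).restrictScalars ℝ).hasFDerivAt.comp_hasDerivAt _ h1)
  have h3 : (((fourierL2.symm : L2 →L[ℂ] L2).restrictScalars ℝ)) (fourierL2 g) = g :=
    fourierL2.symm_apply_apply g
  rw [h3] at h2
  exact h2

/-- An identity of distributions is tested against smooth compactly supported functions, seen as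
Schwartz functions, which determine a locally integrable function almost everywhere. This turns the
weak derivatives into Fourier symbols. -/
theorem ae_eq_of_smulLeftCLM {h : E3 → ℝ} (hh : h.HasTemperateGrowth) {f g : L2}
    (hfg : (g : 𝓢'(E3, ℂ)) =
      TemperedDistribution.smulLeftCLM ℂ (fun x => (h x : ℂ)) (f : 𝓢'(E3, ℂ))) :
    ∀ᵐ x : E3, g x = (h x : ℂ) * f x := by
  have hc : Continuous h := hh.1.continuous
  have hC : Function.HasTemperateGrowth (fun x => (h x : ℂ)) := by fun_prop
  have hf : LocallyIntegrable (f : E3 → ℂ) volume := (Lp.memLp f).locallyIntegrable (by norm_num)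
  refine ae_eq_of_integral_contDiff_smul_eq ((Lp.memLp g).locallyIntegrable (by norm_num)) ?_ ?_
  · have h1 : LocallyIntegrableOn (fun x => (h x : ℂ) * f x) Set.univ volume :=
      (locallyIntegrableOn_univ.mpr hf).continuousOn_mul (by fun_prop) isOpen_univ.isLocallyClosed
    exact locallyIntegrableOn_univ.mp h1
  · intro u hu hcs
    have hu1 : HasCompactSupport (Complex.ofRealCLM ∘ u) := hcs.comp_left rfl
    have hu2 : ContDiff ℝ ((⊤ : ℕ∞) : WithTop ℕ∞) (Complex.ofRealCLM ∘ u) := by fun_prop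
    have h2 := congrArg (fun D : 𝓢'(E3, ℂ) => D (hu1.toSchwartzMap hu2)) hfg
    simp only [TemperedDistribution.smulLeftCLM_apply_apply, Lp.toTemperedDistribution_apply] at h2
    simp only [SchwartzMap.smulLeftCLM_apply_apply hC] at h2
    have h3 : ∀ x, (hu1.toSchwartzMap hu2) x = (u x : ℂ) := fun x => rfl
    simp only [h3, smul_eq_mul] at h2
    simp only [Complex.real_smul]
    rw [h2]
    refine integral_congr_ae (Eventually.of_forall fun x => ?_)
    simp only
    ring

theorem toTemperedDistribution_smul (c : ℂ) (f : L2) :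
    ((c • f : L2) : 𝓢'(E3, ℂ)) = c • (f : 𝓢'(E3, ℂ)) :=
  map_smul (Lp.toTemperedDistributionCLM ℂ (volume : Measure E3) 2) c f

theorem ae_eq_of_smul_smulLeftCLM {h : E3 → ℝ} (hh : h.HasTemperateGrowth) {c : ℂ} (hc : c ≠ 0)
    {f g : L2} (hfg : (g : 𝓢'(E3, ℂ)) =
      c • TemperedDistribution.smulLeftCLM ℂ (fun x => (h x : ℂ)) (f : 𝓢'(E3, ℂ))) :
    ∀ᵐ x : E3, g x = c * ((h x : ℂ) * f x) := by
  have h1 : ((c⁻¹ • g : L2) : 𝓢'(E3, ℂ)) =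
      TemperedDistribution.smulLeftCLM ℂ (fun x => (h x : ℂ)) (f : 𝓢'(E3, ℂ)) := by
    rw [toTemperedDistribution_smul, hfg, smul_smul, inv_mul_cancel₀ hc, one_smul]
  filter_upwards [ae_eq_of_smulLeftCLM hh h1, Lp.coeFn_smul c⁻¹ g] with x h2 h3
  rw [← h2, h3, Pi.smul_apply, smul_eq_mul, mul_inv_cancel_left₀ hc]

theorem fourierL2_weakPartial {φ : L2} (hφ : MemH2 φ) (l : Fin 3) :
    ∀ᵐ ξ : E3, fourierL2 (weakPartial l φ) ξ =
      Complex.I * ((2 * Real.pi * ξ l : ℝ) : ℂ) * fourierL2 φ ξ := by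
  have h1 := congrArg (fun D : 𝓢'(E3, ℂ) => (FourierTransform.fourier D : 𝓢'(E3, ℂ)))
    (coe_weakPartial hφ l)
  beta_reduce at h1
  rw [TemperedDistribution.fourier_lineDerivOp_eq, Lp.fourier_toTemperedDistribution_eq,
    Lp.fourier_toTemperedDistribution_eq] at h1
  have h2 := ae_eq_of_smul_smulLeftCLM (by fun_prop)
    (mul_ne_zero (mul_ne_zero two_ne_zero (Complex.ofReal_ne_zero.mpr Real.pi_ne_zero))
      Complex.I_ne_zero) h1
  filter_upwards [h2] with ξ h3
  refine h3.trans ?_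
  rw [EuclideanSpace.inner_single_right]
  simp only [one_mul, conj_trivial]
  push_cast
  change _ = Complex.I * (2 * Real.pi * ξ l) * (FourierTransform.fourier φ : L2) ξ
  ring

theorem fourierL2_weakLaplacian {φ : L2} (hφ : MemH2 φ) :
    ∀ᵐ ξ : E3, fourierL2 (weakLaplacian φ) ξ =
      ((-(2 * Real.pi) ^ 2 * ‖ξ‖ ^ 2 : ℝ) : ℂ) * fourierL2 φ ξ := by
  have h1 := congrArg (fun D : 𝓢'(E3, ℂ) => (FourierTransform.fourier D : 𝓢'(E3, ℂ)))
    (coe_weakLaplacian hφ)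
  beta_reduce at h1
  rw [TemperedDistribution.laplacian_eq_fourierMultiplierCLM, ← Complex.coe_smul,
    FourierTransform.fourier_smul,
    TemperedDistribution.fourierMultiplierCLM_apply, FourierTransform.fourier_fourierInv_eq,
    Lp.fourier_toTemperedDistribution_eq, Lp.fourier_toTemperedDistribution_eq] at h1
  have hc : ((-(2 * Real.pi) ^ 2 : ℝ) : ℂ) ≠ 0 := by
    rw [Complex.ofReal_ne_zero]
    exact neg_ne_zero.mpr (by positivity)
  have h2 := ae_eq_of_smul_smulLeftCLM (h := fun x : E3 => ‖x‖ ^ 2)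
    (Function.hasTemperateGrowth_norm_sq E3) hc h1
  filter_upwards [h2] with ξ h3
  refine h3.trans ?_
  rw [Complex.ofReal_mul, mul_assoc]
  rfl

end Multipliers

/-! ### Translations and the free Schrödinger group -/

section Groups

open Filter Topology

theorem tendsto_multiplier (θ : C(E3, ℝ)) (f : L2) :
    Tendsto (fun s : ℝ => multiplier (s • θ) f) (𝓝 0) (𝓝 f) := by
  have hph : Tendsto (fun s : ℝ => phaseMul (s • θ) (fourierL2 f)) (𝓝 0) (𝓝 (fourierL2 f)) := by
    set g := fourierL2 f
    rw [tendsto_iff_norm_sub_tendsto_zero]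
    have h1 : Tendsto (fun s : ℝ => ∫ ξ : E3,
        ‖(Complex.exp (Complex.I * ((s * θ ξ : ℝ) : ℂ)) - 1) * g ξ‖ ^ 2) (𝓝 0)
        (𝓝 (∫ _ξ : E3, (0 : ℝ))) := by
      refine tendsto_integral_filter_of_dominated_convergence (fun ξ => 4 * ‖g ξ‖ ^ 2) ?_ ?_ ?_ ?_
      · refine Eventually.of_forall fun s => ?_
        refine (AEStronglyMeasurable.mul ?_ (Lp.aestronglyMeasurable g)).norm.pow 2
        apply Continuous.aestronglyMeasurable
        fun_prop
      · refine Eventually.of_forall fun s => Eventually.of_forall fun ξ => ?_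
        rw [Real.norm_of_nonneg (by positivity), norm_mul]
        have h3 : ‖Complex.exp (Complex.I * ((s * θ ξ : ℝ) : ℂ)) - 1‖ ≤ 2 := by
          refine (norm_sub_le _ _).trans ?_
          rw [norm_phase, norm_one]
          norm_num
        calc _ ≤ (2 * ‖g ξ‖) ^ 2 := by gcongr
          _ = _ := by ring
      · exact (integrable_norm_sq g).const_mul 4
      · refine Eventually.of_forall fun ξ => ?_
        have h2 : Continuous (fun s : ℝ =>
            ‖(Complex.exp (Complex.I * ((s * θ ξ : ℝ) : ℂ)) - 1) * g ξ‖ ^ 2) := by fun_prop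
        have := h2.tendsto 0
        simpa using this
    rw [integral_zero] at h1
    have h2 : ∀ s : ℝ, ‖phaseMul (s • θ) g - g‖ = √(∫ ξ : E3,
        ‖(Complex.exp (Complex.I * ((s * θ ξ : ℝ) : ℂ)) - 1) * g ξ‖ ^ 2) := fun s => by
      rw [← Real.sqrt_sq (norm_nonneg (phaseMul (s • θ) g - g)), l2_norm_sq]
      congr 1
      refine integral_congr_ae ?_
      filter_upwards [phaseMul_ae (s • θ) g, Lp.coeFn_sub (phaseMul (s • θ) g) g] with ξ h3 h4
      rw [h4, Pi.sub_apply, h3, sub_mul, one_mul]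
      rfl
    simp_rw [h2]
    simpa using h1.sqrt
  have h3 := (fourierL2.symm.continuous.tendsto (fourierL2 f)).comp hph
  rw [LinearIsometryEquiv.symm_apply_apply] at h3
  exact h3

/-- The symbol of `a · ∇`, divided by `i`. -/
def gradSymbol (a : E3) : C(E3, ℝ) := ⟨fun ξ => 2 * Real.pi * ⟪a, ξ⟫_ℝ, by fun_prop⟩

/-- The symbol of the Laplacian. -/
def laplaceSymbol : C(E3, ℝ) := ⟨fun ξ => -(2 * Real.pi) ^ 2 * ‖ξ‖ ^ 2, by fun_prop⟩

/-- The translation `e^{a · ∇}`. -/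
def transl (a : E3) : L2 →L[ℂ] L2 := multiplier (gradSymbol a)

/-- The free Schrödinger group `e^{icΔ}`. -/
def freeProp (c : ℝ) : L2 →L[ℂ] L2 := multiplier (c • laplaceSymbol)

theorem norm_transl_le (a : E3) : ‖transl a‖ ≤ 1 := norm_multiplier_le _

theorem norm_freeProp_le (c : ℝ) : ‖freeProp c‖ ≤ 1 := norm_multiplier_le _

theorem norm_freeProp_apply (c : ℝ) (f : L2) : ‖freeProp c f‖ = ‖f‖ := norm_multiplier_apply _ f

theorem transl_add (a b : E3) : transl (a + b) = transl a ∘L transl b := by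
  have h : gradSymbol (a + b) = gradSymbol a + gradSymbol b := by
    ext ξ
    simp [gradSymbol, inner_add_left, mul_add]
  ext1 f
  rw [ContinuousLinearMap.comp_apply, transl, transl, transl, h, multiplier_multiplier]

theorem transl_zero : transl 0 = 1 := by
  have h : gradSymbol 0 = 0 := by
    ext ξ
    simp [gradSymbol]
  ext1 f
  rw [transl, h, multiplier_zero]
  rfl

theorem freeProp_freeProp (b c : ℝ) (f : L2) : freeProp b (freeProp c f) = freeProp (b + c) f := by
  rw [freeProp, freeProp, multiplier_multiplier, ← add_smul]
  rfl

theorem freeProp_zero (f : L2) : freeProp 0 f = f := by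
  rw [freeProp, zero_smul, multiplier_zero]

theorem inner_freeProp (c : ℝ) (f g : L2) : ⟪freeProp c f, g⟫_ℂ = ⟪f, freeProp (-c) g⟫_ℂ := by
  rw [freeProp, inner_multiplier, ← neg_smul]
  rfl

theorem freeProp_transl (c : ℝ) (a : E3) (f : L2) :
    freeProp c (transl a f) = transl a (freeProp c f) := by
  rw [freeProp, transl, multiplier_multiplier, multiplier_multiplier, add_comm]

/-- The symbol of T_a is linear, so a shift of the frequency by k changes it by the constant -a·k.
-/
theorem expMul_transl (k a : E3) :
    expMul k ∘L transl a = Complex.exp (Complex.I * ((-⟪a, k⟫_ℝ : ℝ) : ℂ)) •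
      (transl a ∘L expMul k) := by
  ext1 f
  have h1 : shiftPhase ((2 * Real.pi)⁻¹ • k) (gradSymbol a) =
      gradSymbol a + ContinuousMap.const _ (-⟪a, k⟫_ℝ) := by
    ext ξ
    simp only [shiftPhase, gradSymbol, ContinuousMap.coe_mk, ContinuousMap.add_apply,
      ContinuousMap.const_apply, inner_sub_right, inner_smul_right]
    field_simp
    ring
  rw [ContinuousLinearMap.comp_apply, transl, expMul_multiplier, h1, ← multiplier_multiplier,
    multiplier_const, map_smul]
  rfl

/-- The symbol of Δ is quadratic: shifting it produces a linear term, which is a translation by 2ck,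
and a constant, which is a phase. This exact identity replaces the commutator of Δ with e^{ikx}. -/
theorem expMul_freeProp (k : E3) (c : ℝ) :
    freeProp (-c) ∘L expMul k ∘L freeProp c =
      Complex.exp (Complex.I * ((-(c * ‖k‖ ^ 2) : ℝ) : ℂ)) •
        (transl ((2 * c) • k) ∘L expMul k) := by
  ext1 f
  have h1 : shiftPhase ((2 * Real.pi)⁻¹ • k) (c • laplaceSymbol) =
      c • laplaceSymbol + (gradSymbol ((2 * c) • k) +
        ContinuousMap.const _ (-(c * ‖k‖ ^ 2))) := by
    ext ξ
    simp only [shiftPhase, gradSymbol, laplaceSymbol, ContinuousMap.coe_mk, ContinuousMap.add_apply,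
      ContinuousMap.smul_apply, ContinuousMap.const_apply, smul_eq_mul]
    rw [norm_sub_sq_real, inner_smul_right, inner_smul_left, norm_smul, real_inner_comm,
      mul_pow ‖(2 * Real.pi)⁻¹‖, Real.norm_eq_abs, sq_abs, conj_trivial]
    field_simp
    ring
  change freeProp (-c) (expMul k (multiplier (c • laplaceSymbol) f)) = _
  rw [expMul_multiplier, h1, ← multiplier_multiplier]
  change freeProp (-c) (freeProp c _) = _
  rw [freeProp_freeProp, neg_add_cancel, freeProp_zero, ← multiplier_multiplier, multiplier_const,
    map_smul]
  rfl

theorem expMul_expMul (k k' : E3) : expMul k ∘L expMul k' = expMul k' ∘L expMul k := by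
  ext1 f
  refine Lp.ext ?_
  filter_upwards [expMul_ae k (expMul k' f), expMul_ae k' f, expMul_ae k' (expMul k f),
    expMul_ae k f] with x h1 h2 h3 h4
  simp only [ContinuousLinearMap.comp_apply]
  rw [h1, h2, h3, h4]
  ring

theorem hasDerivAt_transl {φ : L2} (hφ : MemH2 φ) (a : E3) :
    HasDerivAt (fun s : ℝ => transl (s • a) φ) (∑ l, ((a l : ℝ) : ℂ) • weakPartial l φ) 0 := by
  have h1 : ∀ s : ℝ, transl (s • a) φ = multiplier (s • gradSymbol a) φ := fun s => by
    rw [transl]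
    congr 2
    ext ξ
    simp only [gradSymbol, ContinuousMap.coe_mk, ContinuousMap.smul_apply, inner_smul_left,
      conj_trivial, smul_eq_mul]
    ring
  simp_rw [h1]
  refine hasDerivAt_multiplier _ ?_
  rw [map_sum]
  simp_rw [map_smul]
  have h2 : ∀ᵐ ξ : E3, ∀ l, fourierL2 (weakPartial l φ) ξ =
      Complex.I * ((2 * Real.pi * ξ l : ℝ) : ℂ) * fourierL2 φ ξ :=
    ae_all_iff.mpr fun l => fourierL2_weakPartial hφ l
  have h3 : ∀ᵐ ξ : E3, ∀ l, (((a l : ℝ) : ℂ) • fourierL2 (weakPartial l φ) : L2) ξ =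
      ((a l : ℝ) : ℂ) * fourierL2 (weakPartial l φ) ξ :=
    ae_all_iff.mpr fun l => Lp.coeFn_smul _ _
  rw [Fin.sum_univ_three]
  filter_upwards [h2, h3, Lp.coeFn_add (((a 0 : ℝ) : ℂ) • fourierL2 (weakPartial 0 φ) +
    ((a 1 : ℝ) : ℂ) • fourierL2 (weakPartial 1 φ)) (((a 2 : ℝ) : ℂ) • fourierL2 (weakPartial 2 φ)),
    Lp.coeFn_add (((a 0 : ℝ) : ℂ) • fourierL2 (weakPartial 0 φ))
      (((a 1 : ℝ) : ℂ) • fourierL2 (weakPartial 1 φ))] with ξ h4 h5 h6 h7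
  rw [h6, Pi.add_apply, h7, Pi.add_apply, h5, h5, h5, h4, h4, h4]
  simp only [gradSymbol, ContinuousMap.coe_mk, PiLp.inner_apply, Fin.sum_univ_three]
  simp only [RCLike.inner_apply, conj_trivial]
  push_cast
  ring

theorem hasDerivAt_freeProp {φ : L2} (hφ : MemH2 φ) :
    HasDerivAt (fun s : ℝ => freeProp s φ) (Complex.I • weakLaplacian φ) 0 := by
  refine hasDerivAt_multiplier _ ?_
  rw [map_smul]
  filter_upwards [fourierL2_weakLaplacian hφ,
    Lp.coeFn_smul Complex.I (fourierL2 (weakLaplacian φ))] with ξ h1 h2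
  rw [h2, Pi.smul_apply, h1, smul_eq_mul, mul_assoc]
  rfl

/-- The derivative in the interaction picture. -/
theorem hasDerivWithinAt_interaction {φ : ℝ → L2} {dφ : L2} {S : Set ℝ} {s : ℝ} (c : ℝ)
    (h : HasDerivWithinAt φ dφ S s) (hφ : MemH2 (φ s)) :
    HasDerivWithinAt (fun z => freeProp (-(c * z)) (φ z))
      (freeProp (-(c * s)) (dφ - (c : ℂ) • Complex.I • weakLaplacian (φ s))) S s := by
  rw [hasDerivWithinAt_iff_tendsto_slope] at h ⊢
  have hlin : Tendsto (fun z : ℝ => -(c * (z - s))) (𝓝[S \ {s}] s) (𝓝 0) := by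
    have : Continuous (fun z : ℝ => -(c * (z - s))) := by fun_prop
    have := this.tendsto s
    simp only [sub_self, mul_zero, neg_zero] at this
    exact this.mono_left nhdsWithin_le_nhds
  -- The free group is only strongly continuous, so the product rule is proved on slopes: isometry
  -- handles the varying argument here, and only the fixed vector φ(s) has to lie in H² for the
  -- other term `h5`.
  have h1 : Tendsto (fun z => freeProp (-(c * (z - s))) (slope φ s z)) (𝓝[S \ {s}] s) (𝓝 dφ) := by
    have h2 : Tendsto (fun z => freeProp (-(c * (z - s))) dφ) (𝓝[S \ {s}] s) (𝓝 dφ) :=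
      (tendsto_multiplier laplaceSymbol dφ).comp hlin
    have h3 : Tendsto (fun z => freeProp (-(c * (z - s))) (slope φ s z - dφ)) (𝓝[S \ {s}] s)
        (𝓝 0) := by
      rw [tendsto_zero_iff_norm_tendsto_zero]
      simp_rw [norm_freeProp_apply]
      rw [← tendsto_iff_norm_sub_tendsto_zero]
      exact h
    have h4 := h3.add h2
    rw [zero_add] at h4
    refine h4.congr fun z => ?_
    rw [← map_add, sub_add_cancel]
  have h5 : Tendsto (fun z => slope (fun z => freeProp (-(c * (z - s))) (φ s)) s z)
      (𝓝[S \ {s}] s) (𝓝 (-((c : ℂ) • Complex.I • weakLaplacian (φ s)))) := by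
    have h6 : HasDerivAt (fun z : ℝ => -(c * (z - s))) (-c) s := by
      have := (((hasDerivAt_id s).sub_const s).const_mul c).neg
      rw [mul_one] at this
      exact this
    have h7 := (hasDerivAt_freeProp hφ).scomp_of_eq s h6 (by simp)
    rw [← algebraMap_smul ℂ, Complex.coe_algebraMap, Complex.ofReal_neg, neg_smul] at h7
    exact hasDerivWithinAt_iff_tendsto_slope.mp h7.hasDerivWithinAt
  have h8 := ((freeProp (-(c * s))).continuous.tendsto _).comp (h1.add h5)
  rw [← sub_eq_add_neg] at h8
  refine h8.congr fun z => ?_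
  have e1 : -(c * z) = -(c * s) + -(c * (z - s)) := by ring
  simp only [Function.comp_apply, slope_def_module]
  rw [sub_self, mul_zero, neg_zero, freeProp_zero, e1, ← freeProp_freeProp, ← map_sub,
    ← ContinuousLinearMap.map_smul_of_tower]
  congr 1
  rw [ContinuousLinearMap.map_smul_of_tower, ← smul_add, map_sub]
  congr 1
  abel

end Groups

/-! ### The classical field -/

section Field

open Filter Topology

/-! ### Square integrability of the form factor, uniformly in the mass -/

theorem eta_nonneg (m Λ : ℝ) (k : E3) : 0 ≤ eta m Λ k := by
  unfold eta
  split_ifs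
  · positivity
  · exact le_rfl

theorem eta_eq_zero {m Λ : ℝ} {k : E3} (hk : Λ < ‖k‖) : eta m Λ k = 0 := if_neg hk.not_ge

theorem measurable_eta (m Λ : ℝ) : Measurable (eta m Λ) := by
  unfold eta omega
  refine Measurable.ite (measurableSet_le measurable_norm measurable_const) ?_ measurable_const
  fun_prop

/-- The mass is discarded through ω(k) ≥ |k|. The origin is excluded because the right-hand side is
0 there by the convention for division by zero. -/
theorem eta_sq_le {m Λ : ℝ} {k : E3} (hk : k ≠ 0) : eta m Λ k ^ 2 ≤
    Set.indicator (Set.Iic Λ) (fun y => (2 * Real.pi) ^ (-3 : ℝ) / (2 * y)) ‖k‖ := by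
  have hk0 : 0 < ‖k‖ := norm_pos_iff.mpr hk
  rcases le_or_gt ‖k‖ Λ with h | h
  · rw [Set.indicator_of_mem (show ‖k‖ ∈ Set.Iic Λ from h), eta, if_pos h, div_pow, Real.sq_sqrt
      (by unfold omega; positivity), ← Real.rpow_natCast, ← Real.rpow_mul (by positivity)]
    have h1 : ‖k‖ ≤ omega m k := Real.le_sqrt_of_sq_le (by nlinarith [sq_nonneg m])
    norm_num
    gcongr
  · rw [eta_eq_zero h, Set.indicator_of_notMem (show ‖k‖ ∉ Set.Iic Λ from h.not_ge)]
    norm_num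

theorem setIntegral_radial (c Λ : ℝ) (hΛ : 0 ≤ Λ) :
    IntegrableOn (fun y : ℝ => y ^ 2 • Set.indicator (Set.Iic Λ) (fun y => c / (2 * y)) y)
      (Set.Ioi 0) ∧
    ∫ y in Set.Ioi (0 : ℝ), y ^ 2 • Set.indicator (Set.Iic Λ) (fun y => c / (2 * y)) y =
      c * Λ ^ 2 / 4 := by
  have h1 : ∀ y ∈ Set.Ioi (0 : ℝ), y ^ 2 • Set.indicator (Set.Iic Λ) (fun y => c / (2 * y)) y =
      Set.indicator (Set.Iic Λ) (fun y => c / 2 * y) y := by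
    intro y hy
    have hy0 : y ≠ 0 := ne_of_gt hy
    by_cases hyΛ : y ∈ Set.Iic Λ
    · rw [Set.indicator_of_mem hyΛ, Set.indicator_of_mem hyΛ, smul_eq_mul]
      field_simp
    · rw [Set.indicator_of_notMem hyΛ, Set.indicator_of_notMem hyΛ, smul_zero]
  have h2 : IntegrableOn (fun y => c / 2 * y) (Set.Ioc 0 Λ) :=
    (Continuous.integrableOn_Icc (by fun_prop)).mono_set Set.Ioc_subset_Icc_self
  constructor
  · rw [integrableOn_congr_fun h1 measurableSet_Ioi, IntegrableOn,
      integrable_indicator_iff measurableSet_Iic, IntegrableOn,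
      Measure.restrict_restrict measurableSet_Iic, Set.inter_comm, Set.Ioi_inter_Iic]
    exact h2
  · rw [setIntegral_congr_fun measurableSet_Ioi h1, integral_indicator measurableSet_Iic,
      Measure.restrict_restrict measurableSet_Iic, Set.inter_comm, Set.Ioi_inter_Iic,
      ← intervalIntegral.integral_of_le hΛ, intervalIntegral.integral_const_mul, integral_id]
    ring

theorem integral_eta_sq (m : ℝ) {Λ : ℝ} (hΛ : 0 ≤ Λ) :
    Integrable (fun k : E3 => eta m Λ k ^ 2) ∧ ∫ k : E3, eta m Λ k ^ 2 ≤ Λ ^ 2 := by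
  set c : ℝ := (2 * Real.pi) ^ (-3 : ℝ)
  set g : ℝ → ℝ := Set.indicator (Set.Iic Λ) (fun y => c / (2 * y))
  obtain ⟨h1, h2⟩ := setIntegral_radial c Λ hΛ
  have hdim : Module.finrank ℝ E3 = 3 := by simp
  have hg : Integrable (fun k : E3 => g ‖k‖) := by
    rw [integrable_fun_norm_addHaar volume, hdim]
    exact h1
  have hne : ∀ᵐ k : E3, k ≠ 0 := by
    have : (volume : Measure E3) {0} = 0 := measure_singleton 0
    exact compl_mem_ae_iff.mpr this
  have hle : ∀ᵐ k : E3, eta m Λ k ^ 2 ≤ g ‖k‖ := hne.mono fun k hk => eta_sq_le hk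
  have hint : Integrable (fun k : E3 => eta m Λ k ^ 2) := by
    refine hg.mono' ((measurable_eta m Λ).pow_const 2).aestronglyMeasurable ?_
    filter_upwards [hle] with k hk
    rwa [Real.norm_of_nonneg (sq_nonneg _)]
  refine ⟨hint, (integral_mono_ae hint hg hle).trans ?_⟩
  rw [integral_fun_norm_addHaar volume g, hdim]
  have hvol : (volume : Measure E3).real (Metric.ball 0 1) = Real.pi * 4 / 3 := by
    rw [Measure.real, EuclideanSpace.volume_ball_fin_three]
    simp
    positivity
  have hc : c = 1 / (2 * Real.pi) ^ 3 := by
    simp only [c]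
    rw [Real.rpow_neg (by positivity), one_div]
    norm_num
  rw [show (3 - 1 : ℕ) = 2 from rfl, h2, hvol, hc]
  simp only [nsmul_eq_mul, smul_eq_mul]
  have hpi := Real.pi_gt_three
  -- In polar coordinates the massless integral is Λ²/(8π²), far below the bound Λ².
  have e1 : (3 : ℕ) * (Real.pi * 4 / 3 * (1 / (2 * Real.pi) ^ 3 * Λ ^ 2 / 4)) =
      Λ ^ 2 * (1 / (8 * Real.pi ^ 2)) := by
    push_cast
    field_simp
    ring
  rw [e1]
  refine mul_le_of_le_one_right (sq_nonneg _) ?_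
  rw [div_le_one (by positivity)]
  nlinarith

theorem integral_eta_mul_norm (m : ℝ) {Λ : ℝ} (hΛ : 0 ≤ Λ) (α : L2) :
    Integrable (fun k : E3 => eta m Λ k * ‖α k‖) ∧
      ∫ k : E3, eta m Λ k * ‖α k‖ ≤ Λ * ‖α‖ := by
  obtain ⟨h1, h2⟩ := integral_eta_sq m hΛ
  have m1 : MemLp (eta m Λ) 2 (volume : Measure E3) := by
    rw [memLp_two_iff_integrable_sq (measurable_eta m Λ).aestronglyMeasurable]
    exact h1
  have m2 : MemLp (fun k => ‖α k‖) 2 (volume : Measure E3) := (Lp.memLp α).norm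
  refine ⟨m1.integrable_mul m2, ?_⟩
  have hpq : Real.HolderConjugate 2 2 := Real.HolderConjugate.two_two
  have h3 := integral_mul_le_Lp_mul_Lq_of_nonneg hpq
    (Eventually.of_forall fun k => eta_nonneg m Λ k)
    (Eventually.of_forall fun k => norm_nonneg (α k)) (μ := volume)
    (by simpa using m1) (by simpa using m2)
  refine h3.trans ?_
  rw [← Real.sqrt_eq_rpow, ← Real.sqrt_eq_rpow]
  simp only [Real.rpow_ofNat]
  rw [← l2_norm_sq, Real.sqrt_sq (norm_nonneg _)]
  gcongr
  exact Real.sqrt_le_iff.mpr ⟨hΛ, h2⟩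

/-! ### The field as a bounded self-adjoint multiplication operator -/

theorem planeWave_neg (k x : E3) : planeWave (-k) x = conj (planeWave k x) := by
  rw [planeWave, planeWave, ← Complex.exp_conj]
  simp

theorem norm_planeWave (k x : E3) : ‖planeWave k x‖ = 1 := norm_phase _

/-- The integrand of the classical field. -/
def fieldIntegrand (m Λ : ℝ) (α : L2) (x k : E3) : ℂ :=
  (eta m Λ k : ℂ) * (planeWave k x * α k + planeWave (-k) x * conj (α k))

theorem norm_fieldIntegrand_le (m Λ : ℝ) (α : L2) (x k : E3) :
    ‖fieldIntegrand m Λ α x k‖ ≤ 2 * (eta m Λ k * ‖α k‖) := by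
  rw [fieldIntegrand, norm_mul, Complex.norm_real, Real.norm_of_nonneg (eta_nonneg m Λ k)]
  have h1 : ‖planeWave k x * α k + planeWave (-k) x * conj (α k)‖ ≤ ‖α k‖ + ‖α k‖ := by
    refine (norm_add_le _ _).trans ?_
    rw [norm_mul, norm_mul, norm_planeWave, norm_planeWave, RCLike.norm_conj, one_mul]
  nlinarith [mul_le_mul_of_nonneg_left h1 (eta_nonneg m Λ k)]

theorem aestronglyMeasurable_fieldIntegrand (m Λ : ℝ) (α : L2) :
    AEStronglyMeasurable (fun z : E3 × E3 => fieldIntegrand m Λ α z.1 z.2)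
      ((volume : Measure E3).prod volume) := by
  unfold fieldIntegrand
  have h1 : AEStronglyMeasurable (fun z : E3 × E3 => (eta m Λ z.2 : ℂ))
      ((volume : Measure E3).prod volume) :=
    (Complex.measurable_ofReal.comp ((measurable_eta m Λ).comp measurable_snd)).aestronglyMeasurable
  have h2 : AEStronglyMeasurable (fun z : E3 × E3 => α z.2)
      ((volume : Measure E3).prod volume) := (Lp.aestronglyMeasurable α).comp_snd
  have h3 : AEStronglyMeasurable (fun z : E3 × E3 => planeWave z.2 z.1)
      ((volume : Measure E3).prod volume) := by
    apply Continuous.aestronglyMeasurable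
    unfold planeWave
    fun_prop
  have h4 : AEStronglyMeasurable (fun z : E3 × E3 => planeWave (-z.2) z.1)
      ((volume : Measure E3).prod volume) := by
    apply Continuous.aestronglyMeasurable
    unfold planeWave
    fun_prop
  exact h1.mul ((h3.mul h2).add (h4.mul (Complex.continuous_conj.comp_aestronglyMeasurable h2)))

theorem norm_classicalField_le (m : ℝ) {Λ : ℝ} (hΛ : 0 ≤ Λ) (α : L2) (x : E3) :
    ‖classicalField m Λ α x‖ ≤ 2 * (Λ * ‖α‖) := by
  obtain ⟨h1, h2⟩ := integral_eta_mul_norm m hΛ α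
  calc ‖classicalField m Λ α x‖ ≤ ∫ k : E3, 2 * (eta m Λ k * ‖α k‖) :=
        norm_integral_le_of_norm_le (h1.const_mul 2)
          (Eventually.of_forall fun k => norm_fieldIntegrand_le m Λ α x k)
    _ ≤ _ := by
        rw [integral_const_mul]
        gcongr

theorem memLp_classicalField (m : ℝ) {Λ : ℝ} (hΛ : 0 ≤ Λ) (α : L2) :
    MemLp (classicalField m Λ α) ∞ (volume : Measure E3) :=
  memLp_top_of_bound (aestronglyMeasurable_fieldIntegrand m Λ α).integral_prod_right' _
    (Eventually.of_forall fun x => norm_classicalField_le m hΛ α x)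

theorem conj_classicalField (m Λ : ℝ) (α : L2) (x : E3) :
    conj (classicalField m Λ α x) = classicalField m Λ α x := by
  rw [classicalField, ← integral_conj]
  refine integral_congr_ae (Eventually.of_forall fun k => ?_)
  simp only [map_mul, map_add, Complex.conj_ofReal, Complex.conj_conj, planeWave_neg]
  ring

/-- Multiplication by the classical field. -/
def fieldOp (m : ℝ) {Λ : ℝ} (hΛ : 0 ≤ Λ) (α : L2) : L2 →L[ℂ] L2 :=
  mulOp _ (memLp_classicalField m hΛ α)

theorem inner_fieldOp_comm (m : ℝ) {Λ : ℝ} (hΛ : 0 ≤ Λ) (α u v : L2) :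
    ⟪fieldOp m hΛ α u, v⟫_ℂ = ⟪u, fieldOp m hΛ α v⟫_ℂ := by
  rw [L2.inner_def, L2.inner_def]
  refine integral_congr_ae ?_
  filter_upwards [mulOp_ae (memLp_classicalField m hΛ α) u,
    mulOp_ae (memLp_classicalField m hΛ α) v] with x h1 h2
  simp only [fieldOp]
  rw [h1, h2, RCLike.inner_apply, RCLike.inner_apply, map_mul, conj_classicalField]
  ring

/-- The matrix elements of the field as a superposition of those of plane waves. -/
def fieldForm (m Λ : ℝ) (α u v : L2) (k : E3) : ℂ :=
  (eta m Λ k : ℂ) * (α k * ⟪u, expMul k v⟫_ℂ + conj (α k) * ⟪u, expMul (-k) v⟫_ℂ)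

/-- Fubini, with the majorant 2|u v| · η|α|. The superposition is needed only for scalar matrix
elements, so no operator-valued integral occurs. -/
theorem inner_fieldOp (m : ℝ) {Λ : ℝ} (hΛ : 0 ≤ Λ) (α u v : L2) :
    Integrable (fieldForm m Λ α u v) ∧
      ⟪u, fieldOp m hΛ α v⟫_ℂ = ∫ k : E3, fieldForm m Λ α u v k := by
  set G : E3 → E3 → ℂ := fun x k => ⟪u x, v x⟫_ℂ * fieldIntegrand m Λ α x k
  have huv : Integrable (fun x : E3 => ⟪u x, v x⟫_ℂ) := L2.integrable_inner u v
  have hG : Integrable (Function.uncurry G) ((volume : Measure E3).prod volume) := by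
    have h1 := huv.norm.mul_prod ((integral_eta_mul_norm m hΛ α).1.const_mul 2)
    refine h1.mono' (huv.aestronglyMeasurable.comp_fst.mul
      (aestronglyMeasurable_fieldIntegrand m Λ α)) (Eventually.of_forall fun z => ?_)
    rw [Function.uncurry, norm_mul]
    gcongr
    exact norm_fieldIntegrand_le m Λ α z.1 z.2
  have hin : ∀ k, ∫ x : E3, G x k = fieldForm m Λ α u v k := by
    intro k
    have i1 : Integrable (fun x : E3 => ⟪u x, expMul k v x⟫_ℂ) := L2.integrable_inner u _
    have i2 : Integrable (fun x : E3 => ⟪u x, expMul (-k) v x⟫_ℂ) := L2.integrable_inner u _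
    rw [fieldForm, L2.inner_def, L2.inner_def, ← integral_const_mul, ← integral_const_mul,
      ← integral_add (i1.const_mul _) (i2.const_mul _), ← integral_const_mul]
    refine integral_congr_ae ?_
    filter_upwards [expMul_ae k v, expMul_ae (-k) v] with x h1 h2
    simp only [G, fieldIntegrand, h1, h2, RCLike.inner_apply]
    ring
  constructor
  · refine hG.integral_prod_right.congr (Eventually.of_forall fun k => ?_)
    exact hin k
  · rw [L2.inner_def]
    calc ∫ x : E3, ⟪u x, fieldOp m hΛ α v x⟫_ℂ = ∫ x : E3, ∫ k : E3, G x k := by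
          refine integral_congr_ae ?_
          filter_upwards [mulOp_ae (memLp_classicalField m hΛ α) v] with x h1
          simp only [fieldOp]
          rw [h1, integral_const_mul, RCLike.inner_apply, RCLike.inner_apply]
          change _ = _ * classicalField m Λ α x
          ring
      _ = ∫ k : E3, ∫ x : E3, G x k := integral_integral_swap hG
      _ = _ := integral_congr_ae (Eventually.of_forall hin)

variable {N : ℕ} {ψ : Fin N → L2}

theorem tracePair_offDiag_comm {n : ℕ} (X Y : EuclideanSpace ℂ (Fin n) →L[ℂ] L2)
    (A B : L2 →L[ℂ] L2) : tracePair X Y (offDiag ψ (A ∘L B - B ∘L A)) =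
      ∑ i, (⟪spanProj ψ (X (EuclideanSpace.single i 1)),
        A (B ((1 - spanProj ψ) (Y (EuclideanSpace.single i 1))))⟫_ℂ -
      ⟪ContinuousLinearMap.adjoint B (spanProj ψ (X (EuclideanSpace.single i 1))),
        A ((1 - spanProj ψ) (Y (EuclideanSpace.single i 1)))⟫_ℂ) := by
  refine Finset.sum_congr rfl fun i _ => ?_
  rw [ContinuousLinearMap.adjoint_inner_left, ← inner_sub_right, spanProj_inner]
  rfl

/-- A commutator with the field is controlled by the commutators with plane waves. -/
theorem offNorm_comm_fieldOp_le (hψ : Orthonormal ℂ ψ) (m : ℝ) {Λ : ℝ} (hΛ : 0 ≤ Λ) (α : L2)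
    (B : L2 →L[ℂ] L2) {κ : ℝ} (hκ : ∀ k : E3, ‖k‖ ≤ Λ →
      offNorm ψ (expMul k ∘L B - B ∘L expMul k) ≤ κ) :
    offNorm ψ (fieldOp m hΛ α ∘L B - B ∘L fieldOp m hΛ α) ≤ 2 * κ * (Λ * ‖α‖) := by
  have hκ0 : 0 ≤ κ := (offNorm_nonneg _ _).trans (hκ 0 (by simpa using hΛ))
  have hnn : 0 ≤ 2 * κ * (Λ * ‖α‖) := by positivity
  refine TraceLE.toReal_le ⟨hnn, ?_⟩
  rw [traceNorm_le_iff]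
  intro n X Y hX hY
  set D : E3 → ℂ := fun k => tracePair X Y (offDiag ψ (expMul k ∘L B - B ∘L expMul k))
  have hD : ∀ k : E3, ‖k‖ ≤ Λ → ‖D k‖ ≤ κ := fun k hk => by
    have h1 := (enorm_tracePair_le_traceNorm _ X Y hX hY).trans
      ((traceLE_offDiag hψ (expMul k ∘L B - B ∘L expMul k)).2.trans
        (ENNReal.ofReal_le_ofReal (hκ k hk)))
    rwa [← ofReal_norm, ENNReal.ofReal_le_ofReal_iff hκ0] at h1
  have hint : tracePair X Y (offDiag ψ (fieldOp m hΛ α ∘L B - B ∘L fieldOp m hΛ α)) =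
      ∫ k : E3, (eta m Λ k : ℂ) * (α k * D k + conj (α k) * D (-k)) := by
    rw [tracePair_offDiag_comm]
    simp_rw [(inner_fieldOp m hΛ α _ _).2]
    simp_rw [← integral_sub (inner_fieldOp m hΛ α _ _).1 (inner_fieldOp m hΛ α _ _).1]
    refine (integral_finsetSum _ fun i _ =>
      (inner_fieldOp m hΛ α _ _).1.sub (inner_fieldOp m hΛ α _ _).1).symm.trans ?_
    refine integral_congr_ae (Eventually.of_forall fun k => ?_)
    simp only [D, tracePair_offDiag_comm, Pi.sub_apply, fieldForm, Finset.mul_sum, ← Finset.sum_add_distrib]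
    refine Finset.sum_congr rfl fun i _ => ?_
    ring
  obtain ⟨h1, h2⟩ := integral_eta_mul_norm m hΛ α
  rw [hint, ← ofReal_norm]
  refine ENNReal.ofReal_le_ofReal ?_
  calc _ ≤ ∫ k : E3, 2 * κ * (eta m Λ k * ‖α k‖) := by
        refine norm_integral_le_of_norm_le (h1.const_mul _) (Eventually.of_forall fun k => ?_)
        -- Above the cutoff η vanishes, which is why commutators with |k| ≤ Λ are sufficient.
        rcases le_or_gt ‖k‖ Λ with hk | hk
        · rw [norm_mul, Complex.norm_real, Real.norm_of_nonneg (eta_nonneg m Λ k)]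
          have h3 : ‖α k * D k + conj (α k) * D (-k)‖ ≤ ‖α k‖ * κ + ‖α k‖ * κ := by
            refine (norm_add_le _ _).trans ?_
            rw [norm_mul, norm_mul, RCLike.norm_conj]
            gcongr
            exacts [hD k hk, hD (-k) (by simpa using hk)]
          nlinarith [mul_le_mul_of_nonneg_left h3 (eta_nonneg m Λ k)]
        · rw [eta_eq_zero hk]
          simp
    _ ≤ _ := by
        rw [integral_const_mul]
        gcongr

end Field

/-! ### Solutions in the interaction picture -/

section Dynamics

open Filter Topology

variable {N : ℕ} {δ m Λ : ℝ} {I : Set ℝ} {φ : Fin N → ℝ → L2} {α : ℝ → L2}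

theorem inner_freeProp_freeProp (c : ℝ) (f g : L2) :
    ⟪freeProp c f, freeProp c g⟫_ℂ = ⟪f, g⟫_ℂ := by
  rw [inner_freeProp, freeProp_freeProp, neg_add_cancel, freeProp_zero]

theorem orthonormal_freeProp {χ : Fin N → L2} (hχ : Orthonormal ℂ χ) (c : ℝ) :
    Orthonormal ℂ (fun j => freeProp c (χ j)) := by
  rw [orthonormal_iff_ite] at hχ ⊢
  intro i j
  rw [inner_freeProp_freeProp, hχ]

theorem offNorm_freeProp_le {χ : Fin N → L2} (hχ : Orthonormal ℂ χ) (c : ℝ) (B : L2 →L[ℂ] L2) :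
    offNorm (fun j => freeProp c (χ j)) B ≤ offNorm χ (freeProp (-c) ∘L B ∘L freeProp c) := by
  refine offNorm_map_le hχ (norm_freeProp_le c) (norm_freeProp_le (-c)) ?_ (inner_freeProp c) B
  ext1 f
  rw [ContinuousLinearMap.comp_apply, freeProp_freeProp, add_neg_cancel, freeProp_zero]
  rfl

/-- After subtraction of the free part iεΔφ only the bounded field term remains. -/
theorem schrodinger_deriv_eq {ε : ℝ} (hε : ε ≠ 0) (hΛ : 0 ≤ Λ) {α φ dφ wφ : L2}
    (h : ∀ᵐ x : E3, Complex.I * (ε : ℂ) * dφ x =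
      -((ε ^ 2 : ℝ) : ℂ) * wφ x + classicalField m Λ α x * φ x) :
    dφ - (ε : ℂ) • Complex.I • wφ = (-Complex.I) • ((ε⁻¹ : ℝ) : ℂ) • fieldOp m hΛ α φ := by
  have hε' : (ε : ℂ) ≠ 0 := Complex.ofReal_ne_zero.mpr hε
  refine Lp.ext ?_
  filter_upwards [h, Lp.coeFn_sub dφ ((ε : ℂ) • Complex.I • wφ),
    Lp.coeFn_smul (ε : ℂ) (Complex.I • wφ), Lp.coeFn_smul Complex.I wφ,
    Lp.coeFn_smul (-Complex.I) (((ε⁻¹ : ℝ) : ℂ) • fieldOp m hΛ α φ),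
    Lp.coeFn_smul ((ε⁻¹ : ℝ) : ℂ) (fieldOp m hΛ α φ),
    mulOp_ae (memLp_classicalField m hΛ α) φ] with x h0 h1 h2 h3 h4 h5 h6
  rw [h1, Pi.sub_apply, h2, Pi.smul_apply, h3, Pi.smul_apply, h4, Pi.smul_apply, h5, Pi.smul_apply]
  simp only [fieldOp]
  rw [h6]
  simp only [smul_eq_mul]
  push_cast at h0 ⊢
  have h7 : classicalField m Λ α x * φ x = Complex.I * ε * dφ x + ε ^ 2 * wφ x := by
    rw [h0]; ring
  rw [h7]
  field_simp
  linear_combination (dφ x) * Complex.I_sq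

/-- The generator in the interaction picture. -/
def interactionGen (m : ℝ) (hΛ : 0 ≤ Λ) (σ ε : ℝ) (α : ℝ → L2) (s : ℝ) : L2 →L[ℂ] L2 :=
  ((σ * ε⁻¹ : ℝ) : ℂ) •
    (freeProp (-(σ * ε * s)) ∘L fieldOp m hΛ (α (σ * s)) ∘L freeProp (σ * ε * s))

theorem inner_interactionGen (hΛ : 0 ≤ Λ) (σ ε s : ℝ) (f g : L2) :
    ⟪interactionGen m hΛ σ ε α s f, g⟫_ℂ = ⟪f, interactionGen m hΛ σ ε α s g⟫_ℂ := by
  simp only [interactionGen, _root_.smul_apply, ContinuousLinearMap.comp_apply,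
    inner_smul_left, inner_smul_right, Complex.conj_ofReal]
  rw [inner_freeProp, inner_fieldOp_comm, inner_freeProp, neg_neg]

theorem rpow_neg_two_thirds (N : ℕ) :
    (N : ℝ) ^ (-(2 / 3) : ℝ) = ((N : ℝ) ^ (-(1 / 3) : ℝ)) ^ 2 := by
  rw [← Real.rpow_natCast, ← Real.rpow_mul (Nat.cast_nonneg N)]
  norm_num

theorem hasDerivWithinAt_interactionPicture (hsol : IsSolution N δ m Λ I φ α) (hN : 0 < N)
    (hΛ : 0 ≤ Λ) {σ ε T : ℝ} (hε : ε = (N : ℝ) ^ (-(1 / 3) : ℝ))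
    (hI : ∀ s ∈ Set.Icc 0 T, σ * s ∈ I) (j : Fin N) {s : ℝ} (hs : s ∈ Set.Icc 0 T) :
    HasDerivWithinAt (fun z => freeProp (-(σ * ε * z)) (φ j (σ * z)))
      ((-Complex.I) • interactionGen m hΛ σ ε α s (freeProp (-(σ * ε * s)) (φ j (σ * s))))
      (Set.Icc 0 T) s := by
  have hN' : (0 : ℝ) < N := Nat.cast_pos.mpr hN
  have hε0 : ε ≠ 0 := by rw [hε]; positivity
  obtain ⟨dφ, hd, heq⟩ := hsol.schrodinger j (σ * s) (hI s hs)
  rw [rpow_neg_two_thirds, ← hε] at heq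
  have hlin : HasDerivWithinAt (fun z : ℝ => σ * z) σ (Set.Icc 0 T) s := by
    simpa using ((hasDerivAt_id s).const_mul σ).hasDerivWithinAt
  have h1 : HasDerivWithinAt (fun z => φ j (σ * z)) (σ • dφ) (Set.Icc 0 T) s :=
    HasDerivWithinAt.scomp s hd hlin hI
  have h2 := hasDerivWithinAt_interaction (σ * ε) h1 (hsol.memH2 j _ (hI s hs))
  convert h2 using 1
  have h3 := schrodinger_deriv_eq (m := m) hε0 hΛ heq
  have h4 : σ • dφ - ((σ * ε : ℝ) : ℂ) • Complex.I • weakLaplacian (φ j (σ * s)) =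
      (σ : ℂ) • (dφ - (ε : ℂ) • Complex.I • weakLaplacian (φ j (σ * s))) := by
    rw [smul_sub, Complex.ofReal_mul, mul_smul, ← algebraMap_smul ℂ σ dφ, Complex.coe_algebraMap]
  rw [h4, h3]
  simp only [interactionGen, _root_.smul_apply, ContinuousLinearMap.comp_apply,
    freeProp_freeProp, add_neg_cancel, freeProp_zero, map_smul, smul_smul]
  congr 1
  push_cast
  ring

theorem orthonormal_solution (hsol : IsSolution N δ m Λ I φ α) (hN : 0 < N)
    (hΛ : 0 ≤ Λ) {σ T : ℝ} (hI : ∀ s ∈ Set.Icc 0 T, σ * s ∈ I)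
    (h0 : Orthonormal ℂ (fun j => φ j 0)) {s : ℝ} (hs : s ∈ Set.Icc 0 T) :
    Orthonormal ℂ (fun j => φ j (σ * s)) := by
  set ε := (N : ℝ) ^ (-(1 / 3) : ℝ) with hε
  have h1 := orthonormal_of_evolution (ψ := fun j z => freeProp (-(σ * ε * z)) (φ j (σ * z)))
    (M := interactionGen m hΛ σ ε α) (T := T)
    (fun s _ => inner_interactionGen hΛ σ ε s)
    (fun j s hs => hasDerivWithinAt_interactionPicture hsol hN hΛ hε hI j hs)
    (by simpa [freeProp_zero] using h0) hs
  have h2 := orthonormal_freeProp h1 (σ * ε * s)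
  simpa only [freeProp_freeProp, add_neg_cancel, freeProp_zero] using h2

/-- Growth of `‖p B q‖` along a solution, with `B` transported by the free evolution. -/
theorem offNorm_solution_le (hsol : IsSolution N δ m Λ I φ α) (hN : 0 < N)
    (hΛ : 0 ≤ Λ) {σ ε T : ℝ} (hσ : |σ| = 1) (hε : ε = (N : ℝ) ^ (-(1 / 3) : ℝ))
    (hI : ∀ s ∈ Set.Icc 0 T, σ * s ∈ I)
    (h0 : Orthonormal ℂ (fun j => φ j 0)) {s₁ s₂ : ℝ} (h01 : 0 ≤ s₁) (h12 : s₁ ≤ s₂) (h2T : s₂ ≤ T)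
    (B : L2 →L[ℂ] L2) (C : ℝ → L2 →L[ℂ] L2)
    (hC : ∀ s, C s = freeProp (-(σ * ε * (s₂ - s))) ∘L B ∘L freeProp (σ * ε * (s₂ - s)))
    {r : ℝ} (hr : ∀ s ∈ Set.Icc s₁ s₂, offNorm (fun j => φ j (σ * s))
      (fieldOp m hΛ (α (σ * s)) ∘L C s - C s ∘L fieldOp m hΛ (α (σ * s))) ≤ r) :
    offNorm (fun j => φ j (σ * s₂)) B ≤
      offNorm (fun j => φ j (σ * s₁)) (C s₁) + ε⁻¹ * r * (s₂ - s₁) := by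
  have hN' : (0 : ℝ) < N := Nat.cast_pos.mpr hN
  have hε0 : 0 < ε := by rw [hε]; positivity
  have hon : ∀ s ∈ Set.Icc 0 T, Orthonormal ℂ (fun j => φ j (σ * s)) :=
    fun s hs => orthonormal_solution hsol hN hΛ hI h0 hs
  set ψ : Fin N → ℝ → L2 := fun j z => freeProp (-(σ * ε * z)) (φ j (σ * z))
  have hψ : ∀ s ∈ Set.Icc 0 T, Orthonormal ℂ (fun j => ψ j s) :=
    fun s hs => orthonormal_freeProp (hon s hs) _
  -- B' is B in the interaction picture of time s₂, hence constant in s. Undoing the picture at time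
  -- s gives `C s`, which carries the free evolution over the remaining time s₂ - s.
  set B' := freeProp (-(σ * ε * s₂)) ∘L B ∘L freeProp (σ * ε * s₂)
  have hCB : ∀ s, freeProp (σ * ε * s) ∘L B' ∘L freeProp (-(σ * ε * s)) = C s := fun s => by
    rw [hC]
    ext1 f
    simp only [B', ContinuousLinearMap.comp_apply, freeProp_freeProp]
    congr 3
    · ring
    · congr 2
      ring
  have hmem : ∀ s ∈ Set.Icc s₁ s₂, s ∈ Set.Icc 0 T := fun s hs =>
    ⟨h01.trans hs.1, hs.2.trans h2T⟩
  have hψφ : ∀ s ∈ Set.Icc 0 T, ∀ D, offNorm (fun j => ψ j s) D ≤ offNorm (fun j => φ j (σ * s))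
      (freeProp (σ * ε * s) ∘L D ∘L freeProp (-(σ * ε * s))) := fun s hs D => by
    have := offNorm_freeProp_le (hon s hs) (-(σ * ε * s)) D
    rwa [neg_neg] at this
  have hr' : ∀ s ∈ Set.Icc s₁ s₂, offNorm (fun j => ψ j s)
      (interactionGen m hΛ σ ε α s ∘L B' - B' ∘L interactionGen m hΛ σ ε α s) ≤ ε⁻¹ * r := by
    intro s hs
    refine (hψφ s (hmem s hs) _).trans ?_
    have h1 : freeProp (σ * ε * s) ∘L (interactionGen m hΛ σ ε α s ∘L B' -
        B' ∘L interactionGen m hΛ σ ε α s) ∘L freeProp (-(σ * ε * s)) =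
        ((σ * ε⁻¹ : ℝ) : ℂ) • (fieldOp m hΛ (α (σ * s)) ∘L C s -
          C s ∘L fieldOp m hΛ (α (σ * s))) := by
      rw [← hCB]
      ext1 f
      simp only [interactionGen, ContinuousLinearMap.comp_apply, _root_.sub_apply,
        _root_.smul_apply, map_sub, map_smul, freeProp_freeProp, add_neg_cancel,
        freeProp_zero, smul_sub]
    rw [h1]
    refine (offNorm_smul_le (hon s (hmem s hs)) _ _).trans ?_
    rw [Complex.norm_real, Real.norm_eq_abs, abs_mul, hσ, one_mul, abs_of_pos (inv_pos.mpr hε0)]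
    exact mul_le_mul_of_nonneg_left (hr s hs) (inv_pos.mpr hε0).le
  have key := offNorm_le_of_evolution (ψ := ψ) (M := interactionGen m hΛ σ ε α) (T := T)
    (fun s _ => inner_interactionGen hΛ σ ε s)
    (fun j s hs => hasDerivWithinAt_interactionPicture hsol hN hΛ hε hI j hs) hψ h01 h12 h2T B' hr'
  have e1 : offNorm (fun j => φ j (σ * s₂)) B ≤ offNorm (fun j => ψ j s₂) B' := by
    have := offNorm_freeProp_le (hψ s₂ ⟨h01.trans h12, h2T⟩) (σ * ε * s₂) B
    simpa only [ψ, freeProp_freeProp, add_neg_cancel, freeProp_zero] using this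
  have e2 := hψφ s₁ ⟨h01, h12.trans h2T⟩ B'
  rw [hCB] at e2
  linarith

/-! ### Growth of the radiation field -/

theorem norm_fourier3_density_le {χ : Fin N → L2} (hχ : ∀ j, ‖χ j‖ = 1) (k : E3) :
    ‖fourier3 (density χ) k‖ ≤ (2 * Real.pi) ^ (-(3 / 2) : ℝ) * N := by
  rw [fourier3, norm_mul, Complex.norm_real, Real.norm_of_nonneg (by positivity)]
  gcongr
  have h1 : ∫ x : E3, ∑ j, ‖χ j x‖ ^ 2 = N := by
    rw [integral_finsetSum _ fun j _ => integrable_norm_sq (χ j)]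
    simp [← l2_norm_sq, hχ]
  rw [← h1]
  refine norm_integral_le_of_norm_le (integrable_finsetSum _ fun j _ => integrable_norm_sq (χ j))
    (Eventually.of_forall fun x => ?_)
  rw [norm_mul, norm_planeWave, one_mul, density, ← Complex.ofReal_sum, Complex.norm_real,
    Real.norm_of_nonneg (Finset.sum_nonneg fun j _ => by positivity)]

/-- The real symbol ν contributes only to the imaginary part. In the source, |F[ρ]| ≤ (2π)^(-3/2) N
cancels the prefactor N⁻¹(2π)^(3/2), leaving ∫ η|α| ≤ Λ‖α‖. -/
theorem abs_re_inner_deriv_le {χ : Fin N → L2} (hN : 0 < N) (hΛ : 0 ≤ Λ) (hχ : ∀ j, ‖χ j‖ = 1)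
    {α dα : L2} {ν : E3 → ℝ} (h : ∀ᵐ k : E3, Complex.I * dα k = (ν k : ℂ) * α k +
      (((N : ℝ)⁻¹ * (2 * Real.pi) ^ (3 / 2 : ℝ) * eta m Λ k : ℝ) : ℂ) *
          fourier3 (density χ) k) :
    |RCLike.re ⟪α, dα⟫_ℂ| ≤ Λ * ‖α‖ := by
  have hN' : (0 : ℝ) < N := Nat.cast_pos.mpr hN
  obtain ⟨h1, h2⟩ := integral_eta_mul_norm m hΛ α
  have hint : Integrable (fun k : E3 => ⟪α k, dα k⟫_ℂ) := L2.integrable_inner α dα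
  rw [L2.inner_def, ← integral_re hint, ← Real.norm_eq_abs]
  refine (norm_integral_le_of_norm_le h1 ?_).trans h2
  filter_upwards [h] with k hk
  set b : ℝ := (N : ℝ)⁻¹ * (2 * Real.pi) ^ (3 / 2 : ℝ) * eta m Λ k
  have hb : 0 ≤ b := by have := eta_nonneg m Λ k; positivity
  have hd : dα k = -Complex.I * ((ν k : ℂ) * α k + (b : ℂ) * fourier3 (density χ) k) := by
    rw [← hk]
    linear_combination (dα k) * Complex.I_sq
  have e1 : RCLike.re ⟪α k, dα k⟫_ℂ =
      (-Complex.I * ((b : ℂ) * fourier3 (density χ) k) * conj (α k)).re := by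
    rw [RCLike.inner_apply, hd]
    have : -Complex.I * ((ν k : ℂ) * α k + (b : ℂ) * fourier3 (density χ) k) * conj (α k) =
        -Complex.I * ((b : ℂ) * fourier3 (density χ) k) * conj (α k) +
          -Complex.I * ((ν k * Complex.normSq (α k) : ℝ) : ℂ) := by
      have hns : ((Complex.normSq (α k) : ℝ) : ℂ) = conj (α k) * α k :=
        Complex.normSq_eq_conj_mul_self
      rw [Complex.ofReal_mul (ν k), hns]
      ring
    rw [this]
    simp
  rw [e1, Real.norm_eq_abs]
  refine (Complex.abs_re_le_norm _).trans ?_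
  rw [norm_mul, norm_mul, norm_mul, norm_neg, Complex.norm_I, one_mul, RCLike.norm_conj,
    Complex.norm_real, Real.norm_of_nonneg hb]
  gcongr
  calc b * ‖fourier3 (density χ) k‖ ≤ b * ((2 * Real.pi) ^ (-(3 / 2) : ℝ) * N) := by
        gcongr
        exact norm_fourier3_density_le hχ k
    _ = eta m Λ k := by
        have hp : (0 : ℝ) < 2 * Real.pi := by positivity
        simp only [b]
        rw [Real.rpow_neg hp.le]
        have := (Real.rpow_pos_of_pos hp (3 / 2)).ne'
        field_simp

theorem norm_field_le (hsol : IsSolution N δ m Λ I φ α) (hN : 0 < N)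
    (hΛ : 0 ≤ Λ) {σ T : ℝ} (hσ : |σ| = 1) (hI : ∀ s ∈ Set.Icc 0 T, σ * s ∈ I)
    (h0 : Orthonormal ℂ (fun j => φ j 0)) {s : ℝ} (hs : s ∈ Set.Icc 0 T) :
    ‖α (σ * s)‖ ≤ 1 + ‖α 0‖ + Λ * s := by
  -- The regularised norm is differentiable also where α vanishes, and its derivative is still at
  -- most Λ; the price is the additive 1.
  set f : ℝ → ℝ := fun z => √(1 + ‖α (σ * z)‖ ^ 2)
  have hd : ∀ z ∈ Set.Icc 0 T, ∃ f' ≤ Λ, HasDerivWithinAt f f' (Set.Icc 0 T) z := by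
    intro z hz
    obtain ⟨dα, hdα, heq⟩ := hsol.kleinGordon (σ * z) (hI z hz)
    have hre := abs_re_inner_deriv_le (m := m) hN hΛ
      (fun j => (orthonormal_solution hsol hN hΛ hI h0 hz).1 j) heq
    have hlin : HasDerivWithinAt (fun z : ℝ => σ * z) σ (Set.Icc 0 T) z := by
      simpa using ((hasDerivAt_id z).const_mul σ).hasDerivWithinAt
    have h1 : HasDerivWithinAt (fun z => α (σ * z)) (σ • dα) (Set.Icc 0 T) z :=
      HasDerivWithinAt.scomp z hdα hlin hI
    have h2 : HasDerivWithinAt (fun z => ‖α (σ * z)‖ ^ 2)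
        (2 * (σ * RCLike.re ⟪α (σ * z), dα⟫_ℂ)) (Set.Icc 0 T) z := by
      have h3 := (Complex.reCLM.hasFDerivAt (x := ⟪α (σ * z), α (σ * z)⟫_ℂ)).comp_hasDerivWithinAt z
        (h1.inner ℂ h1)
      have h4 : ∀ w, ‖α (σ * w)‖ ^ 2 = Complex.reCLM ⟪α (σ * w), α (σ * w)⟫_ℂ := fun w =>
        (@inner_self_eq_norm_sq ℂ _ _ _ _ (α (σ * w))).symm
      simp_rw [h4]
      have h5 : Complex.reCLM (⟪α (σ * z), σ • dα⟫_ℂ + ⟪σ • dα, α (σ * z)⟫_ℂ) =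
          2 * (σ * RCLike.re ⟪α (σ * z), dα⟫_ℂ) := by
        rw [← algebraMap_smul ℂ σ dα, Complex.coe_algebraMap, inner_smul_right, inner_smul_left,
          ← inner_conj_symm dα (α (σ * z)), Complex.conj_ofReal]
        simp only [Complex.reCLM_apply, Complex.add_re, Complex.re_ofReal_mul, Complex.conj_re]
        change _ = 2 * (σ * (⟪α (σ * z), dα⟫_ℂ).re)
        ring
      rw [h5] at h3
      exact h3
    have hpos : 0 < 1 + ‖α (σ * z)‖ ^ 2 := by positivity
    refine ⟨_, ?_, (h2.const_add 1).sqrt hpos.ne'⟩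
    have hsq : 0 < √(1 + ‖α (σ * z)‖ ^ 2) := Real.sqrt_pos.mpr hpos
    rw [div_le_iff₀ (by positivity)]
    have h3 : ‖α (σ * z)‖ ≤ √(1 + ‖α (σ * z)‖ ^ 2) := Real.le_sqrt_of_sq_le (by linarith)
    have h4 : σ * RCLike.re ⟪α (σ * z), dα⟫_ℂ ≤ Λ * ‖α (σ * z)‖ := by
      refine (le_abs_self _).trans ?_
      rwa [abs_mul, hσ, one_mul]
    nlinarith [mul_le_mul_of_nonneg_left h3 hΛ]
  choose! f' hf' hff' using hd
  have key := image_le_of_deriv_right_le_deriv_boundary (f := f) (f' := f') (a := 0) (b := T)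
    (B := fun z => f 0 + Λ * z) (B' := fun _ => Λ)
    (fun z hz => (hff' z hz).continuousWithinAt)
    (fun z hz => (hff' z ⟨hz.1, hz.2.le⟩).mono_of_mem_nhdsWithin (Icc_mem_nhdsGE_of_mem hz))
    (by simp) (by fun_prop)
    (fun z _ => by simpa using (((hasDerivAt_id z).const_mul Λ).const_add (f 0)).hasDerivWithinAt)
    (fun z hz => hf' z ⟨hz.1, hz.2.le⟩) hs
  have h1 : ‖α (σ * s)‖ ≤ f s := Real.le_sqrt_of_sq_le (by linarith)
  have h2 : f 0 ≤ 1 + ‖α 0‖ := by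
    simp only [f, mul_zero]
    rw [Real.sqrt_le_left (by positivity)]
    nlinarith [norm_nonneg (α 0)]
  linarith

end Dynamics

/-! ### Translations and the gradient -/

section Gradient

open Filter Topology

variable {N : ℕ} {ψ : Fin N → L2}

theorem TraceLE.of_tendsto {H K ι : Type*} [NormedAddCommGroup H] [InnerProductSpace ℂ H]
    [CompleteSpace H] [NormedAddCommGroup K] [InnerProductSpace ℂ K] [CompleteSpace K]
    {A : H →L[ℂ] K} {l : Filter ι} [l.NeBot] {u : ι → ℝ} {c : ℝ}
    (h : ∀ᶠ i in l, TraceLE A (u i)) (hu : Tendsto u l (𝓝 c)) : TraceLE A c :=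
  ⟨ge_of_tendsto hu (h.mono fun _ hi => hi.1),
    ge_of_tendsto ((ENNReal.continuous_ofReal.tendsto c).comp hu) (h.mono fun _ hi => hi.2)⟩

theorem inner_transl (a : E3) (f g : L2) : ⟪transl a f, g⟫_ℂ = ⟪f, transl (-a) g⟫_ℂ := by
  have h : gradSymbol (-a) = -gradSymbol a := by
    ext ξ
    simp [gradSymbol, inner_neg_left]
  rw [transl, transl, h, inner_multiplier]

theorem offNorm_transl_add_le (hψ : Orthonormal ℂ ψ) (a b : E3) :
    offNorm ψ (transl (a + b)) ≤ offNorm ψ (transl a) + offNorm ψ (transl b) := by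
  rw [transl_add]
  exact offNorm_comp_le hψ (norm_transl_le a) (norm_transl_le b)

theorem offNorm_transl_nsmul_le (hψ : Orthonormal ℂ ψ) (a : E3) (n : ℕ) :
    offNorm ψ (transl (((n + 1 : ℕ) : ℝ) • a)) ≤ ((n + 1 : ℕ) : ℝ) * offNorm ψ (transl a) := by
  induction n with
  | zero => simp
  | succ n ih =>
    rw [Nat.cast_succ (n + 1), add_smul, one_smul, add_mul, one_mul]
    exact (offNorm_transl_add_le hψ _ _).trans (by gcongr)

/-- By subadditivity it suffices to control `‖p T q‖` for infinitesimal translations `T`. -/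
theorem offNorm_transl_le_of_tendsto (hψ : Orthonormal ℂ ψ) {a : E3} {u : ℝ → ℝ} {c : ℝ}
    (hu : Tendsto u (𝓝[≠] 0) (𝓝 c))
    (h : ∀ s : ℝ, 0 < s → offNorm ψ (transl (s • a)) ≤ s * u s) : offNorm ψ (transl a) ≤ c := by
  have h1 : Tendsto (fun n : ℕ => ((n + 1 : ℕ) : ℝ)⁻¹) atTop (𝓝[≠] 0) := by
    refine tendsto_nhdsWithin_of_tendsto_nhds_of_eventually_within _ ?_
      (Eventually.of_forall fun n => by simp only [Set.mem_compl_iff, Set.mem_singleton_iff]; positivity)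
    exact (tendsto_inv_atTop_nhds_zero_nat (𝕜 := ℝ)).comp (tendsto_add_atTop_nat 1)
  refine ge_of_tendsto' (hu.comp h1) fun n => ?_
  have hn : (0 : ℝ) < ((n + 1 : ℕ) : ℝ) := by positivity
  have h2 := offNorm_transl_nsmul_le hψ (((n + 1 : ℕ) : ℝ)⁻¹ • a) n
  rw [smul_smul, mul_inv_cancel₀ hn.ne', one_smul] at h2
  refine h2.trans ((mul_le_mul_of_nonneg_left (h _ (inv_pos.mpr hn)) hn.le).trans_eq ?_)
  rw [← mul_assoc, mul_inv_cancel₀ hn.ne', one_mul]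
  rfl

/-- A contribution quadratic in |a| is free: splitting T_a into n translations by a/n divides it by
n. This removes terms carrying an uncompensated ε⁻¹. -/
theorem offNorm_transl_le_of_quadratic (hψ : Orthonormal ℂ ψ) {c d : ℝ}
    (h : ∀ a : E3, offNorm ψ (transl a) ≤ ‖a‖ * (c + d * ‖a‖)) (a : E3) :
    offNorm ψ (transl a) ≤ ‖a‖ * c := by
  have hu : Tendsto (fun s : ℝ => ‖a‖ * (c + d * (s * ‖a‖))) (𝓝[≠] 0) (𝓝 (‖a‖ * c)) := by
    have : Continuous (fun s : ℝ => ‖a‖ * (c + d * (s * ‖a‖))) := by fun_prop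
    simpa using (this.tendsto 0).mono_left nhdsWithin_le_nhds
  refine offNorm_transl_le_of_tendsto hψ hu fun s hs => (h _).trans_eq ?_
  rw [norm_smul, Real.norm_of_nonneg hs.le]
  ring

/-- The block `p (a · ∇) q`. -/
def offGrad (ψ : Fin N → L2) (a : E3) : L2 →L[ℂ] L2 :=
  ∑ l, ((a l : ℝ) : ℂ) • (projPartial ψ l ∘L coproj ψ)

/-- The error of the difference quotient of translations along `a` at `ψ`. -/
def translError (ψ : Fin N → L2) (a : E3) (s : ℝ) : ℝ :=
  ∑ j, ‖s⁻¹ • (transl (s • (-a)) (ψ j) - ψ j) -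
    ∑ l, (((-a) l : ℝ) : ℂ) • weakPartial l (ψ j)‖

theorem tendsto_translError (hH2 : ∀ j, MemH2 (ψ j)) (a : E3) :
    Tendsto (translError ψ a) (𝓝[≠] 0) (𝓝 0) := by
  have h : Tendsto (translError ψ a) (𝓝[≠] 0) (𝓝 (∑ _j : Fin N, 0)) := by
    refine tendsto_finsetSum _ fun j _ => ?_
    have h1 := hasDerivAt_iff_tendsto_slope_zero.mp (hasDerivAt_transl (hH2 j) (-a))
    simp only [zero_add, zero_smul, transl_zero] at h1
    simpa using (tendsto_iff_norm_sub_tendsto_zero.mp h1)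
  simpa using h

theorem projPartial_apply (ψ : Fin N → L2) (l : Fin 3) (f : L2) :
    projPartial ψ l f = ∑ j, ⟪-weakPartial l (ψ j), f⟫_ℂ • ψ j := by
  simp [projPartial]

theorem traceLE_offDiag_transl_sub (hψ : Orthonormal ℂ ψ) (a : E3) (s : ℝ) :
    TraceLE (((s⁻¹ : ℝ) : ℂ) • offDiag ψ (transl (s • a)) - offGrad ψ a) (translError ψ a s) := by
  set v : Fin N → L2 := fun j => s⁻¹ • (transl (s • (-a)) (ψ j) - ψ j) -
    ∑ l, (((-a) l : ℝ) : ℂ) • weakPartial l (ψ j) with hv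
  have h1 : ((s⁻¹ : ℝ) : ℂ) • offDiag ψ (transl (s • a)) - offGrad ψ a =
      (∑ j, InnerProductSpace.rankOne ℂ (ψ j) (v j)) ∘L (1 - spanProj ψ) := by
    ext1 f
    set g : L2 := (1 - spanProj ψ) f with hg
    have hg0 : ∑ j, ⟪ψ j, g⟫_ℂ • ψ j = 0 := by
      rw [← spanProj_apply, hg]
      change spanProj ψ (f - spanProj ψ f) = 0
      rw [map_sub, spanProj_spanProj hψ, sub_self]
    have e1 : offDiag ψ (transl (s • a)) f = ∑ j, ⟪transl (s • (-a)) (ψ j), g⟫_ℂ • ψ j := by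
      change spanProj ψ (transl (s • a) g) = _
      rw [spanProj_apply]
      simp_rw [inner_transl, smul_neg, neg_neg]
    have e2 : offGrad ψ a f = ∑ j, (∑ l, ((a l : ℝ) : ℂ) * ⟪-weakPartial l (ψ j), g⟫_ℂ) • ψ j := by
      simp only [offGrad, sum_apply, _root_.smul_apply]
      change ∑ l, ((a l : ℝ) : ℂ) • projPartial ψ l g = _
      simp_rw [projPartial_apply, Finset.smul_sum, Finset.sum_smul, smul_smul]
      exact Finset.sum_comm
    rw [_root_.sub_apply, _root_.smul_apply, e1, e2]
    have e3 : ((∑ j, InnerProductSpace.rankOne ℂ (ψ j) (v j)) ∘L (1 - spanProj ψ)) f =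
        ∑ j, ⟪v j, g⟫_ℂ • ψ j := by
      rw [ContinuousLinearMap.comp_apply, ← hg, sum_apply]
      simp only [InnerProductSpace.rankOne_apply]
    -- Since g lies in the range of q, the overlaps with ψ_j vanish and may be subtracted, which
    -- produces a difference quotient. Its limit is ∑ a_l ∂_l ψ_j with the sign reversed, matching
    -- the adjoint in `projPartial`.
    have e4 : ∑ j, ⟪transl (s • (-a)) (ψ j), g⟫_ℂ • ψ j =
        ∑ j, (⟪transl (s • (-a)) (ψ j), g⟫_ℂ - ⟪ψ j, g⟫_ℂ) • ψ j := by
      simp_rw [sub_smul, Finset.sum_sub_distrib, hg0, sub_zero]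
    rw [e3, e4, Finset.smul_sum, ← Finset.sum_sub_distrib]
    refine Finset.sum_congr rfl fun j _ => ?_
    rw [smul_smul, ← sub_smul]
    congr 1
    rw [hv]
    simp only
    rw [inner_sub_left, ← algebraMap_smul ℂ s⁻¹, Complex.coe_algebraMap, inner_smul_left,
      inner_sub_left, Complex.conj_ofReal, sum_inner]
    congr 1
    refine Finset.sum_congr rfl fun l _ => ?_
    rw [inner_smul_left, Complex.conj_ofReal, inner_neg_left, PiLp.neg_apply]
    push_cast
    ring
  rw [h1]
  have h2 := (TraceLE.sum Finset.univ fun j _ => traceLE_rankOne (ψ j) (v j)).comp_right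
    (1 - spanProj ψ)
  simp only [hψ.1, one_mul] at h2
  refine h2.mono (mul_le_of_le_one_right (Finset.sum_nonneg fun j _ => norm_nonneg _)
    (norm_one_sub_spanProj_le hψ))

/-- Near 0 the block of T_{sa} is s times the gradient block up to o(s), and subadditivity carries
this bound to a itself. -/
theorem offNorm_transl_le_of_offGrad (hψ : Orthonormal ℂ ψ) (hH2 : ∀ j, MemH2 (ψ j)) {a : E3}
    {c : ℝ} (h : TraceLE (offGrad ψ a) c) : offNorm ψ (transl a) ≤ c := by
  have hu : Tendsto (fun s => c + translError ψ a s) (𝓝[≠] 0) (𝓝 c) := by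
    simpa using (tendsto_translError hH2 a).const_add c
  refine offNorm_transl_le_of_tendsto hψ hu fun s hs => ?_
  have h1 := (h.add (traceLE_offDiag_transl_sub hψ a s)).smul (s : ℂ)
  rw [add_sub_cancel, smul_smul, ← Complex.ofReal_mul, mul_inv_cancel₀ hs.ne', Complex.ofReal_one,
    one_smul, Complex.norm_real, Real.norm_of_nonneg hs.le] at h1
  exact h1.toReal_le

theorem traceLE_offGrad_of_offNorm_transl (hψ : Orthonormal ℂ ψ) (hH2 : ∀ j, MemH2 (ψ j)) {a : E3}
    {c : ℝ} (h : ∀ s : ℝ, 0 < s → offNorm ψ (transl (s • a)) ≤ s * c) :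
    TraceLE (offGrad ψ a) c := by
  have hu : Tendsto (fun s => c + translError ψ a s) (𝓝[>] 0) (𝓝 c) := by
    simpa using ((tendsto_translError hH2 a).mono_left
      (nhdsWithin_mono (0 : ℝ) fun x (hx : x ∈ Set.Ioi (0 : ℝ)) =>
        (ne_of_gt hx : x ≠ 0))).const_add c
  refine TraceLE.of_tendsto ?_ hu
  filter_upwards [self_mem_nhdsWithin] with s (hs : 0 < s)
  have h1 := ((traceLE_offDiag hψ (transl (s • a))).mono (h s hs)).smul ((s⁻¹ : ℝ) : ℂ)
  have h2 := h1.sub (traceLE_offDiag_transl_sub hψ a s)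
  rw [sub_sub_cancel, Complex.norm_real, Real.norm_of_nonneg (by positivity), ← mul_assoc,
    inv_mul_cancel₀ hs.ne', one_mul] at h2
  exact h2

theorem norm_proj_le (l : Fin 3) :
    ‖(PiLp.proj 2 (fun _ : Fin 3 => L2) l : L2Vec →L[ℂ] L2)‖ ≤ 1 :=
  ContinuousLinearMap.opNorm_le_bound _ zero_le_one fun x => by
    rw [one_mul]
    exact PiLp.norm_apply_le x l

/-- The inclusion of the `l`-th component into `L²(ℝ³) ⊗ ℂ³`. -/
def component (l : Fin 3) : L2 →L[ℂ] L2Vec :=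
  LinearMap.mkContinuous
    { toFun := fun f => PiLp.single 2 l f
      map_add' := fun f g => by
        ext i : 1
        exact congrFun (Pi.single_add (f := fun _ : Fin 3 => L2) l f g) i
      map_smul' := fun c f => by
        ext i : 1
        exact congrFun (Pi.single_smul (f := fun _ : Fin 3 => L2) l c f) i } 1
    fun f => by
      rw [one_mul]
      exact (PiLp.norm_single 2 (fun _ : Fin 3 => L2) l f).le

theorem norm_component_le (l : Fin 3) : ‖component l‖ ≤ 1 :=
  LinearMap.mkContinuous_norm_le _ zero_le_one _

theorem traceLE_projPartial_of_projGrad {c : ℝ} (h : TraceLE (projGrad ψ) c) (l : Fin 3) :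
    TraceLE (projPartial ψ l ∘L coproj ψ) c :=
  (h.comp_left (PiLp.proj 2 (fun _ : Fin 3 => L2) l : L2Vec →L[ℂ] L2)).mono
    (mul_le_of_le_one_left h.1 (norm_proj_le l))

theorem traceLE_projGrad_of_projPartial {c : ℝ}
    (h : ∀ l, TraceLE (projPartial ψ l ∘L coproj ψ) c) : TraceLE (projGrad ψ) (3 * c) := by
  have h1 : projGrad ψ = ∑ l, component l ∘L (projPartial ψ l ∘L coproj ψ) := by
    ext1 f
    ext i : 1
    rw [sum_apply, WithLp.ofLp_sum, Finset.sum_apply, Finset.sum_eq_single i]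
    · change projPartial ψ i (coproj ψ f) = (Pi.single i (projPartial ψ i (coproj ψ f)) : Fin 3 → L2) i
      rw [Pi.single_eq_same]
    · intro l _ hl
      change (Pi.single l (projPartial ψ l (coproj ψ f)) : Fin 3 → L2) i = 0
      rw [Pi.single_eq_of_ne hl.symm]
    · simp
  rw [h1]
  have h2 := TraceLE.sum Finset.univ fun l _ =>
    ((h l).comp_left (component l)).mono (mul_le_of_le_one_left (h l).1 (norm_component_le l))
  simpa using h2

/-- Each component of a is at most |a|; the three components give the factor 3. -/
theorem traceLE_offGrad_of_projGrad {c : ℝ} (h : TraceLE (projGrad ψ) c) (a : E3) :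
    TraceLE (offGrad ψ a) (3 * c * ‖a‖) := by
  have h1 := TraceLE.sum Finset.univ fun l _ =>
    ((traceLE_projPartial_of_projGrad h l).smul ((a l : ℝ) : ℂ)).mono (b := ‖a‖ * c) (by
      rw [Complex.norm_real]
      exact mul_le_mul_of_nonneg_right (PiLp.norm_apply_le a l) h.1)
  refine h1.mono (le_of_eq ?_)
  simp
  ring

theorem offGrad_single (l : Fin 3) :
    offGrad ψ (EuclideanSpace.single l 1) = projPartial ψ l ∘L coproj ψ := by
  rw [offGrad, Finset.sum_eq_single l]
  · simp
  · intro i _ hi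
    simp [hi]
  · simp

end Gradient

/-! ### Commutators with plane waves -/

section Commutator

variable {N : ℕ} {ψ : Fin N → L2}

theorem expMul_comm_eq (k' k a : E3) (c : ℂ) :
    expMul k' ∘L (c • (transl a ∘L expMul k)) - (c • (transl a ∘L expMul k)) ∘L expMul k' =
      (c * (Complex.exp (Complex.I * ((-⟪a, k'⟫_ℝ : ℝ) : ℂ)) - 1)) •
        (transl a ∘L (expMul k ∘L expMul k')) := by
  ext1 f
  have h1 : expMul k' (transl a (expMul k f)) =
      Complex.exp (Complex.I * ((-⟪a, k'⟫_ℝ : ℝ) : ℂ)) • transl a (expMul k' (expMul k f)) :=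
    congrArg (fun A : L2 →L[ℂ] L2 => A (expMul k f)) (expMul_transl k' a)
  have h2 : expMul k' (expMul k f) = expMul k (expMul k' f) :=
    congrArg (fun A : L2 →L[ℂ] L2 => A f) (expMul_expMul k' k)
  simp only [ContinuousLinearMap.comp_apply, _root_.sub_apply, _root_.smul_apply, map_smul, h1, h2]
  rw [mul_sub, sub_smul, mul_one, smul_smul]

theorem norm_phase_sub_one_le (a k : E3) :
    ‖Complex.exp (Complex.I * ((-⟪a, k⟫_ℝ : ℝ) : ℂ)) - 1‖ ≤ ‖a‖ * ‖k‖ := by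
  refine (Real.norm_exp_I_mul_ofReal_sub_one_le).trans ?_
  rw [norm_neg]
  exact norm_inner_le_norm a k

/-- The crude bound N for the block suffices here: the translation comes from free evolution over a
short time, so |a| is of order h and the effect over the step is O(h²). -/
theorem offNorm_expMul_comm_le (hψ : Orthonormal ℂ ψ) {Λ : ℝ} {k' : E3} (hk' : ‖k'‖ ≤ Λ)
    (k a : E3) {c : ℂ} (hc : ‖c‖ = 1) :
    offNorm ψ (expMul k' ∘L (c • (transl a ∘L expMul k)) -
      (c • (transl a ∘L expMul k)) ∘L expMul k') ≤ Λ * ‖a‖ * N := by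
  have hN : offNorm ψ (transl a ∘L (expMul k ∘L expMul k')) ≤ N := by
    refine (offNorm_le_norm hψ _).trans (mul_le_of_le_one_right (Nat.cast_nonneg N) ?_)
    refine (ContinuousLinearMap.opNorm_comp_le _ _).trans
      (mul_le_one₀ (norm_transl_le a) (norm_nonneg _) ?_)
    exact (ContinuousLinearMap.opNorm_comp_le _ _).trans
      (mul_le_one₀ (norm_expMul_le k) (norm_nonneg _) (norm_expMul_le k'))
  rw [expMul_comm_eq]
  refine (offNorm_smul_le hψ _ _).trans ?_
  rw [norm_mul, hc, one_mul]
  refine mul_le_mul ((norm_phase_sub_one_le a k').trans ?_) hN (offNorm_nonneg _ _) ?_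
  · rw [mul_comm]
    gcongr
  · exact mul_nonneg ((norm_nonneg _).trans hk') (norm_nonneg _)

/-- Here the off-diagonal norms must be kept: ‖p e^{ik'x} q‖ carries the factor ε that compensates
ε⁻¹ in front of the field. -/
theorem offNorm_expMul_comm_transl_le (hψ : Orthonormal ℂ ψ) {Λ : ℝ} {k' : E3} (hk' : ‖k'‖ ≤ Λ)
    (a : E3) :
    offNorm ψ (expMul k' ∘L transl a - transl a ∘L expMul k') ≤
      Λ * ‖a‖ * (offNorm ψ (expMul k') + offNorm ψ (transl a)) := by
  have h : expMul k' ∘L transl a - transl a ∘L expMul k' =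
      (Complex.exp (Complex.I * ((-⟪a, k'⟫_ℝ : ℝ) : ℂ)) - 1) • (transl a ∘L expMul k') := by
    rw [expMul_transl, sub_smul, one_smul]
  rw [h, add_comm (offNorm ψ (expMul k'))]
  refine (offNorm_smul_le hψ _ _).trans ?_
  refine mul_le_mul ((norm_phase_sub_one_le a k').trans ?_)
    (offNorm_comp_le hψ (norm_transl_le a) (norm_expMul_le k')) (offNorm_nonneg _ _) ?_
  · rw [mul_comm]
    gcongr
  · exact mul_nonneg ((norm_nonneg _).trans hk') (norm_nonneg _)

end Commutator

/-! ### Propagation of the semiclassical structure -/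

section Propagation

open Filter Topology

variable {N : ℕ} {δ m Λ : ℝ} {I : Set ℝ} {φ : Fin N → ℝ → L2} {α : ℝ → L2} {σ ε T A : ℝ}

/-- The bounds `‖p e^{ikx} q‖ ≤ z N ε (1 + |k|)` and `‖p e^{a·∇} q‖ ≤ z N |a|` in trace norm. -/
def SemiclassicalBound (ε : ℝ) (ψ : Fin N → L2) (z : ℝ) : Prop :=
  (∀ k, offNorm ψ (expMul k) ≤ z * (N * ε) * (1 + ‖k‖)) ∧
    ∀ a, offNorm ψ (transl a) ≤ z * N * ‖a‖

theorem SemiclassicalBound.mono {ψ : Fin N → L2} {z z' : ℝ} (h : SemiclassicalBound ε ψ z)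
    (hε : 0 ≤ ε) (hz : z ≤ z') : SemiclassicalBound ε ψ z' :=
  ⟨fun k => (h.1 k).trans (by gcongr), fun a => (h.2 a).trans (by gcongr)⟩

theorem SemiclassicalBound.of_tendsto {ψ : Fin N → L2} {u : ℕ → ℝ} {z : ℝ}
    (h : ∀ n, SemiclassicalBound ε ψ (u n)) (hu : Tendsto u atTop (𝓝 z)) :
    SemiclassicalBound ε ψ z :=
  ⟨fun k => ge_of_tendsto' ((hu.mul_const _).mul_const _) fun n => (h n).1 k,
    fun a => ge_of_tendsto' ((hu.mul_const _).mul_const _) fun n => (h n).2 a⟩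

theorem offNorm_transl_growth (hsol : IsSolution N δ m Λ I φ α) (hN : 0 < N)
    (hΛ : 0 ≤ Λ) (hσ : |σ| = 1) (hε : ε = (N : ℝ) ^ (-(1 / 3) : ℝ))
    (hI : ∀ s ∈ Set.Icc 0 T, σ * s ∈ I) (h0 : Orthonormal ℂ (fun j => φ j 0))
    (hA : ∀ s ∈ Set.Icc 0 T, ‖α (σ * s)‖ ≤ A)
    {s₁ s₂ : ℝ} (h01 : 0 ≤ s₁) (h12 : s₁ ≤ s₂) (h2T : s₂ ≤ T) (a : E3) {M : ℝ}
    (hM : ∀ s ∈ Set.Icc s₁ s₂, ∀ k : E3, ‖k‖ ≤ Λ → offNorm (fun j => φ j (σ * s)) (expMul k) +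
      offNorm (fun j => φ j (σ * s)) (transl a) ≤ M) :
    offNorm (fun j => φ j (σ * s₂)) (transl a) ≤ offNorm (fun j => φ j (σ * s₁)) (transl a) +
      ε⁻¹ * (2 * (Λ * ‖a‖ * M) * (Λ * A)) * (s₂ - s₁) := by
  have hM0 : 0 ≤ M := (add_nonneg (offNorm_nonneg _ _) (offNorm_nonneg _ _)).trans
    (hM s₁ ⟨le_rfl, h12⟩ 0 (by simpa using hΛ))
  refine offNorm_solution_le hsol hN hΛ hσ hε hI h0 h01 h12 h2T (transl a) (fun _ => transl a)
    (fun s => ?_) fun s hs => ?_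
  · ext1 f
    simp only [ContinuousLinearMap.comp_apply]
    rw [← freeProp_transl, freeProp_freeProp, neg_add_cancel, freeProp_zero]
  · have hsT : s ∈ Set.Icc 0 T := ⟨h01.trans hs.1, hs.2.trans h2T⟩
    have hon := orthonormal_solution hsol hN hΛ hI h0 hsT
    refine (offNorm_comm_fieldOp_le hon m hΛ (α (σ * s)) (transl a) (κ := Λ * ‖a‖ * M)
      fun k hk => (offNorm_expMul_comm_transl_le hon hk a).trans ?_).trans ?_
    · exact mul_le_mul_of_nonneg_left (hM s hs k hk) (by positivity)
    · have := hA s hsT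
      gcongr

/-- Three contributions: the old plane-wave block, the transport by free evolution, and the field.
The field commutes with e^{ikx} and sees only the translation of size 2ε(s₂ - s)|k|, so its
contribution is quadratic in the time step. -/
theorem offNorm_expMul_growth (hsol : IsSolution N δ m Λ I φ α) (hN : 0 < N)
    (hΛ : 0 ≤ Λ) (hσ : |σ| = 1) (hε : ε = (N : ℝ) ^ (-(1 / 3) : ℝ))
    (hI : ∀ s ∈ Set.Icc 0 T, σ * s ∈ I) (h0 : Orthonormal ℂ (fun j => φ j 0))
    (hA : ∀ s ∈ Set.Icc 0 T, ‖α (σ * s)‖ ≤ A)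
    {s₁ s₂ : ℝ} (h01 : 0 ≤ s₁) (h12 : s₁ ≤ s₂) (h2T : s₂ ≤ T) (k : E3) :
    offNorm (fun j => φ j (σ * s₂)) (expMul k) ≤ offNorm (fun j => φ j (σ * s₁)) (expMul k) +
      offNorm (fun j => φ j (σ * s₁)) (transl ((2 * (σ * ε * (s₂ - s₁))) • k)) +
      ε⁻¹ * (2 * (Λ * (2 * ε * (s₂ - s₁) * ‖k‖) * N) * (Λ * A)) * (s₂ - s₁) := by
  have hN' : (0 : ℝ) < N := Nat.cast_pos.mpr hN
  have hε0 : 0 < ε := by rw [hε]; positivity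
  have hsT : ∀ s ∈ Set.Icc s₁ s₂, s ∈ Set.Icc 0 T := fun s hs => ⟨h01.trans hs.1, hs.2.trans h2T⟩
  have hon : ∀ s ∈ Set.Icc s₁ s₂, Orthonormal ℂ (fun j => φ j (σ * s)) := fun s hs =>
    orthonormal_solution hsol hN hΛ hI h0 (hsT s hs)
  have hs₁ : s₁ ∈ Set.Icc s₁ s₂ := ⟨le_rfl, h12⟩
  set C : ℝ → L2 →L[ℂ] L2 := fun s =>
    Complex.exp (Complex.I * ((-((σ * ε * (s₂ - s)) * ‖k‖ ^ 2) : ℝ) : ℂ)) •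
      (transl ((2 * (σ * ε * (s₂ - s))) • k) ∘L expMul k) with hC
  have h1 := offNorm_solution_le hsol hN hΛ hσ hε hI h0 h01 h12 h2T (expMul k) C
    (fun s => (expMul_freeProp k _).symm)
    (r := 2 * (Λ * (2 * ε * (s₂ - s₁) * ‖k‖) * N) * (Λ * A)) fun s hs => by
      have hd : 0 ≤ s₂ - s := sub_nonneg.mpr hs.2
      have hd' : s₂ - s ≤ s₂ - s₁ := sub_le_sub_left hs.1 _
      have hd₁ : 0 ≤ s₂ - s₁ := hd.trans hd'
      refine (offNorm_comm_fieldOp_le (hon s hs) m hΛ (α (σ * s)) (C s)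
        (κ := Λ * (2 * ε * (s₂ - s₁) * ‖k‖) * N)
        fun k' hk' => (offNorm_expMul_comm_le (hon s hs) hk' k _ (norm_phase _)).trans ?_).trans ?_
      · rw [norm_smul, Real.norm_eq_abs, abs_mul, abs_mul, abs_mul, hσ, abs_of_pos hε0,
          abs_of_nonneg hd, abs_two, one_mul, ← mul_assoc 2]
        gcongr
      · have := hA s (hsT s hs)
        gcongr
  have h2 : offNorm (fun j => φ j (σ * s₁)) (C s₁) ≤
      offNorm (fun j => φ j (σ * s₁)) (transl ((2 * (σ * ε * (s₂ - s₁))) • k)) +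
        offNorm (fun j => φ j (σ * s₁)) (expMul k) := by
    refine (offNorm_smul_le (hon s₁ hs₁) _ _).trans ?_
    rw [norm_phase, one_mul]
    exact offNorm_comp_le (hon s₁ hs₁) (norm_transl_le _) (norm_expMul_le k)
  linarith

/-- One Gronwall step: the linear rate must be sharp and independent of N, T and G, whereas K may
depend on everything because it multiplies the square of the step length. -/
theorem semiclassicalBound_step (hsol : IsSolution N δ m Λ I φ α) (hN : 0 < N)
    (hΛ1 : 1 ≤ Λ) (hσ : |σ| = 1) (hε : ε = (N : ℝ) ^ (-(1 / 3) : ℝ))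
    (hI : ∀ s ∈ Set.Icc 0 T, σ * s ∈ I) (h0 : Orthonormal ℂ (fun j => φ j 0))
    (hA : ∀ s ∈ Set.Icc 0 T, ‖α (σ * s)‖ ≤ A) {G : ℝ} (hG0 : 0 ≤ G)
    (hG : ∀ s ∈ Set.Icc 0 T, ∀ a, offNorm (fun j => φ j (σ * s)) (transl a) ≤ G * ‖a‖) :
    ∃ K, ∀ s₁ s₂ z, 0 ≤ s₁ → s₁ ≤ s₂ → s₂ ≤ T → 0 ≤ z →
      SemiclassicalBound ε (fun j => φ j (σ * s₁)) z →
      SemiclassicalBound ε (fun j => φ j (σ * s₂))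
        (z * (1 + (4 * Λ ^ 3 * A + 2) * (s₂ - s₁)) + K * (s₂ - s₁) ^ 2) := by
  have hN' : (0 : ℝ) < N := Nat.cast_pos.mpr hN
  have hε0 : 0 < ε := by rw [hε]; positivity
  have hΛ : 0 ≤ Λ := zero_le_one.trans hΛ1
  set K₁ := 2 * ε * G + 4 * Λ ^ 2 * A * N * T with hK₁
  set K₂ := 2 * ε⁻¹ * Λ ^ 3 * A * K₁ / N with hK₂
  set K₃ := 4 * Λ ^ 2 * A / ε with hK₃
  refine ⟨K₂ + K₃, fun s₁ s₂ z h01 h12 h2T hz hP => ?_⟩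
  have hT : 0 ≤ T := h01.trans (h12.trans h2T)
  have hA0 : 0 ≤ A := (norm_nonneg _).trans (hA 0 ⟨le_rfl, hT⟩)
  have hK₁0 : 0 ≤ K₁ := by positivity
  have hK₂0 : 0 ≤ K₂ := by positivity
  have hK₃0 : 0 ≤ K₃ := by positivity
  have hh : 0 ≤ s₂ - s₁ := sub_nonneg.mpr h12
  have hs₂ : s₂ ∈ Set.Icc 0 T := ⟨h01.trans h12, h2T⟩
  have hnorm : ∀ s, s₁ ≤ s → ∀ k : E3, ‖(2 * (σ * ε * (s - s₁))) • k‖ = 2 * ε * (s - s₁) * ‖k‖ := by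
    intro s hs k
    rw [norm_smul, Real.norm_eq_abs, abs_mul, abs_mul, abs_mul, hσ, abs_of_pos hε0,
      abs_of_nonneg (sub_nonneg.mpr hs), abs_two, one_mul, ← mul_assoc 2]
  -- Within the step, plane-wave blocks exceed their initial bound by O(s₂ - s₁); multiplied by the
  -- step length in the estimate for translations, this is second order.
  have hcrude : ∀ s ∈ Set.Icc s₁ s₂, ∀ k : E3, ‖k‖ ≤ Λ →
      offNorm (fun j => φ j (σ * s)) (expMul k) ≤
        z * (N * ε) * (1 + Λ) + K₁ * Λ * (s₂ - s₁) := by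
    intro s hs k hk
    have h1 := offNorm_expMul_growth hsol hN hΛ hσ hε hI h0 hA h01 hs.1 (hs.2.trans h2T) k
    have h2 := hG s₁ ⟨h01, h12.trans h2T⟩ ((2 * (σ * ε * (s - s₁))) • k)
    rw [hnorm s hs.1] at h2
    have hd : 0 ≤ s - s₁ := sub_nonneg.mpr hs.1
    have hd' : s - s₁ ≤ s₂ - s₁ := sub_le_sub_right hs.2 _
    have hdT : s - s₁ ≤ T := by linarith [hs.2]
    have h3 : ε⁻¹ * (2 * (Λ * (2 * ε * (s - s₁) * ‖k‖) * N) * (Λ * A)) * (s - s₁) =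
        4 * Λ ^ 2 * A * N * (s - s₁) * (s - s₁) * ‖k‖ := by
      field_simp
      ring
    have h4 : 4 * Λ ^ 2 * A * N * (s - s₁) * (s - s₁) * ‖k‖ ≤
        4 * Λ ^ 2 * A * N * T * (s₂ - s₁) * Λ := by gcongr
    have h5 : G * (2 * ε * (s - s₁) * ‖k‖) ≤ G * (2 * ε * (s₂ - s₁) * Λ) := by gcongr
    have h6 : offNorm (fun j => φ j (σ * s₁)) (expMul k) ≤ z * (N * ε) * (1 + Λ) :=
      (hP.1 k).trans (by gcongr)
    calc _ ≤ _ := h1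
      _ ≤ z * (N * ε) * (1 + Λ) + G * (2 * ε * (s₂ - s₁) * Λ) +
          4 * Λ ^ 2 * A * N * T * (s₂ - s₁) * Λ := by
        rw [h3]
        exact add_le_add (add_le_add h6 (h2.trans h5)) h4
      _ = _ := by rw [hK₁]; ring
  constructor
  · intro k
    have h1 := offNorm_expMul_growth hsol hN hΛ hσ hε hI h0 hA h01 h12 h2T k
    have h2 := hP.2 ((2 * (σ * ε * (s₂ - s₁))) • k)
    rw [hnorm s₂ h12] at h2
    have h3 := hP.1 k
    have h4 : ε⁻¹ * (2 * (Λ * (2 * ε * (s₂ - s₁) * ‖k‖) * N) * (Λ * A)) * (s₂ - s₁) =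
        K₃ * (s₂ - s₁) ^ 2 * (N * ε) * ‖k‖ := by
      rw [hK₃]
      field_simp
      ring
    calc _ ≤ _ := h1
      _ ≤ z * (N * ε) * (1 + ‖k‖) + z * N * (2 * ε * (s₂ - s₁) * ‖k‖) +
          K₃ * (s₂ - s₁) ^ 2 * (N * ε) * ‖k‖ := by
        rw [h4]
        exact add_le_add (add_le_add h3 h2) le_rfl
      _ = (z * (N * ε)) * (1 + ‖k‖) + (z * (2 * (s₂ - s₁)) * (N * ε)) * ‖k‖ +
          (K₃ * (s₂ - s₁) ^ 2 * (N * ε)) * ‖k‖ := by ring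
      _ ≤ (z * (N * ε)) * (1 + ‖k‖) + (z * ((4 * Λ ^ 3 * A + 2) * (s₂ - s₁)) * (N * ε)) * (1 + ‖k‖) +
          ((K₂ + K₃) * (s₂ - s₁) ^ 2 * (N * ε)) * (1 + ‖k‖) := by
        have e1 : (2 : ℝ) ≤ 4 * Λ ^ 3 * A + 2 := le_add_of_nonneg_left (by positivity)
        have e2 : ‖k‖ ≤ 1 + ‖k‖ := le_add_of_nonneg_left zero_le_one
        have e3 : K₃ ≤ K₂ + K₃ := le_add_of_nonneg_left hK₂0
        gcongr
      _ = _ := by ring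
  · intro a
    set c := z * N + ε⁻¹ * 2 * Λ ^ 2 * A * (s₂ - s₁) *
      (z * (N * ε) * (1 + Λ) + K₁ * Λ * (s₂ - s₁)) with hc
    -- The a priori bound G|a| on ‖p T_a q‖ enters only quadratically in a and is discarded below.
    have hquad : ∀ a : E3, offNorm (fun j => φ j (σ * s₂)) (transl a) ≤
        ‖a‖ * (c + ε⁻¹ * 2 * Λ ^ 2 * A * (s₂ - s₁) * G * ‖a‖) := fun a => by
      have h1 := offNorm_transl_growth hsol hN hΛ hσ hε hI h0 hA h01 h12 h2T a
        (M := z * (N * ε) * (1 + Λ) + K₁ * Λ * (s₂ - s₁) + G * ‖a‖) fun s hs k hk =>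
          add_le_add (hcrude s hs k hk) (hG s ⟨h01.trans hs.1, hs.2.trans h2T⟩ a)
      refine h1.trans ((add_le_add_left (hP.2 a) _).trans_eq ?_)
      rw [hc]
      ring
    have hon := orthonormal_solution hsol hN hΛ hI h0 hs₂
    refine (offNorm_transl_le_of_quadratic hon hquad a).trans ?_
    rw [mul_comm]
    refine mul_le_mul_of_nonneg_right ?_ (norm_nonneg a)
    have e1 : c = z * N + 2 * Λ ^ 2 * A * (s₂ - s₁) * z * N * (1 + Λ) +
        K₂ * (s₂ - s₁) ^ 2 * N := by
      rw [hc, hK₂]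
      field_simp
      ring
    -- From 1 + Λ ≤ 2Λ; this yields the 4Λ³A in the rate. The other summand 2 comes from the
    -- transport of plane waves.
    have e2 : 2 * Λ ^ 2 * A * (s₂ - s₁) * z * N * (1 + Λ) ≤
        2 * Λ ^ 2 * A * (s₂ - s₁) * z * N * (2 * Λ) := by
      gcongr
      linarith
    have e3 : 0 ≤ z * (2 * (s₂ - s₁)) * N := by positivity
    have e4 : 0 ≤ K₃ * (s₂ - s₁) ^ 2 * N := by positivity
    rw [e1]
    linarith

theorem semiclassicalBound_solution (hsol : IsSolution N δ m Λ I φ α) (hN : 0 < N)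
    (hΛ1 : 1 ≤ Λ) (hσ : |σ| = 1) (hε : ε = (N : ℝ) ^ (-(1 / 3) : ℝ)) (hT : 0 ≤ T)
    (hI : ∀ s ∈ Set.Icc 0 T, σ * s ∈ I) (h0 : Orthonormal ℂ (fun j => φ j 0))
    (hA : ∀ s ∈ Set.Icc 0 T, ‖α (σ * s)‖ ≤ A) {z : ℝ} (hz : 0 ≤ z)
    (hP : SemiclassicalBound ε (fun j => φ j 0) z) :
    SemiclassicalBound ε (fun j => φ j (σ * T)) (Real.exp ((4 * Λ ^ 3 * A + 2) * T) * z) := by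
  have hN' : (0 : ℝ) < N := Nat.cast_pos.mpr hN
  have hε0 : 0 < ε := by rw [hε]; positivity
  have hΛ : 0 ≤ Λ := zero_le_one.trans hΛ1
  have hA0 : 0 ≤ A := (norm_nonneg _).trans (hA 0 ⟨le_rfl, hT⟩)
  -- A priori Lipschitz bound from the trivial estimate of every block by N. Its bad dependence on ε
  -- affects only K.
  have hG : ∀ s ∈ Set.Icc 0 T, ∀ a, offNorm (fun j => φ j (σ * s)) (transl a) ≤
      (z * N + ε⁻¹ * 4 * Λ ^ 2 * A * N * T) * ‖a‖ := by
    intro s hs a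
    have hle : ∀ r ∈ Set.Icc 0 s, ∀ B : L2 →L[ℂ] L2, ‖B‖ ≤ 1 →
        offNorm (fun j => φ j (σ * r)) B ≤ N := fun r hr B hB =>
      (offNorm_le_norm (orthonormal_solution hsol hN hΛ hI h0 ⟨hr.1, hr.2.trans hs.2⟩) B).trans
        (mul_le_of_le_one_right hN'.le hB)
    have h1 := offNorm_transl_growth hsol hN hΛ hσ hε hI h0 hA le_rfl hs.1 hs.2 a (M := N + N)
      fun r hr k _ => add_le_add (hle r hr _ (norm_expMul_le k)) (hle r hr _ (norm_transl_le a))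
    rw [mul_zero, sub_zero] at h1
    calc _ ≤ _ := h1
      _ ≤ z * N * ‖a‖ + ε⁻¹ * (2 * (Λ * ‖a‖ * (N + N)) * (Λ * A)) * T := by
        refine add_le_add (hP.2 a) ?_
        have := hs.2
        gcongr
      _ = _ := by ring
  obtain ⟨K, hK⟩ := semiclassicalBound_step hsol hN hΛ1 hσ hε hI h0 hA (by positivity) hG
  set β := 4 * Λ ^ 3 * A + 2 with hβ
  have hβ0 : 0 ≤ β := by positivity
  have hiter : ∀ h : ℝ, 0 ≤ h → ∀ i : ℕ, i * h ≤ T →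
      SemiclassicalBound ε (fun j => φ j (σ * (i * h)))
        (Real.exp (β * (i * h)) * (z + i * (|K| * h ^ 2))) := by
    intro h hh i
    induction i with
    | zero => intro _; simpa using hP
    | succ i ih =>
      intro hi
      have hsucc : ((i + 1 : ℕ) : ℝ) * h = i * h + h := by push_cast; ring
      rw [hsucc] at hi ⊢
      have h1 := hK (i * h) (i * h + h) _ (by positivity) (by linarith) hi (by positivity)
        (ih (by linarith))
      rw [add_sub_cancel_left] at h1
      refine h1.mono hε0.le ?_
      have e1 : 1 + β * h ≤ Real.exp (β * h) := by
        rw [add_comm]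
        exact Real.add_one_le_exp _
      have e2 : 1 ≤ Real.exp (β * (i * h + h)) := Real.one_le_exp (by positivity)
      have e3 : Real.exp (β * (i * h + h)) = Real.exp (β * (i * h)) * Real.exp (β * h) := by
        rw [← Real.exp_add]
        ring_nf
      have e4 : 0 ≤ |K| * h ^ 2 := by positivity
      calc _ ≤ Real.exp (β * (i * h)) * (z + i * (|K| * h ^ 2)) * Real.exp (β * h) +
            Real.exp (β * (i * h + h)) * (|K| * h ^ 2) := by
            refine add_le_add (mul_le_mul_of_nonneg_left e1 (by positivity)) ?_
            exact (mul_le_mul_of_nonneg_right (le_abs_self K) (by positivity)).trans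
              (le_mul_of_one_le_left e4 e2)
        _ = _ := by
            rw [e3]
            push_cast
            ring
  -- With n + 1 equal steps the accumulated quadratic errors are |K|T²/(n+1) times the exponential,
  -- and vanish in the limit.
  have hn : ∀ n : ℕ, SemiclassicalBound ε (fun j => φ j (σ * T))
      (Real.exp (β * T) * (z + |K| * T ^ 2 * ((n + 1 : ℕ) : ℝ)⁻¹)) := fun n => by
    have hn0 : ((n + 1 : ℕ) : ℝ) ≠ 0 := by positivity
    have e1 : ((n + 1 : ℕ) : ℝ) * (T / (n + 1 : ℕ)) = T := mul_div_cancel₀ T hn0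
    have h1 := hiter (T / (n + 1 : ℕ)) (by positivity) (n + 1) e1.le
    rw [e1] at h1
    convert h1 using 3
    field_simp
  refine SemiclassicalBound.of_tendsto hn ?_
  have h1 := (tendsto_inv_atTop_nhds_zero_nat (𝕜 := ℝ)).comp (tendsto_add_atTop_nat 1)
  simpa using ((h1.const_mul (|K| * T ^ 2)).const_add z).const_mul (Real.exp (β * T))

/-- The four summands 4, 4Λ³(1+a)T, 4Λ⁴T² and 2T cost 4, 2, 4 and 1 multiples of Λ⁴(1+a)(1+T²),
whence 11. The extra 4 leaves room for numerical prefactors. -/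
theorem exponent_le {Λ a T : ℝ} (hΛ : 1 ≤ Λ) (ha : 0 ≤ a) (hT : 0 ≤ T) :
    4 + (4 * Λ ^ 3 * (1 + a + Λ * T) + 2) * T ≤ 11 * Λ ^ 4 * (1 + a) * (1 + T ^ 2) := by
  have hΛ0 : 0 ≤ Λ := zero_le_one.trans hΛ
  have h2T : 2 * T ≤ 1 + T ^ 2 := by nlinarith [sq_nonneg (T - 1)]
  have h4 : 1 ≤ Λ ^ 4 := one_le_pow₀ hΛ
  have h3 : Λ ^ 3 ≤ Λ ^ 4 := pow_le_pow_right₀ hΛ (by norm_num)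
  have hX : 1 + T ^ 2 ≤ Λ ^ 4 * (1 + a) * (1 + T ^ 2) :=
    le_mul_of_one_le_left (by positivity) (one_le_mul_of_one_le_of_one_le h4 (by linarith))
  have h5 : 2 * (Λ ^ 3 * (1 + a)) * (2 * T) ≤ 2 * (Λ ^ 4 * (1 + a)) * (1 + T ^ 2) := by gcongr
  have h6 : Λ ^ 4 * 1 * T ^ 2 ≤ Λ ^ 4 * (1 + a) * (1 + T ^ 2) := by
    gcongr <;> linarith
  nlinarith [sq_nonneg T]

end Propagation

end SKG

/-! ### Assembly of the constants -/

open SKG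
theorem lemma4p1 :
    ∃ C : ℝ, 0 < C ∧
      ∀ (N : ℕ) (δ m Λ : ℝ), 0 < N → 0 < δ → 0 ≤ m → 1 ≤ Λ →
      ∀ (I : Set ℝ), I.OrdConnected → (0 : ℝ) ∈ I →
      ∀ (φ : Fin N → ℝ → SKG.L2) (α : ℝ → SKG.L2),
        SKG.IsSolution N δ m Λ I φ α →
        Orthonormal ℂ (fun j => φ j 0) →
      ∀ Ctilde : ℝ, 0 < Ctilde →
        (∀ k : SKG.E3, SKG.traceNorm (SKG.projExp (fun j => φ j 0) k) ≤
          ENNReal.ofReal (Ctilde * (1 + ‖k‖) * (N : ℝ) ^ (2 / 3 : ℝ))) →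
        SKG.traceNorm (SKG.projGrad (fun j => φ j 0)) ≤ ENNReal.ofReal (Ctilde * N) →
      ∀ t ∈ I,
        (∀ k : SKG.E3,
          SKG.hsNorm (SKG.projExp (fun j => φ j t) k) ^ 2 ≤
              SKG.traceNorm (SKG.projExp (fun j => φ j t) k) ∧
          SKG.traceNorm (SKG.projExp (fun j => φ j t) k) ≤
            ENNReal.ofReal (2 * Ctilde * (1 + ‖k‖) * (N : ℝ) ^ (2 / 3 : ℝ) *
              Real.exp (C * Λ ^ 4 * (1 + ‖α 0‖) * (1 + t ^ 2)))) ∧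
        SKG.traceNorm (SKG.projGrad (fun j => φ j t)) ≤
          ENNReal.ofReal (2 * Ctilde * N *
            Real.exp (C * Λ ^ 4 * (1 + ‖α 0‖) * (1 + t ^ 2))) := by
  refine ⟨11, by norm_num, fun N δ m Λ hN _ _ hΛ1 I hIc hI0 φ α hsol h0 c hc hexp hgrad t ht => ?_⟩
  have hΛ : 0 ≤ Λ := zero_le_one.trans hΛ1
  have hN' : (0 : ℝ) < N := Nat.cast_pos.mpr hN
  -- Negative times are treated by running the evolution forward in s with t = σ|t|.
  obtain ⟨σ, hσ, hσt⟩ : ∃ σ : ℝ, |σ| = 1 ∧ σ * |t| = t := by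
    rcases le_total 0 t with h | h
    · exact ⟨1, abs_one, by rw [one_mul, abs_of_nonneg h]⟩
    · exact ⟨-1, by simp, by rw [abs_of_nonpos h]; ring⟩
  have hI : ∀ s ∈ Set.Icc 0 |t|, σ * s ∈ I := by
    intro s hs
    have hmem : ∀ x ∈ Set.uIcc 0 t, x ∈ I := fun x hx => hIc.uIcc_subset hI0 ht hx
    refine hmem _ ?_
    rcases (abs_eq zero_le_one).mp hσ with rfl | rfl
    · rw [one_mul] at hσt ⊢
      rw [← hσt, Set.uIcc_of_le (abs_nonneg t)]
      exact hs
    · rw [← hσt, Set.uIcc_of_ge (by linarith [abs_nonneg t])]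
      exact ⟨by linarith [hs.2], by linarith [hs.1]⟩
  set ε := (N : ℝ) ^ (-(1 / 3) : ℝ) with hε
  have hNε : (N : ℝ) ^ (2 / 3 : ℝ) = N * ε := by
    rw [hε, ← Real.rpow_one_add' hN'.le (by norm_num)]
    norm_num
  have hε0 : 0 < ε := by positivity
  have htmem : |t| ∈ Set.Icc 0 |t| := ⟨abs_nonneg t, le_rfl⟩
  have hA : ∀ s ∈ Set.Icc 0 |t|, ‖α (σ * s)‖ ≤ 1 + ‖α 0‖ + Λ * |t| := fun s hs =>
    (norm_field_le hsol hN hΛ hσ hI h0 hs).trans (by have := hs.2; gcongr)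
  -- The factor 3 is forced by the passage from ∇ to translations; for plane waves it is slack.
  have hinit : SemiclassicalBound ε (fun j => φ j 0) (3 * c) := by
    refine ⟨fun k => ?_, fun a => ?_⟩
    · have h1 : TraceLE (offDiag (fun j => φ j 0) (expMul k)) _ := ⟨by positivity, hexp k⟩
      refine h1.toReal_le.trans ?_
      rw [hNε]
      have : 0 ≤ c * (1 + ‖k‖) * (N * ε) := by positivity
      linarith
    · have h1 := traceLE_offGrad_of_projGrad ⟨by positivity, hgrad⟩ a
      refine (offNorm_transl_le_of_offGrad h0 (fun j => hsol.memH2 j 0 hI0) h1).trans_eq ?_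
      ring
  have hfin := semiclassicalBound_solution hsol hN hΛ1 hσ hε (abs_nonneg t) hI h0 hA
    (by positivity) hinit
  have hon := orthonormal_solution hsol hN hΛ hI h0 htmem
  rw [hσt] at hfin hon
  set X := (4 * Λ ^ 3 * (1 + ‖α 0‖ + Λ * |t|) + 2) * |t| with hX
  set Y := 11 * Λ ^ 4 * (1 + ‖α 0‖) * (1 + t ^ 2) with hY
  -- Returning from components to p∇q costs another 3, so 9e^X has to be at most 2e^Y; e^4 ≥ 5 gives
  -- 10e^X ≤ 2e^Y.
  have hXY : 5 * Real.exp X ≤ Real.exp Y := by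
    have h1 : 4 + X ≤ Y := by
      have := exponent_le hΛ1 (norm_nonneg (α 0)) (abs_nonneg t)
      rwa [sq_abs] at this
    refine le_trans ?_ (Real.exp_le_exp.mpr h1)
    rw [Real.exp_add]
    gcongr
    linarith [Real.add_one_le_exp (4 : ℝ)]
  have hexpX := Real.exp_pos X
  refine ⟨fun k => ⟨?_, ?_⟩, ?_⟩
  · refine hsNorm_sq_le_traceNorm _ ?_
    refine (ContinuousLinearMap.opNorm_comp_le _ _).trans
      (mul_le_one₀ (norm_spanProj_le hon) (norm_nonneg _) ?_)
    exact (ContinuousLinearMap.opNorm_comp_le _ _).trans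
      (mul_le_one₀ (norm_expMul_le k) (norm_nonneg _) (norm_one_sub_spanProj_le hon))
  · refine ((traceLE_offDiag hon (expMul k)).mono ((hfin.1 k).trans ?_)).2
    rw [hNε]
    have h1 : 0 ≤ c * (1 + ‖k‖) * (N * ε) := by positivity
    nlinarith [mul_le_mul_of_nonneg_left hXY h1, mul_nonneg h1 hexpX.le]
  · have h1 : ∀ l, TraceLE (projPartial (fun j => φ j t) l ∘L coproj (fun j => φ j t))
        (Real.exp X * (3 * c) * N) := fun l => by
      rw [← offGrad_single]
      refine traceLE_offGrad_of_offNorm_transl hon (fun j => hsol.memH2 j t ht) fun s hs => ?_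
      refine (hfin.2 _).trans_eq ?_
      rw [norm_smul, Real.norm_of_nonneg hs.le, PiLp.norm_single, norm_one]
      ring
    refine ((traceLE_projGrad_of_projPartial h1).mono ?_).2
    have h2 : 0 ≤ c * N := by positivity
    nlinarith [mul_le_mul_of_nonneg_left hXY h2, mul_nonneg h2 hexpX.le]

end
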